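/- Let $d\ge 2$, let $B_r=\{x\in\mathbb R^d : |x|<r\}$ for $r>0$, and let $\mathcal H(B_1)=\{u\in L^2(B_1;\mathbb C) : \Delta u=0 \text{ in } B_1\}$ (in the sense of distributions), a closed subspace of $L^2(B_1)$; let $P$ be the orthogonal projection of $L^2(B_1)$ onto $\mathcal H(B_1)$. Let $V\in L^\infty(B_1)$ be real-valued with $V\ge 0$ almost everywhere, and assume that for some $c\in(0,1)$ the essential support of $V$ is the closed ball $\overline{B_c}$, and that $\operatorname{ess\,inf}_{x\in B_\delta}V(x)>0$ for every $\delta\in(0,c)$. Then the harmonic Toeplitz operator $T_V=PV:\mathcal H(B_1)\to\mathcal H(B_1)$ is self-adjoint and compact, and, writing $n_+(\lambda;T_V)$ for the number of eigenvalues of $T_V$ larger than $\lambda>0$, counted with multiplicities, $$\lim_{\lambda\downarrow 0}|\ln\lambda|^{-d+1}\,n_+(\lambda;T_V)=\frac{2^{-d+2}}{(d-1)!\,|\ln c|^{d-1}}.$$ -/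

import Mathlib

open MeasureTheory Filter Topology Set
open scoped ENNReal ContDiff

noncomputable section

namespace HarmonicToeplitz

variable {d : ℕ}

/-- Lebesgue measure on a subset `Ω` of `ℝ^d`. -/
abbrev lebesgueOn (Ω : Set (EuclideanSpace ℝ (Fin d))) : Measure (EuclideanSpace ℝ (Fin d)) :=
  volume.restrict Ω

/-- `φ` is a test function on `Ω`, i.e. an element of `C_c^∞(Ω; ℂ)`. -/
structure IsTestFunction (Ω : Set (EuclideanSpace ℝ (Fin d)))
    (φ : EuclideanSpace ℝ (Fin d) → ℂ) : Prop where
  contDiff : ContDiff ℝ ∞ φ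
  hasCompactSupport : HasCompactSupport φ
  tsupport_subset : tsupport φ ⊆ Ω

theorem memLp_laplacian {Ω : Set (EuclideanSpace ℝ (Fin d))}
    {φ : EuclideanSpace ℝ (Fin d) → ℂ} (hφ : IsTestFunction Ω φ) :
    MemLp (Laplacian.laplacian φ) 2 (lebesgueOn Ω) := by
  have h : Laplacian.laplacian φ = fun x => ∑ i, iteratedFDeriv ℝ 2 φ x
      ![(EuclideanSpace.basisFun (Fin d) ℝ) i, (EuclideanSpace.basisFun (Fin d) ℝ) i] :=
    InnerProductSpace.laplacian_eq_iteratedFDeriv_orthonormalBasis φ _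
  have h2 : (2 : WithTop ℕ∞) ≤ ((⊤ : ℕ∞) : WithTop ℕ∞) := WithTop.coe_le_coe.2 le_top
  have hc : Continuous (iteratedFDeriv ℝ 2 φ) := hφ.contDiff.continuous_iteratedFDeriv h2
  have hcs : HasCompactSupport (iteratedFDeriv ℝ 2 φ) := hφ.hasCompactSupport.iteratedFDeriv 2
  refine Continuous.memLp_of_hasCompactSupport ?_ ?_
  · rw [h]
    exact continuous_finsetSum _ fun i _ =>
      (ContinuousMultilinearMap.apply ℝ (fun _ : Fin 2 => EuclideanSpace ℝ (Fin d)) ℂ _).continuous.comp hc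
  · refine hcs.mono fun x hx h0 => hx ?_
    rw [h]
    simp [h0]

/-- The harmonic subspace `𝓗(Ω) = {u ∈ L²(Ω) : Δu = 0 in Ω}`, the equation `Δu = 0` being
understood in the sense of distributions. -/
def harmonicL2 (Ω : Set (EuclideanSpace ℝ (Fin d))) : Submodule ℂ (Lp ℂ 2 (lebesgueOn Ω)) where
  carrier := {u | ∀ φ : EuclideanSpace ℝ (Fin d) → ℂ, IsTestFunction Ω φ →
    ∫ x in Ω, u x * Laplacian.laplacian φ x = 0}
  zero_mem' := by
    intro φ _
    refine integral_eq_zero_of_ae ?_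
    filter_upwards [Lp.coeFn_zero ℂ 2 (lebesgueOn Ω)] with x hx
    rw [hx, Pi.zero_apply, zero_mul]
  add_mem' := by
    intro u v hu hv φ hφ
    have hL := memLp_laplacian hφ
    calc ∫ x in Ω, (u + v) x * Laplacian.laplacian φ x
        = ∫ x in Ω, (u x * Laplacian.laplacian φ x + v x * Laplacian.laplacian φ x) := by
          refine integral_congr_ae ?_
          filter_upwards [Lp.coeFn_add u v] with x hx
          rw [hx, Pi.add_apply, add_mul]
      _ = 0 := by
          refine (integral_add ((Lp.memLp u).integrable_mul hL)
            ((Lp.memLp v).integrable_mul hL)).trans ?_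
          exact (congrArg₂ (· + ·) (hu φ hφ) (hv φ hφ)).trans (add_zero 0)
  smul_mem' := by
    intro a u hu φ hφ
    calc ∫ x in Ω, (a • u) x * Laplacian.laplacian φ x
        = ∫ x in Ω, a * (u x * Laplacian.laplacian φ x) := by
          refine integral_congr_ae ?_
          filter_upwards [Lp.coeFn_smul a u] with x hx
          rw [hx, Pi.smul_apply, smul_eq_mul, mul_assoc]
      _ = 0 := by rw [integral_const_mul, hu φ hφ, mul_zero]

theorem isClosed_harmonicL2 (Ω : Set (EuclideanSpace ℝ (Fin d))) :
    IsClosed (harmonicL2 Ω : Set (Lp ℂ 2 (lebesgueOn Ω))) := by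
  have h : (harmonicL2 Ω : Set (Lp ℂ 2 (lebesgueOn Ω))) =
      ⋂ (φ : EuclideanSpace ℝ (Fin d) → ℂ) (hφ : IsTestFunction Ω φ),
        {u | inner ℂ ((memLp_laplacian hφ).star.toLp _) u = 0} := by
    ext u
    simp only [mem_iInter, mem_ofPred_eq]
    refine forall_congr' fun φ => forall_congr' fun hφ => ?_
    rw [L2.inner_def]
    refine Eq.congr_left (integral_congr_ae ?_)
    filter_upwards [(memLp_laplacian hφ).star.coeFn_toLp] with x hx
    simp [hx]
  rw [h]
  exact isClosed_iInter fun φ => isClosed_iInter fun hφ =>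
    isClosed_eq (continuous_const.inner continuous_id) continuous_const

instance (Ω : Set (EuclideanSpace ℝ (Fin d))) : CompleteSpace (harmonicL2 Ω) :=
  (isClosed_harmonicL2 Ω).completeSpace_coe

/-- Multiplication by a bounded function `V`, as a bounded operator on `L²(Ω)`. -/
def mulOperator {Ω : Set (EuclideanSpace ℝ (Fin d))} {V : EuclideanSpace ℝ (Fin d) → ℂ}
    (hV : MemLp V ∞ (lebesgueOn Ω)) : Lp ℂ 2 (lebesgueOn Ω) →L[ℂ] Lp ℂ 2 (lebesgueOn Ω) :=
  (ContinuousLinearMap.mul ℂ ℂ).holderL (lebesgueOn Ω) ∞ 2 2 (hV.toLp V)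

/-- The harmonic Toeplitz operator `T_V = P V : 𝓗(Ω) → 𝓗(Ω)` with bounded symbol `V`, where `P` is
the orthogonal projection of `L²(Ω)` onto `𝓗(Ω)`. -/
def toeplitz {Ω : Set (EuclideanSpace ℝ (Fin d))} {V : EuclideanSpace ℝ (Fin d) → ℂ}
    (hV : MemLp V ∞ (lebesgueOn Ω)) : harmonicL2 Ω →L[ℂ] harmonicL2 Ω :=
  (harmonicL2 Ω).orthogonalProjectionOnto ∘L mulOperator hV ∘L (harmonicL2 Ω).subtypeL

/-- The eigenvalue counting function `n_+(s; T)` of a compact self-adjoint operator `T`: the number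
of eigenvalues of `T` larger than `s`, counted with multiplicity, i.e. the dimension of the span of
all eigenspaces of `T` for eigenvalues in `(s, ∞)`. For compact self-adjoint `T` and `s > 0` that
span is the (finite-dimensional) range of the spectral projection of `T` for `(s, ∞)`. -/
def nPlus {H : Type*} [NormedAddCommGroup H] [InnerProductSpace ℂ H] (s : ℝ) (T : H →L[ℂ] H) : ℕ :=
  Module.finrank ℂ
    (⨆ μ : Ioi s, Module.End.eigenspace (T : H →ₗ[ℂ] H) ((μ : ℝ) : ℂ) : Submodule ℂ H)

/-- The (essential) support of a class of functions modulo equality almost everywhere: the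
complement of the largest open set on which `f` vanishes almost everywhere. -/
def essSupport {X : Type*} [TopologicalSpace X] [MeasurableSpace X] (μ : Measure X) (f : X → ℝ) :
    Set X :=
  {x | ∀ U ∈ 𝓝 x, ¬ f =ᵐ[μ.restrict U] 0}

end HarmonicToeplitz

end

/-! The quadratic form of `T_V` at a harmonic `u` is `∫ V|u|²`. Since `0 ≤ V ≤ M` and `V` vanishes
a.e. outside `B_c`, it is at most `M c^d E(c)`; since `V ≥ a > 0` on `B_δ`, `δ < c`, it is at least
`a δ^d E(δ)`. Here `E(t) = ∫_{B_1} |u(tx)|² dx` is the `energy`. Everything rests on how `E(t)`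
decays as `t` decreases from 1.

Spherical harmonics are replaced by one symmetry: `∫ f(x) g(τx) = ∫ f(τx) g(x)` over `B_1` for
harmonic `f`, `g` (`integral_mul_dilation`). With Cauchy–Schwarz it gives `E(t)² ≤ E(1) E(t²)`, so
`E` is log-convex along geometric sequences of radii. A log-convex sequence bounded by `C qⁿ` has
first ratio at most `q` (`le_mul_of_logConvex`), with no constant left. Going inwards, vanishing of
order `K` at the origin yields `E(c) ≤ c^{2K} E(1)` (`energy_le_of_isBigO`). Going outwards, a
harmonic polynomial of degree at most `N` satisfies `E(δ) ≥ δ^{2N} E(1)` (`le_energy_of_growth`).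

The symmetry comes from the kernel `σ^d h(σy) w(σ²y)` with `h` radial and `w` harmonic: its
`σ`-derivative is a Laplacian in `y`, so its integral against a weakly harmonic function does not
depend on `σ` (`integral_meanKernel_eq`). Taking `w = 1` gives the mean value property and hence
Weyl's lemma (`exists_harmonicOnBall_ae_eq`), which supplies smooth representatives. Taking `w =
g(τ·)` and comparing `σ = 1` with `σ = 1/τ` gives the symmetry.

It remains to count, with `d = m + 1`. Derivatives at 0 of order at most one in the first variable
determine the jet of a harmonic function, so vanishing to order `K + 1` costs at most about
`2K^m/m!` linear conditions (`finrank_jets_le`). Rank–nullity for the Laplacian gives at least about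
`2N^m/m!` independent harmonic polynomials (`le_finrank_harmonicPolynomial`). Glazman's variational
principle (`nPlus_le_finrank`, `finrank_le_nPlus`) turns these into bounds for `n_+(s)`, with `K ≈
|ln s|/(2|ln c|)` and `N ≈ |ln s|/(2γ)`, `γ > |ln c|`. Letting `γ ↓ |ln c|` gives the limit.
Compactness holds because `T_V` is small on the finite-codimensional space where the jet vanishes.
-/

namespace HarmonicToeplitz

variable {d : ℕ}

/-! ### Variational bounds for counting eigenvalues; a compactness criterion -/

section Spectral

variable {H : Type*} [NormedAddCommGroup H] [InnerProductSpace ℂ H]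

theorem norm_sq_sum_eigenvectors {ι : Type*} {T : H →L[ℂ] H} (hT : (T : H →ₗ[ℂ] H).IsSymmetric)
    {μ : ι → ℂ} (hμ : Function.Injective μ) {f : ι → H}
    (hf : ∀ i, f i ∈ Module.End.eigenspace (T : H →ₗ[ℂ] H) (μ i)) (s : Finset ι) :
    ‖∑ i ∈ s, f i‖ ^ 2 = ∑ i ∈ s, ‖f i‖ ^ 2 :=
  (hT.orthogonalFamily_eigenspaces.comp hμ).norm_sum (fun i => ⟨f i, hf i⟩) s

theorem re_inner_sum_eigenvectors {ι : Type*} {T : H →L[ℂ] H}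
    (hT : (T : H →ₗ[ℂ] H).IsSymmetric)
    {μ : ι → ℂ} (hμ : Function.Injective μ) {f : ι → H}
    (hf : ∀ i, f i ∈ Module.End.eigenspace (T : H →ₗ[ℂ] H) (μ i)) (s : Finset ι) :
    (inner ℂ (∑ i ∈ s, f i) (T (∑ i ∈ s, f i))).re = ∑ i ∈ s, (μ i).re * ‖f i‖ ^ 2 := by
  have hTf : ∀ i, T (f i) = μ i • f i := fun i => Module.End.mem_eigenspace_iff.1 (hf i)
  have h := (hT.orthogonalFamily_eigenspaces.comp hμ).inner_sum (fun i => ⟨f i, hf i⟩)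
    (fun i => μ i • ⟨f i, hf i⟩) s
  have h' : inner ℂ (∑ i ∈ s, f i) (∑ i ∈ s, μ i • f i) =
      ∑ i ∈ s, inner ℂ (f i) (μ i • f i) := h
  rw [map_sum, Finset.sum_congr rfl fun i _ => hTf i, h', Complex.re_sum]
  refine Finset.sum_congr rfl fun i _ => ?_
  rw [inner_smul_right, inner_self_eq_norm_sq_to_K]
  change (μ i * ((‖f i‖ : ℝ) : ℂ) ^ 2).re = _
  rw [← Complex.ofReal_pow, Complex.re_mul_ofReal]

/-- The span of the eigenspaces of `T` for real eigenvalues larger than `s`. -/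
abbrev upperSpace (s : ℝ) (T : H →L[ℂ] H) : Submodule ℂ H :=
  ⨆ μ : Ioi s, Module.End.eigenspace (T : H →ₗ[ℂ] H) ((μ : ℝ) : ℂ)

/-- Eigenspaces of a symmetric operator are orthogonal, so norm and quadratic form are both diagonal
in the eigenvector expansion; a nonzero vector has a nonempty expansion, which makes the inequality
strict. -/
theorem lt_re_inner_of_mem_upperSpace {s : ℝ} {T : H →L[ℂ] H}
    (hT : (T : H →ₗ[ℂ] H).IsSymmetric) {u : H} (hu : u ∈ upperSpace s T) (hu0 : u ≠ 0) :
    s * ‖u‖ ^ 2 < (inner ℂ u (T u)).re := by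
  obtain ⟨f, hf, rfl⟩ := (Submodule.mem_iSup_iff_exists_finsupp _ _).1 hu
  have hinj : Function.Injective fun μ : Ioi s => ((μ : ℝ) : ℂ) :=
    Complex.ofReal_injective.comp Subtype.coe_injective
  have h1 := norm_sq_sum_eigenvectors hT hinj hf f.support
  have h2 := re_inner_sum_eigenvectors hT hinj hf f.support
  rw [show (f.sum fun i xi => xi) = ∑ i ∈ f.support, f i from rfl] at *
  rw [h1, h2, Finset.mul_sum]
  refine Finset.sum_lt_sum_of_nonempty ?_ fun i hi => ?_
  · by_contra h
    rw [Finset.not_nonempty_iff_eq_empty] at h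
    simp [h] at hu0
  · have : f i ≠ 0 := Finsupp.mem_support_iff.1 hi
    have h3 : 0 < ‖f i‖ ^ 2 := by positivity
    exact mul_lt_mul_of_pos_right i.2 h3

/-- Upper half of Glazman's principle: a nonzero vector of the upper space killed by `Λ` would
satisfy two contradictory bounds on the form. -/
theorem disjoint_upperSpace_ker {s : ℝ} {T : H →L[ℂ] H} (hT : (T : H →ₗ[ℂ] H).IsSymmetric)
    {F : Type*} [AddCommGroup F] [Module ℂ F] (Λ : H →ₗ[ℂ] F)
    (h : ∀ u, Λ u = 0 → (inner ℂ u (T u)).re ≤ s * ‖u‖ ^ 2) :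
    Function.Injective (Λ.domRestrict (upperSpace s T)) := by
  rw [← LinearMap.ker_eq_bot, LinearMap.ker_eq_bot']
  rintro ⟨u, hu⟩ hΛ
  by_contra hne
  have hu0 : u ≠ 0 := fun h0 => hne (by simp [h0])
  exact absurd (h u hΛ) (not_le.2 (lt_re_inner_of_mem_upperSpace hT hu hu0))

/-- `nPlus` is a `finrank`, hence zero on an infinite-dimensional span; lower bounds for it need
this finiteness first. -/
theorem finiteDimensional_upperSpace {s : ℝ} {T : H →L[ℂ] H}
    (hT : (T : H →ₗ[ℂ] H).IsSymmetric)
    {F : Type*} [AddCommGroup F] [Module ℂ F] [FiniteDimensional ℂ F] (Λ : H →ₗ[ℂ] F)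
    (h : ∀ u, Λ u = 0 → (inner ℂ u (T u)).re ≤ s * ‖u‖ ^ 2) :
    FiniteDimensional ℂ (upperSpace s T) :=
  FiniteDimensional.of_injective _ (disjoint_upperSpace_ker hT Λ h)

theorem nPlus_le_finrank {s : ℝ} {T : H →L[ℂ] H} (hT : (T : H →ₗ[ℂ] H).IsSymmetric)
    {F : Type*} [AddCommGroup F] [Module ℂ F] [FiniteDimensional ℂ F] (Λ : H →ₗ[ℂ] F)
    (h : ∀ u, Λ u = 0 → (inner ℂ u (T u)).re ≤ s * ‖u‖ ^ 2) :
    nPlus s T ≤ Module.finrank ℂ F :=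
  LinearMap.finrank_le_finrank_of_injective (disjoint_upperSpace_ker hT Λ h)

/-- The span of the eigenspaces of `T` for eigenvalues that are not real numbers larger than `s`. -/
abbrev lowerSpace (s : ℝ) (T : H →L[ℂ] H) : Submodule ℂ H :=
  ⨆ μ : {μ : ℂ // ∀ r : ℝ, s < r → μ ≠ r}, Module.End.eigenspace (T : H →ₗ[ℂ] H) (μ : ℂ)

theorem re_inner_le_of_mem_lowerSpace {s : ℝ} {T : H →L[ℂ] H}
    (hT : (T : H →ₗ[ℂ] H).IsSymmetric) {u : H} (hu : u ∈ lowerSpace s T) :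
    (inner ℂ u (T u)).re ≤ s * ‖u‖ ^ 2 := by
  obtain ⟨f, hf, rfl⟩ := (Submodule.mem_iSup_iff_exists_finsupp _ _).1 hu
  have h1 := norm_sq_sum_eigenvectors hT Subtype.coe_injective hf f.support
  have h2 := re_inner_sum_eigenvectors hT Subtype.coe_injective hf f.support
  rw [show (f.sum fun i xi => xi) = ∑ i ∈ f.support, f i from rfl] at *
  rw [h1, h2, Finset.mul_sum]
  refine Finset.sum_le_sum fun i hi => mul_le_mul_of_nonneg_right ?_ (by positivity)
  have hne : f i ≠ 0 := Finsupp.mem_support_iff.1 hi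
  have hconj := hT.conj_eigenvalue_eq_self
    (Module.End.hasEigenvalue_of_hasEigenvector ⟨hf i, hne⟩)
  obtain ⟨r, hr⟩ := Complex.conj_eq_iff_real.1 hconj
  by_contra hlt
  rw [hr, Complex.ofReal_re, not_le] at hlt
  exact i.2 r hlt hr

theorem isOrtho_upperSpace_lowerSpace {s : ℝ} {T : H →L[ℂ] H}
    (hT : (T : H →ₗ[ℂ] H).IsSymmetric) : upperSpace s T ⟂ lowerSpace s T := by
  rw [Submodule.isOrtho_iSup_left]
  intro μ
  rw [Submodule.isOrtho_iSup_right]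
  intro ν
  exact hT.orthogonalFamily_eigenspaces.isOrtho fun h => ν.2 μ μ.2 h.symm

/-- By the spectral theorem the upper and lower spaces together are dense. On their sum the
projection to the complement of the upper space lands in the lower space, where the bound is known;
the projected inequality is a closed condition, so it extends to every vector. -/
theorem re_inner_le_of_mem_orthogonal [CompleteSpace H] {s : ℝ} {T : H →L[ℂ] H}
    (hT : (T : H →ₗ[ℂ] H).IsSymmetric) (hc : IsCompactOperator T)
    [FiniteDimensional ℂ (upperSpace s T)] {u : H} (hu : u ∈ (upperSpace s T)ᗮ) :
    (inner ℂ u (T u)).re ≤ s * ‖u‖ ^ 2 := by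
  set E := upperSpace s T with hE
  set G := lowerSpace s T with hG
  have hsup : (⨆ μ, Module.End.eigenspace (T : H →ₗ[ℂ] H) μ) ≤ E ⊔ G := by
    refine iSup_le fun μ => ?_
    by_cases h : ∀ r : ℝ, s < r → μ ≠ r
    · exact (le_iSup (fun μ : {μ : ℂ // ∀ r : ℝ, s < r → μ ≠ r} =>
        Module.End.eigenspace (T : H →ₗ[ℂ] H) (μ : ℂ)) ⟨μ, h⟩).trans le_sup_right
    · push Not at h
      obtain ⟨r, hr, rfl⟩ := h
      exact (le_iSup (fun μ : Ioi s =>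
        Module.End.eigenspace (T : H →ₗ[ℂ] H) ((μ : ℝ) : ℂ)) ⟨r, hr⟩).trans le_sup_left
  have htop : (E ⊔ G).topologicalClosure = ⊤ := by
    rw [Submodule.topologicalClosure_eq_top_iff, eq_bot_iff]
    refine (Submodule.orthogonal_le hsup).trans ?_
    rw [ContinuousLinearMap.orthogonalComplement_iSup_eigenspaces_eq_bot hc hT]
  have hGE : G ≤ Eᗮ := (isOrtho_upperSpace_lowerSpace hT).symm
  have hdense : Dense ((E ⊔ G : Submodule ℂ H) : Set H) :=
    (Submodule.dense_iff_topologicalClosure_eq_top).2 htop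
  have hP : Continuous fun v : H => Eᗮ.starProjection v := (Eᗮ.starProjection).continuous
  have hclosed : IsClosed {v : H | (inner ℂ (Eᗮ.starProjection v) (T (Eᗮ.starProjection v))).re
      ≤ s * ‖Eᗮ.starProjection v‖ ^ 2} :=
    isClosed_le (Complex.continuous_re.comp (hP.inner (T.continuous.comp hP)))
      (continuous_const.mul (hP.norm.pow 2))
  have hsub : ((E ⊔ G : Submodule ℂ H) : Set H) ⊆
      {v : H | (inner ℂ (Eᗮ.starProjection v) (T (Eᗮ.starProjection v))).re
        ≤ s * ‖Eᗮ.starProjection v‖ ^ 2} := by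
    intro v hv
    obtain ⟨e, he, g, hg, rfl⟩ := Submodule.mem_sup.1 hv
    have : Eᗮ.starProjection (e + g) = g := by
      rw [map_add, Submodule.starProjection_eq_self_iff.2 (hGE hg)]
      rw [(Submodule.starProjection_apply_eq_zero_iff _).2 (by simpa using he), zero_add]
    simp only [mem_ofPred_eq, this]
    exact re_inner_le_of_mem_lowerSpace hT hg
  have hall := hclosed.closure_subset_iff.2 hsub
  have := hall (hdense.closure_eq ▸ mem_univ u)
  rwa [mem_ofPred_eq, Submodule.starProjection_eq_self_iff.2 hu] at this

/-- Lower half of Glazman's principle: a trial vector whose projection to the upper space vanishes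
is orthogonal to it and violates the strict bound. Injectivity of `L` is implicit, since the strict
bound fails when `L p = 0`. -/
theorem finrank_le_nPlus [CompleteSpace H] {s : ℝ} {T : H →L[ℂ] H}
    (hT : (T : H →ₗ[ℂ] H).IsSymmetric) (hc : IsCompactOperator T)
    [FiniteDimensional ℂ (upperSpace s T)] {F : Type*} [AddCommGroup F] [Module ℂ F]
    (L : F →ₗ[ℂ] H) (h : ∀ p, p ≠ 0 → s * ‖L p‖ ^ 2 < (inner ℂ (L p) (T (L p))).re) :
    Module.finrank ℂ F ≤ nPlus s T := by
  let Q : F →ₗ[ℂ] upperSpace s T :=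
    ((upperSpace s T).orthogonalProjectionOnto : H →ₗ[ℂ] upperSpace s T) ∘ₗ L
  refine LinearMap.finrank_le_finrank_of_injective (f := Q) ?_
  rw [← LinearMap.ker_eq_bot, LinearMap.ker_eq_bot']
  intro p hp
  by_contra hne
  refine absurd (h p hne) (not_lt.2 (re_inner_le_of_mem_orthogonal hT hc ?_))
  exact Submodule.orthogonalProjectionOnto_eq_zero_iff.1 hp

/-- Such a `T` is a norm limit of finite-rank operators. No continuity of `Λ` is assumed, so its
kernel is replaced by the closure, to which the norm bound extends. -/
theorem isCompactOperator_of_small_on_ker [CompleteSpace H] {T : H →L[ℂ] H}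
    (h : ∀ ε > 0, ∃ n : ℕ, ∃ Λ : H →ₗ[ℂ] (Fin n → ℂ), ∀ u, Λ u = 0 → ‖T u‖ ≤ ε * ‖u‖) :
    IsCompactOperator T := by
  have hcl := isClosed_setOfPred_isCompactOperator (σ₁₂ := RingHom.id ℂ) (M₁ := H) (M₂ := H)
  refine hcl.closure_subset (Metric.mem_closure_iff.2 fun ε hε => ?_)
  obtain ⟨n, Λ, hΛ⟩ := h (ε / 2) (half_pos hε)
  set Z := (LinearMap.ker Λ).topologicalClosure with hZ
  have hZc : IsClosed (Z : Set H) := Submodule.isClosed_topologicalClosure _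
  have : CompleteSpace Z := hZc.completeSpace_coe
  have hle : ∀ u ∈ Z, ‖T u‖ ≤ ε / 2 * ‖u‖ := by
    have hc : IsClosed {u : H | ‖T u‖ ≤ ε / 2 * ‖u‖} :=
      isClosed_le T.continuous.norm (continuous_const.mul continuous_norm)
    exact fun u hu => closure_minimal (s := (LinearMap.ker Λ : Set H))
      (fun v hv => hΛ v hv) hc hu
  have hinj : Function.Injective (Λ.domRestrict Zᗮ) := by
    rw [← LinearMap.ker_eq_bot, LinearMap.ker_eq_bot']
    rintro ⟨u, hu⟩ hu0
    have h1 : u ∈ Z := Submodule.le_topologicalClosure _ hu0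
    have : u = 0 := by
      have := Submodule.inner_right_of_mem_orthogonal h1 hu
      exact inner_self_eq_zero.1 this
    simp [this]
  have : FiniteDimensional ℂ Zᗮ := FiniteDimensional.of_injective _ hinj
  have : ProperSpace Zᗮ := FiniteDimensional.proper ℂ Zᗮ
  have hcomp : IsCompactOperator (T ∘L Zᗮ.subtypeL) :=
    isCompactOperator_of_locallyCompactSpace_rng (T ∘L Zᗮ.subtypeL)
  -- The approximant agrees with `T` on `Zᗮ` and kills `Z`, so the error is `T` composed with the
  -- projection onto `Z`.
  refine ⟨(T ∘L Zᗮ.subtypeL) ∘L Zᗮ.orthogonalProjectionOnto, hcomp.comp_clm _, ?_⟩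
  rw [dist_eq_norm]
  refine lt_of_le_of_lt (ContinuousLinearMap.opNorm_le_bound _ (half_pos hε).le fun u => ?_)
    (half_lt_self hε)
  have hsub : (T - (T ∘L Zᗮ.subtypeL) ∘L Zᗮ.orthogonalProjectionOnto) u
      = T (Z.starProjection u) := by
    have := Submodule.starProjection_add_starProjection_orthogonal (K := Z) u
    conv_lhs => rw [← this]
    simp only [sub_apply, ContinuousLinearMap.comp_apply]
    rw [this, ← map_sub]
    congr 1
    rw [sub_eq_iff_eq_add]
    exact this.symm
  rw [hsub]
  refine (hle _ (Submodule.starProjection_apply_mem _ _)).trans ?_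
  exact mul_le_mul_of_nonneg_left (Submodule.norm_starProjection_apply_le _ _) (half_pos hε).le

end Spectral

/-! ### Log-convex sequences -/

/-- A nonnegative log-convex sequence that is `O(qⁿ)` starts with a ratio at most `q`. -/
theorem le_mul_of_logConvex {f : ℕ → ℝ} (hf : ∀ n, 0 ≤ f n)
    (hlog : ∀ n, f (n + 1) ^ 2 ≤ f n * f (n + 2)) {q C : ℝ} (hq : 0 < q)
    (hC : ∀ᶠ n in atTop, f n ≤ C * q ^ n) : f 1 ≤ q * f 0 := by
  by_contra! hlt
  have h1 : 0 < f 1 := lt_of_le_of_lt (mul_nonneg hq.le (hf 0)) hlt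
  have h0 : 0 < f 0 := by
    refine lt_of_le_of_ne (hf 0) fun h => ?_
    have := hlog 0
    rw [← h, zero_mul] at this
    nlinarith [pow_pos h1 2]
  set r := f 1 / f 0 with hr
  have hqr : q < r := by rw [hr, lt_div_iff₀ h0]; exact hlt
  have hr0 : 0 < r := hq.trans hqr
  -- Log-convexity makes successive ratios nondecreasing, so all are at least the first one, `r >
  -- q`; the resulting growth `rⁿ` contradicts `O(qⁿ)`.
  have key : ∀ n, 0 < f n ∧ r * f n ≤ f (n + 1) := by
    intro n
    induction n with
    | zero => exact ⟨h0, by rw [hr, div_mul_cancel₀ _ h0.ne']⟩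
    | succ n ih =>
      have hp : 0 < f (n + 1) := lt_of_lt_of_le (mul_pos hr0 ih.1) ih.2
      refine ⟨hp, ?_⟩
      have h2 := hlog n
      have h3 : 0 ≤ f (n + 2) := hf _
      have : f n * (r * f (n + 1)) ≤ f n * f (n + 2) := by nlinarith
      exact le_of_mul_le_mul_left this ih.1
  have hpow : ∀ n, r ^ n * f 0 ≤ f n := by
    intro n
    induction n with
    | zero => simp
    | succ n ih =>
      calc r ^ (n + 1) * f 0 = r * (r ^ n * f 0) := by ring
        _ ≤ r * f n := mul_le_mul_of_nonneg_left ih hr0.le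
        _ ≤ _ := (key n).2
  have hone : 1 < r / q := (one_lt_div hq).2 hqr
  obtain ⟨n, hn, hCn⟩ :=
    (((tendsto_pow_atTop_atTop_of_one_lt hone).eventually_gt_atTop (C / f 0)).and hC).exists
  rw [div_pow, div_lt_div_iff₀ h0 (pow_pos hq n)] at hn
  linarith [hpow n]

/-! ### Calculus of coordinate partial derivatives and the Laplacian -/

/-- The `i`-th partial derivative. -/
noncomputable def partialDeriv (i : Fin d) (f : EuclideanSpace ℝ (Fin d) → ℂ) :
    EuclideanSpace ℝ (Fin d) → ℂ :=
  fun x => fderiv ℝ f x (EuclideanSpace.single i 1)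

/-- The Laplacian as the sum of the second partial derivatives. -/
noncomputable def coordLaplacian (f : EuclideanSpace ℝ (Fin d) → ℂ) :
    EuclideanSpace ℝ (Fin d) → ℂ :=
  fun x => ∑ i, partialDeriv i (partialDeriv i f) x

variable {f g : EuclideanSpace ℝ (Fin d) → ℂ} {x : EuclideanSpace ℝ (Fin d)}
  {U : Set (EuclideanSpace ℝ (Fin d))}

theorem fderiv_apply_eq_sum (f : EuclideanSpace ℝ (Fin d) → ℂ) (x v : EuclideanSpace ℝ (Fin d)) :
    fderiv ℝ f x v = ∑ i, (v i : ℂ) * partialDeriv i f x := by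
  conv_lhs => rw [← (EuclideanSpace.basisFun (Fin d) ℝ).sum_repr v, map_sum]
  simp [partialDeriv]

theorem ContDiffOn.partialDeriv (hf : ContDiffOn ℝ ∞ f U) (hU : IsOpen U) (i : Fin d) :
    ContDiffOn ℝ ∞ (partialDeriv i f) U :=
  (hf.fderiv_of_isOpen hU (m := ∞) (by simp)).clm_apply contDiffOn_const

theorem ContDiff.partialDeriv (hf : ContDiff ℝ ∞ f) (i : Fin d) :
    ContDiff ℝ ∞ (partialDeriv i f) :=
  (hf.fderiv_right (m := ∞) (by simp)).clm_apply contDiff_const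

theorem Filter.EventuallyEq.partialDeriv (h : f =ᶠ[𝓝 x] g) (i : Fin d) :
    partialDeriv i f =ᶠ[𝓝 x] partialDeriv i g :=
  h.fderiv.fun_comp fun L => L (EuclideanSpace.single i 1)

theorem Filter.EventuallyEq.coordLaplacian_eq (h : f =ᶠ[𝓝 x] g) :
    coordLaplacian f x = coordLaplacian g x :=
  Finset.sum_congr rfl fun i _ =>
    (Filter.EventuallyEq.partialDeriv (Filter.EventuallyEq.partialDeriv h i) i).eq_of_nhds

theorem laplacian_eq_coordLaplacian (hf : ContDiff ℝ ∞ f) :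
    Laplacian.laplacian f = coordLaplacian f := by
  rw [InnerProductSpace.laplacian_eq_iteratedFDeriv_orthonormalBasis f
    (EuclideanSpace.basisFun (Fin d) ℝ)]
  funext x
  refine Finset.sum_congr rfl fun i _ => ?_
  have h : DifferentiableAt ℝ (fderiv ℝ f) x :=
    (hf.fderiv_right (m := ∞) (by simp)).differentiable (by simp) x
  rw [iteratedFDeriv_two_apply]
  unfold partialDeriv
  rw [fderiv_clm_apply h (differentiableAt_const _)]
  simp

theorem partialDeriv_mul (hf : DifferentiableAt ℝ f x) (hg : DifferentiableAt ℝ g x) (i : Fin d) :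
    partialDeriv i (fun y => f y * g y) x =
      f x * partialDeriv i g x + g x * partialDeriv i f x := by
  simp only [partialDeriv]
  rw [fderiv_fun_mul hf hg]
  simp

theorem partialDeriv_add (hf : DifferentiableAt ℝ f x) (hg : DifferentiableAt ℝ g x) (i : Fin d) :
    partialDeriv i (fun y => f y + g y) x = partialDeriv i f x + partialDeriv i g x := by
  simp only [partialDeriv]
  rw [fderiv_fun_add hf hg]
  simp

theorem partialDeriv_const_mul (hf : DifferentiableAt ℝ f x) (a : ℂ) (i : Fin d) :
    partialDeriv i (fun y => a * f y) x = a * partialDeriv i f x := by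
  simp only [partialDeriv]
  rw [fderiv_const_mul hf]
  simp

theorem partialDeriv_comp_smul (f : EuclideanSpace ℝ (Fin d) → ℂ) (t : ℝ) (i : Fin d) :
    partialDeriv i (fun y => f (t • y)) = fun y => (t : ℂ) * partialDeriv i f (t • y) := by
  funext y
  simp [partialDeriv, fderiv_comp_smul]

theorem partialDeriv_comp_sub (f : EuclideanSpace ℝ (Fin d) → ℂ) (a : EuclideanSpace ℝ (Fin d))
    (i : Fin d) :
    partialDeriv i (fun y => f (y - a)) = fun y => partialDeriv i f (y - a) := by
  funext y
  simp [partialDeriv, fderiv_comp_sub]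

theorem partialDeriv_conj (f : EuclideanSpace ℝ (Fin d) → ℂ) (i : Fin d) :
    partialDeriv i (fun y => star (f y)) = fun y => star (partialDeriv i f y) := by
  funext y
  have : (fun y => star (f y)) = Complex.conjCLE ∘ f := rfl
  rw [partialDeriv, this, ContinuousLinearEquiv.comp_fderiv]
  rfl

theorem partialDeriv_const (c : ℂ) (i : Fin d) :
    partialDeriv i (fun _ : EuclideanSpace ℝ (Fin d) => c) = fun _ => 0 := by
  funext y
  simp [partialDeriv]

theorem partialDeriv_coord (i j : Fin d) (x : EuclideanSpace ℝ (Fin d)) :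
    partialDeriv i (fun y => ((y j : ℝ) : ℂ)) x = if i = j then 1 else 0 := by
  have : (fun y : EuclideanSpace ℝ (Fin d) => ((y j : ℝ) : ℂ)) =
      (Complex.ofRealCLM ∘L (EuclideanSpace.proj j : EuclideanSpace ℝ (Fin d) →L[ℝ] ℝ)) := rfl
  rw [partialDeriv, this, ContinuousLinearMap.fderiv]
  by_cases h : i = j <;> simp [h, eq_comm]

theorem contDiff_coord (j : Fin d) :
    ContDiff ℝ ∞ (fun y : EuclideanSpace ℝ (Fin d) => ((y j : ℝ) : ℂ)) :=
  (Complex.ofRealCLM ∘L (EuclideanSpace.proj j : EuclideanSpace ℝ (Fin d) →L[ℝ] ℝ)).contDiff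

theorem partialDeriv_comm (hf : ContDiffOn ℝ ∞ f U) (hU : IsOpen U) (hx : x ∈ U) (i j : Fin d) :
    partialDeriv i (partialDeriv j f) x = partialDeriv j (partialDeriv i f) x := by
  have hat : ContDiffAt ℝ ∞ f x := hf.contDiffAt (hU.mem_nhds hx)
  have h : DifferentiableAt ℝ (fderiv ℝ f) x :=
    (hat.fderiv_right (m := ∞) (by simp)).differentiableAt (by simp)
  have hs : IsSymmSndFDerivAt ℝ f x := hat.isSymmSndFDerivAt (by
    rw [minSmoothness_of_isRCLikeNormedField]
    exact WithTop.coe_le_coe.2 le_top)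
  unfold partialDeriv
  rw [fderiv_clm_apply h (differentiableAt_const _), fderiv_clm_apply h (differentiableAt_const _)]
  simpa using hs _ _

theorem coordLaplacian_mul (hf : ContDiff ℝ ∞ f) (hg : ContDiff ℝ ∞ g) (x) :
    coordLaplacian (fun y => f y * g y) x =
      f x * coordLaplacian g x + g x * coordLaplacian f x +
        2 * ∑ i, partialDeriv i f x * partialDeriv i g x := by
  have hf1 : Differentiable ℝ f := hf.differentiable (by simp)
  have hg1 : Differentiable ℝ g := hg.differentiable (by simp)
  have hf2 := fun i => (ContDiff.partialDeriv hf i).differentiable (by simp)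
  have hg2 := fun i => (ContDiff.partialDeriv hg i).differentiable (by simp)
  simp only [coordLaplacian, Finset.mul_sum, ← Finset.sum_add_distrib]
  refine Finset.sum_congr rfl fun i _ => ?_
  have : partialDeriv i (fun y => f y * g y) =
      fun y => f y * partialDeriv i g y + g y * partialDeriv i f y :=
    funext fun y => partialDeriv_mul (hf1 y) (hg1 y) i
  rw [this, partialDeriv_add ((hf1 x).fun_mul (hg2 i x)) ((hg1 x).fun_mul (hf2 i x)),
    partialDeriv_mul (hf1 x) (hg2 i x), partialDeriv_mul (hg1 x) (hf2 i x)]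
  ring

theorem coordLaplacian_comp_smul (hf : ContDiff ℝ ∞ f) (t : ℝ) :
    coordLaplacian (fun y => f (t • y)) = fun y => (t : ℂ) ^ 2 * coordLaplacian f (t • y) := by
  funext y
  simp only [coordLaplacian, Finset.mul_sum]
  refine Finset.sum_congr rfl fun i _ => ?_
  have hd : Differentiable ℝ fun y => partialDeriv i f (t • y) :=
    ((ContDiff.partialDeriv hf i).comp (contDiff_const_smul t)).differentiable (by simp)
  rw [partialDeriv_comp_smul, partialDeriv_const_mul (hd y), partialDeriv_comp_smul]
  ring

theorem coordLaplacian_comp_sub (f : EuclideanSpace ℝ (Fin d) → ℂ)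
    (a : EuclideanSpace ℝ (Fin d)) :
    coordLaplacian (fun y => f (y - a)) = fun y => coordLaplacian f (y - a) := by
  funext y
  simp only [coordLaplacian, partialDeriv_comp_sub]

theorem coordLaplacian_conj (f : EuclideanSpace ℝ (Fin d) → ℂ) :
    coordLaplacian (fun y => star (f y)) = fun y => star (coordLaplacian f y) := by
  funext y
  simp only [coordLaplacian, partialDeriv_conj, star_sum]

theorem coordLaplacian_const_mul (hf : ContDiff ℝ ∞ f) (a : ℂ) :
    coordLaplacian (fun y => a * f y) = fun y => a * coordLaplacian f y := by
  funext y
  simp only [coordLaplacian, Finset.mul_sum]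
  refine Finset.sum_congr rfl fun i _ => ?_
  have : partialDeriv i (fun y => a * f y) = fun y => a * partialDeriv i f y :=
    funext fun y => partialDeriv_const_mul (hf.differentiable (by simp) y) a i
  rw [this, partialDeriv_const_mul ((ContDiff.partialDeriv hf i).differentiable (by simp) y)]

/-- Multiplication by a bump removes the restriction on the domain, so that formulas stated for
globally smooth functions apply on smaller balls. -/
theorem exists_contDiff_eqOn_ball {r R : ℝ} (hr : 0 < r) (hrR : r < R)
    (hf : ContDiffOn ℝ ∞ f (Metric.ball 0 R)) :
    ∃ F : EuclideanSpace ℝ (Fin d) → ℂ, ContDiff ℝ ∞ F ∧ EqOn F f (Metric.ball 0 r) := by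
  obtain ⟨r', hr', hr'R⟩ := exists_between hrR
  let χ : ContDiffBump (0 : EuclideanSpace ℝ (Fin d)) := ⟨r, r', hr, hr'⟩
  refine ⟨fun x => χ x • f x, contDiff_iff_contDiffAt.2 fun x => ?_, fun x hx => ?_⟩
  · by_cases hx : x ∈ tsupport fun x => χ x • f x
    swap
    · exact (contDiffAt_const (c := (0 : ℂ))).congr_of_eventuallyEq
        (notMem_tsupport_iff_eventuallyEq.1 hx)
    have hx' : x ∈ Metric.ball (0 : EuclideanSpace ℝ (Fin d)) R := by
      have h1 := tsupport_smul_subset_left (χ : EuclideanSpace ℝ (Fin d) → ℝ) f hx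
      rw [χ.tsupport_eq] at h1
      exact Metric.closedBall_subset_ball hr'R h1
    exact χ.contDiff.contDiffAt.smul (hf.contDiffAt (Metric.isOpen_ball.mem_nhds hx'))
  · simp [χ.one_of_mem_closedBall (Metric.ball_subset_closedBall hx)]

theorem tsupport_partialDeriv_subset (f : EuclideanSpace ℝ (Fin d) → ℂ) (i : Fin d) :
    tsupport (partialDeriv i f) ⊆ tsupport f := by
  refine closure_minimal (fun x hx => ?_) (isClosed_tsupport f)
  refine support_fderiv_subset ℝ (f := f) ?_
  intro h
  exact hx (by simp [partialDeriv, h])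

theorem HasCompactSupport.partialDeriv (hf : HasCompactSupport f) (i : Fin d) :
    HasCompactSupport (partialDeriv i f) :=
  hf.of_isClosed_subset (isClosed_tsupport _) (tsupport_partialDeriv_subset f i)

theorem tsupport_coordLaplacian_subset (f : EuclideanSpace ℝ (Fin d) → ℂ) :
    tsupport (coordLaplacian f) ⊆ tsupport f := by
  refine closure_minimal (fun x hx => ?_) (isClosed_tsupport f)
  by_contra hx'
  refine hx (Finset.sum_eq_zero fun i _ => ?_)
  refine image_eq_zero_of_notMem_tsupport fun h => hx' ?_
  exact tsupport_partialDeriv_subset f i (tsupport_partialDeriv_subset _ i h)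

theorem integral_mul_partialDeriv (hf : ContDiff ℝ ∞ f) (hg : ContDiff ℝ ∞ g)
    (hs : HasCompactSupport g) (i : Fin d) :
    ∫ x, f x * partialDeriv i g x = -∫ x, partialDeriv i f x * g x := by
  refine integral_mul_fderiv_eq_neg_fderiv_mul_of_integrable ?_ ?_ ?_
    (fun x _ => hf.differentiable (by simp) x) (fun x _ => hg.differentiable (by simp) x)
  · exact ((ContDiff.partialDeriv hf i).continuous.mul hg.continuous).integrable_of_hasCompactSupport
      hs.mul_left
  · exact (hf.continuous.mul (ContDiff.partialDeriv hg i).continuous).integrable_of_hasCompactSupport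
      (HasCompactSupport.partialDeriv hs i).mul_left
  · exact (hf.continuous.mul hg.continuous).integrable_of_hasCompactSupport hs.mul_left

theorem integral_mul_coordLaplacian (hf : ContDiff ℝ ∞ f) (hg : ContDiff ℝ ∞ g)
    (hs : HasCompactSupport g) :
    ∫ x, f x * coordLaplacian g x = ∫ x, coordLaplacian f x * g x := by
  simp only [coordLaplacian, Finset.mul_sum, Finset.sum_mul]
  rw [integral_finsetSum, integral_finsetSum]
  · refine Finset.sum_congr rfl fun i _ => ?_
    rw [integral_mul_partialDeriv hf (ContDiff.partialDeriv hg i)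
      (HasCompactSupport.partialDeriv hs i),
      integral_mul_partialDeriv (ContDiff.partialDeriv hf i) hg hs, neg_neg]
  · exact fun i _ => ((ContDiff.partialDeriv (ContDiff.partialDeriv hf i) i).continuous.mul
      hg.continuous).integrable_of_hasCompactSupport hs.mul_left
  · exact fun i _ => (hf.continuous.mul (ContDiff.partialDeriv (ContDiff.partialDeriv hg i)
      i).continuous).integrable_of_hasCompactSupport
      (HasCompactSupport.partialDeriv (HasCompactSupport.partialDeriv hs i) i).mul_left

/-! ### Smooth harmonic functions on balls -/

/-- `f` is smooth and harmonic in the ball of radius `R` about the origin. -/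
structure HarmonicOnBall (f : EuclideanSpace ℝ (Fin d) → ℂ) (R : ℝ) : Prop where
  contDiffOn : ContDiffOn ℝ ∞ f (Metric.ball 0 R)
  coordLaplacian_eq_zero : ∀ x ∈ Metric.ball 0 R, coordLaplacian f x = 0

theorem HarmonicOnBall.exists_extension {r R : ℝ} (hr : 0 < r) (hrR : r < R)
    (hf : HarmonicOnBall f R) :
    ∃ F : EuclideanSpace ℝ (Fin d) → ℂ, ContDiff ℝ ∞ F ∧ EqOn F f (Metric.ball 0 r) ∧
      ∀ x ∈ Metric.ball 0 r, coordLaplacian F x = 0 := by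
  obtain ⟨F, hF, hFf⟩ := exists_contDiff_eqOn_ball hr hrR hf.contDiffOn
  refine ⟨F, hF, hFf, fun x hx => ?_⟩
  rw [Filter.EventuallyEq.coordLaplacian_eq (hFf.eventuallyEq_of_mem
    (Metric.isOpen_ball.mem_nhds hx))]
  exact hf.coordLaplacian_eq_zero x (Metric.ball_subset_ball hrR.le hx)

theorem HarmonicOnBall.conj {R : ℝ} (hf : HarmonicOnBall f R) :
    HarmonicOnBall (fun x => star (f x)) R where
  contDiffOn := Complex.conjCLE.contDiff.comp_contDiffOn hf.contDiffOn
  coordLaplacian_eq_zero x hx := by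
    rw [coordLaplacian_conj]
    simp [hf.coordLaplacian_eq_zero x hx]

theorem HarmonicOnBall.comp_smul {R r t : ℝ} (hf : HarmonicOnBall f R) (ht : 0 < t)
    (h : t * r ≤ R) : HarmonicOnBall (fun x => f (t • x)) r := by
  have hmaps : MapsTo (fun x : EuclideanSpace ℝ (Fin d) => t • x) (Metric.ball 0 r)
      (Metric.ball 0 R) := fun x hx => by
    rw [mem_ball_zero_iff] at hx ⊢
    rw [norm_smul, Real.norm_of_nonneg ht.le]
    exact lt_of_lt_of_le (mul_lt_mul_of_pos_left hx ht) h
  have hcd : ContDiffOn ℝ ∞ (fun x => f (t • x)) (Metric.ball 0 r) :=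
    hf.contDiffOn.comp (contDiff_const_smul t).contDiffOn hmaps
  refine ⟨hcd, fun x hx => ?_⟩
  have hpos : 0 < R := (norm_nonneg _).trans_lt (mem_ball_zero_iff.1 (hmaps hx))
  have hlt := mem_ball_zero_iff.1 (hmaps hx)
  obtain ⟨q, hq, hqR⟩ := exists_between hlt
  obtain ⟨F, hF, hFf, hF0⟩ := hf.exists_extension ((norm_nonneg _).trans_lt hq) hqR
  have hev : (fun y => f (t • y)) =ᶠ[𝓝 x] fun y => F (t • y) := by
    have : ∀ᶠ y in 𝓝 x, t • y ∈ Metric.ball (0 : EuclideanSpace ℝ (Fin d)) q :=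
      (continuous_const_smul t).continuousAt.eventually
        (Metric.isOpen_ball.mem_nhds (mem_ball_zero_iff.2 hq))
    filter_upwards [this] with y hy using (hFf hy).symm
  rw [Filter.EventuallyEq.coordLaplacian_eq hev, coordLaplacian_comp_smul hF]
  simp [hF0 _ (mem_ball_zero_iff.2 hq)]

theorem exists_tsupport_subset_ball {R : ℝ} (hR : 0 < R) {φ : EuclideanSpace ℝ (Fin d) → ℂ}
    (hφ : IsTestFunction (Metric.ball 0 R) φ) :
    ∃ r, 0 < r ∧ r < R ∧ tsupport φ ⊆ Metric.ball 0 r := by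
  obtain ⟨r, hr, hs⟩ := exists_pos_lt_subset_ball hR hφ.hasCompactSupport.isClosed
    hφ.tsupport_subset
  exact ⟨r, hr.1, hr.2, hs⟩

/-- Green's identity for a global extension of `f` that is still harmonic on a ball containing the
support of the test function. -/
theorem HarmonicOnBall.integral_mul_laplacian {R : ℝ} (hR : 0 < R) (hf : HarmonicOnBall f R)
    {φ : EuclideanSpace ℝ (Fin d) → ℂ} (hφ : IsTestFunction (Metric.ball 0 R) φ) :
    ∫ x, f x * coordLaplacian φ x = 0 := by
  obtain ⟨r, hr, hrR, hs⟩ := exists_tsupport_subset_ball hR hφ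
  obtain ⟨F, hF, hFf, hF0⟩ := hf.exists_extension hr hrR
  calc ∫ x, f x * coordLaplacian φ x = ∫ x, F x * coordLaplacian φ x := by
        congr 1
        funext x
        by_cases hx : x ∈ Metric.ball (0 : EuclideanSpace ℝ (Fin d)) r
        · rw [hFf hx]
        · rw [image_eq_zero_of_notMem_tsupport fun h =>
            hx (hs (tsupport_coordLaplacian_subset φ h)), mul_zero, mul_zero]
    _ = ∫ x, coordLaplacian F x * φ x :=
        integral_mul_coordLaplacian hF hφ.contDiff hφ.hasCompactSupport
    _ = ∫ _, (0 : ℂ) := by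
        congr 1
        funext x
        by_cases hx : x ∈ Metric.ball (0 : EuclideanSpace ℝ (Fin d)) r
        · rw [hF0 x hx, zero_mul]
        · rw [image_eq_zero_of_notMem_tsupport fun h => hx (hs h), mul_zero]
    _ = 0 := integral_zero _ _

/-! ### The scaling identity for the mean value kernel -/

/-- The mean value kernel `σ ^ d h(σ y) w(σ² y)`; for radial `h` and harmonic `w` its
derivative in `σ` is a Laplacian in `y`. -/
noncomputable def meanKernel (h w : EuclideanSpace ℝ (Fin d) → ℂ) (σ : ℝ)
    (y : EuclideanSpace ℝ (Fin d)) : ℂ :=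
  (σ : ℂ) ^ d * (h (σ • y) * w (σ ^ 2 • y))

/-- The derivative of `meanKernel` in the scaling parameter. -/
noncomputable def meanKernelDeriv (h w : EuclideanSpace ℝ (Fin d) → ℂ) (σ : ℝ)
    (y : EuclideanSpace ℝ (Fin d)) : ℂ :=
  (d : ℂ) * (σ : ℂ) ^ (d - 1) * (h (σ • y) * w (σ ^ 2 • y)) +
    (σ : ℂ) ^ d * (fderiv ℝ h (σ • y) y * w (σ ^ 2 • y) +
      h (σ • y) * (2 * σ * fderiv ℝ w (σ ^ 2 • y) y))

variable {h ψ w u : EuclideanSpace ℝ (Fin d) → ℂ}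

theorem hasDerivAt_meanKernel (hh : ContDiff ℝ ∞ h) (hw : ContDiff ℝ ∞ w) (σ : ℝ)
    (y : EuclideanSpace ℝ (Fin d)) :
    HasDerivAt (fun σ => meanKernel h w σ y) (meanKernelDeriv h w σ y) σ := by
  have h1 : HasDerivAt (fun σ : ℝ => (σ : ℂ) ^ d) ((d : ℂ) * (σ : ℂ) ^ (d - 1)) σ := by
    simpa using (hasDerivAt_pow d (σ : ℂ)).comp_ofReal
  have h2 : HasDerivAt (fun σ : ℝ => h (σ • y)) (fderiv ℝ h (σ • y) y) σ := by
    have h3 : HasDerivAt (fun σ : ℝ => σ • y) y σ := by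
      simpa using (hasDerivAt_id σ).smul_const y
    exact ((hh.differentiable (by simp) (σ • y)).hasFDerivAt).comp_hasDerivAt σ h3
  have h4 : HasDerivAt (fun σ : ℝ => w (σ ^ 2 • y)) (2 * σ * fderiv ℝ w (σ ^ 2 • y) y) σ := by
    have h3 : HasDerivAt (fun σ : ℝ => σ ^ 2 • y) ((2 * σ) • y) σ := by
      simpa using (hasDerivAt_pow 2 σ).smul_const y
    have := ((hw.differentiable (by simp) (σ ^ 2 • y)).hasFDerivAt).comp_hasDerivAt σ h3
    refine this.congr_deriv ?_
    rw [map_smul]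
    simp
  exact h1.mul (h2.mul h4)

theorem continuous_meanKernelDeriv (hh : ContDiff ℝ ∞ h) (hw : ContDiff ℝ ∞ w) :
    Continuous (fun p : ℝ × EuclideanSpace ℝ (Fin d) => meanKernelDeriv h w p.1 p.2) := by
  have h1 := hh.continuous
  have h2 := hw.continuous
  have h3 : Continuous (fderiv ℝ h) := hh.continuous_fderiv (by simp)
  have h4 : Continuous (fderiv ℝ w) := hw.continuous_fderiv (by simp)
  unfold meanKernelDeriv
  fun_prop

theorem continuous_meanKernelDeriv_right (hh : ContDiff ℝ ∞ h) (hw : ContDiff ℝ ∞ w) (σ : ℝ) :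
    Continuous (meanKernelDeriv h w σ) := by
  have h1 := hh.continuous
  have h2 := hw.continuous
  have h3 : Continuous (fderiv ℝ h) := hh.continuous_fderiv (by simp)
  have h4 : Continuous (fderiv ℝ w) := hw.continuous_fderiv (by simp)
  unfold meanKernelDeriv
  fun_prop

theorem continuous_meanKernel (hh : ContDiff ℝ ∞ h) (hw : ContDiff ℝ ∞ w) (σ : ℝ) :
    Continuous (meanKernel h w σ) := by
  have h1 := hh.continuous
  have h2 := hw.continuous
  unfold meanKernel
  fun_prop

theorem coordLaplacian_of_radial_gradient (hh : ContDiff ℝ ∞ h)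
    (hψ : ∀ i y, partialDeriv i ψ y = h y * (y i : ℂ)) (x : EuclideanSpace ℝ (Fin d)) :
    coordLaplacian ψ x = d * h x + fderiv ℝ h x x := by
  have : ∀ i, partialDeriv i (partialDeriv i ψ) x = h x + (x i : ℂ) * partialDeriv i h x := by
    intro i
    rw [show partialDeriv i ψ = fun y => h y * (y i : ℂ) from funext (hψ i),
      partialDeriv_mul (hh.differentiable (by simp) x)
        ((contDiff_coord i).differentiable (by simp) x), partialDeriv_coord]
    simp
  rw [coordLaplacian, Finset.sum_congr rfl fun i _ => this i, Finset.sum_add_distrib,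
    fderiv_apply_eq_sum]
  simp

/-- Since `∇ψ(y) = h(y) y`, the term `Δψ = d h + y·∇h` reproduces the derivatives of `σ^d` and
`h(σy)`, and the cross term `2∇ψ·∇w` reproduces that of `w(σ²y)`. What is left is `ψ Δw`, removed by
`hy`. The factor `σ³` avoids the negative power in `σ^(d-3)`. -/
theorem pow_mul_meanKernelDeriv (hh : ContDiff ℝ ∞ h) (hψc : ContDiff ℝ ∞ ψ)
    (hψ : ∀ i y, partialDeriv i ψ y = h y * (y i : ℂ)) (hw : ContDiff ℝ ∞ w) {σ : ℝ}
    {y : EuclideanSpace ℝ (Fin d)} (hy : ψ (σ • y) = 0 ∨ coordLaplacian w (σ ^ 2 • y) = 0) :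
    (σ : ℂ) ^ 3 * meanKernelDeriv h w σ y =
      (σ : ℂ) ^ d * coordLaplacian (fun y => ψ (σ • y) * w (σ ^ 2 • y)) y := by
  have hy' : ψ (σ • y) * coordLaplacian w (σ ^ 2 • y) = 0 := by
    rcases hy with h | h <;> simp [h]
  rw [coordLaplacian_mul (f := fun y => ψ (σ • y)) (g := fun y => w (σ ^ 2 • y))
    (hψc.comp (contDiff_const_smul σ)) (hw.comp (contDiff_const_smul (σ ^ 2))),
    coordLaplacian_comp_smul hψc, coordLaplacian_comp_smul hw]
  simp only [coordLaplacian_of_radial_gradient hh hψ]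
  have hsum : ∑ i, partialDeriv i (fun y => ψ (σ • y)) y *
      partialDeriv i (fun y => w (σ ^ 2 • y)) y =
      (σ : ℂ) ^ 4 * h (σ • y) * fderiv ℝ w (σ ^ 2 • y) y := by
    rw [fderiv_apply_eq_sum, Finset.mul_sum]
    refine Finset.sum_congr rfl fun i _ => ?_
    rw [partialDeriv_comp_smul, partialDeriv_comp_smul]
    simp only [hψ, PiLp.smul_apply, smul_eq_mul]
    push_cast
    ring
  have hd : (d : ℂ) * (σ : ℂ) ^ (d - 1) * σ = d * (σ : ℂ) ^ d := by
    cases d with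
    | zero => simp
    | succ n => simp [pow_succ, mul_assoc]
  rw [hsum, meanKernelDeriv]
  simp only [map_smul, Complex.real_smul, Complex.ofReal_pow]
  linear_combination (σ : ℂ) ^ 2 * (h (σ • y) * w (σ ^ 2 • y)) * hd -
    (σ : ℂ) ^ d * ((σ : ℂ) ^ 2) ^ 2 * hy'

/-- Weak harmonicity in a ball with centre `a`. -/
def WeaklyHarmonic (u : EuclideanSpace ℝ (Fin d) → ℂ) (a : EuclideanSpace ℝ (Fin d)) (R : ℝ) :
    Prop :=
  ∀ φ, IsTestFunction (Metric.ball a R) φ →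
    ∫ x in Metric.ball a R, u x * coordLaplacian φ x = 0

theorem isTestFunction_comp_sub {R ρ : ℝ} {φ : EuclideanSpace ℝ (Fin d) → ℂ}
    (hφ : ContDiff ℝ ∞ φ) (a : EuclideanSpace ℝ (Fin d)) (hρR : ρ < R)
    (hs : ∀ y, ρ < ‖y‖ → φ y = 0) :
    IsTestFunction (Metric.ball a R) (fun y => φ (y - a)) := by
  have hsub : tsupport (fun y => φ (y - a)) ⊆ Metric.closedBall a ρ := by
    refine closure_minimal (fun y hy => ?_) Metric.isClosed_closedBall
    rw [mem_closedBall_iff_norm]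
    by_contra! hlt
    exact hy (hs _ hlt)
  exact ⟨hφ.comp (contDiff_id.sub contDiff_const),
    (isCompact_closedBall a ρ).of_isClosed_subset (isClosed_tsupport _) hsub,
    hsub.trans (Metric.closedBall_subset_ball hρR)⟩

theorem integral_mul_meanKernelDeriv {a : EuclideanSpace ℝ (Fin d)} {R R' ρ σ : ℝ}
    (huh : WeaklyHarmonic u a R)
    (hh : ContDiff ℝ ∞ h) (hψc : ContDiff ℝ ∞ ψ)
    (hψ : ∀ i y, partialDeriv i ψ y = h y * (y i : ℂ)) (hψs : ∀ y, ρ < ‖y‖ → ψ y = 0)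
    (hw : ContDiff ℝ ∞ w) (hw0 : ∀ y ∈ Metric.ball 0 R', coordLaplacian w y = 0)
    (hσ : 0 < σ) (h1 : ρ < σ * R) (h2 : σ * ρ < R') :
    ∫ y in Metric.ball a R, u y * meanKernelDeriv h w σ (y - a) = 0 := by
  set θ : EuclideanSpace ℝ (Fin d) → ℂ := fun y => ψ (σ • y) * w (σ ^ 2 • y) with hθ
  have hθc : ContDiff ℝ ∞ θ :=
    (hψc.comp (contDiff_const_smul σ)).mul (hw.comp (contDiff_const_smul (σ ^ 2)))
  have htest : IsTestFunction (Metric.ball a R) (fun y => θ (y - a)) := by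
    refine isTestFunction_comp_sub (ρ := ρ / σ) hθc a (by rwa [div_lt_iff₀' hσ]) fun y hy => ?_
    have : ψ (σ • y) = 0 := hψs _ (by
      rw [norm_smul, Real.norm_of_nonneg hσ.le]
      rwa [div_lt_iff₀' hσ] at hy)
    simp only [hθ, this, zero_mul]
  have h0 := huh _ htest
  rw [coordLaplacian_comp_sub] at h0
  have hσc : (σ : ℂ) ^ 3 ≠ 0 := pow_ne_zero _ (Complex.ofReal_ne_zero.2 hσ.ne')
  refine mul_left_cancel₀ hσc ?_
  rw [← integral_const_mul, mul_zero]
  have : ∀ y, (σ : ℂ) ^ 3 * (u y * meanKernelDeriv h w σ (y - a)) =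
      (σ : ℂ) ^ d * (u y * coordLaplacian θ (y - a)) := by
    intro y
    -- Where `‖σ(y - a)‖ ≤ ρ`, the point `σ²(y - a)` has norm at most `σρ < R'` and lies where `w`
    -- is harmonic; elsewhere the potential vanishes.
    have hy : ψ (σ • (y - a)) = 0 ∨ coordLaplacian w (σ ^ 2 • (y - a)) = 0 := by
      by_cases hn : ρ < ‖σ • (y - a)‖
      · exact Or.inl (hψs _ hn)
      · refine Or.inr (hw0 _ ?_)
        rw [not_lt] at hn
        rw [mem_ball_zero_iff, pow_two, mul_smul, norm_smul, Real.norm_of_nonneg hσ.le]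
        exact (mul_le_mul_of_nonneg_left hn hσ.le).trans_lt h2
    have := pow_mul_meanKernelDeriv hh hψc hψ hw hy
    linear_combination u y * this
  rw [integral_congr_ae (Eventually.of_forall this), integral_const_mul, h0, mul_zero]

theorem IntegrableOn.mul_continuous_ball {a : EuclideanSpace ℝ (Fin d)} {R : ℝ}
    (hu : IntegrableOn u (Metric.ball a R)) {g : EuclideanSpace ℝ (Fin d) → ℂ}
    (hg : Continuous g) : IntegrableOn (fun y => u y * g y) (Metric.ball a R) := by
  obtain ⟨C, hC⟩ := (isCompact_closedBall a R).exists_bound_of_continuousOn hg.continuousOn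
  refine Integrable.mono' (hu.norm.mul_const C)
    (hu.aestronglyMeasurable.mul hg.aestronglyMeasurable) ?_
  filter_upwards [ae_restrict_mem measurableSet_ball] with y hy
  rw [norm_mul]
  exact mul_le_mul_of_nonneg_left (hC y (Metric.ball_subset_closedBall hy)) (norm_nonneg _)

theorem exists_bound_meanKernelDeriv (hh : ContDiff ℝ ∞ h) (hw : ContDiff ℝ ∞ w)
    (a : EuclideanSpace ℝ (Fin d)) (R σ : ℝ) :
    ∃ C, ∀ τ ∈ Metric.ball σ 1, ∀ y ∈ Metric.ball a R,
      ‖meanKernelDeriv h w τ (y - a)‖ ≤ C := by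
  obtain ⟨C, hC⟩ := ((isCompact_closedBall σ 1).prod
    (isCompact_closedBall (0 : EuclideanSpace ℝ (Fin d)) R)).exists_bound_of_continuousOn
    (continuous_meanKernelDeriv hh hw).continuousOn
  refine ⟨C, fun τ hτ y hy =>
    hC (τ, y - a) (mk_mem_prod (Metric.ball_subset_closedBall hτ) ?_)⟩
  rw [mem_closedBall_zero_iff, ← dist_eq_norm]
  exact (Metric.mem_ball.1 hy).le

theorem hasDerivAt_integral_meanKernel {a : EuclideanSpace ℝ (Fin d)} {R R' ρ σ : ℝ}
    (hu : IntegrableOn u (Metric.ball a R)) (huh : WeaklyHarmonic u a R)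
    (hh : ContDiff ℝ ∞ h) (hψc : ContDiff ℝ ∞ ψ)
    (hψ : ∀ i y, partialDeriv i ψ y = h y * (y i : ℂ)) (hψs : ∀ y, ρ < ‖y‖ → ψ y = 0)
    (hw : ContDiff ℝ ∞ w) (hw0 : ∀ y ∈ Metric.ball 0 R', coordLaplacian w y = 0)
    (hσ : 0 < σ) (h1 : ρ < σ * R) (h2 : σ * ρ < R') :
    HasDerivAt (fun σ => ∫ y in Metric.ball a R, u y * meanKernel h w σ (y - a)) 0 σ := by
  obtain ⟨C, hC⟩ := exists_bound_meanKernelDeriv hh hw a R σ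
  have hcont : ∀ σ, Continuous fun y => meanKernel h w σ (y - a) := fun σ =>
    (continuous_meanKernel hh hw σ).comp (by fun_prop : Continuous fun y => y - a)
  have hcontD : Continuous fun y => meanKernelDeriv h w σ (y - a) :=
    (continuous_meanKernelDeriv_right hh hw σ).comp (by fun_prop : Continuous fun y => y - a)
  have hbound : ∀ᵐ y ∂volume.restrict (Metric.ball a R), ∀ τ ∈ Metric.ball σ 1,
      ‖u y * meanKernelDeriv h w τ (y - a)‖ ≤ ‖u y‖ * C := by
    filter_upwards [ae_restrict_mem measurableSet_ball] with y hy τ hτ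
    rw [norm_mul]
    exact mul_le_mul_of_nonneg_left (hC τ hτ y hy) (norm_nonneg _)
  have hderiv : ∀ᵐ y ∂volume.restrict (Metric.ball a R), ∀ τ ∈ Metric.ball σ 1,
      HasDerivAt (fun τ => u y * meanKernel h w τ (y - a))
        (u y * meanKernelDeriv h w τ (y - a)) τ :=
    Eventually.of_forall fun y τ _ => (hasDerivAt_meanKernel hh hw τ (y - a)).const_mul (u y)
  have hmeas : ∀ᶠ τ in 𝓝 σ, AEStronglyMeasurable (fun y => u y * meanKernel h w τ (y - a))
      (volume.restrict (Metric.ball a R)) :=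
    Eventually.of_forall fun τ => hu.aestronglyMeasurable.mul (hcont τ).aestronglyMeasurable
  have hmeasD : AEStronglyMeasurable (fun y => u y * meanKernelDeriv h w σ (y - a))
      (volume.restrict (Metric.ball a R)) :=
    hu.aestronglyMeasurable.mul hcontD.aestronglyMeasurable
  have key := (hasDerivAt_integral_of_dominated_loc_of_deriv_le (Metric.ball_mem_nhds σ one_pos)
    hmeas (IntegrableOn.mul_continuous_ball hu (hcont σ)) hmeasD hbound (hu.norm.mul_const C)
    hderiv).2
  exact key.congr_deriv (integral_mul_meanKernelDeriv huh hh hψc hψ hψs hw hw0 hσ h1 h2)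

/-- The common source of the mean value property and of the symmetry of dilations. The support
condition is tightest at the smallest scale `σ₁`, the harmonicity condition on `w` at the largest
scale `σ₂`. -/
theorem integral_meanKernel_eq {a : EuclideanSpace ℝ (Fin d)} {R R' ρ σ₁ σ₂ : ℝ}
    (hu : IntegrableOn u (Metric.ball a R)) (huh : WeaklyHarmonic u a R)
    (hh : ContDiff ℝ ∞ h) (hψc : ContDiff ℝ ∞ ψ)
    (hψ : ∀ i y, partialDeriv i ψ y = h y * (y i : ℂ)) (hψs : ∀ y, ρ < ‖y‖ → ψ y = 0)
    (hw : ContDiff ℝ ∞ w) (hw0 : ∀ y ∈ Metric.ball 0 R', coordLaplacian w y = 0)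
    (hR : 0 < R) (hρ : 0 ≤ ρ)
    (hσ : 0 < σ₁) (hσ₁₂ : σ₁ ≤ σ₂) (h1 : ρ < σ₁ * R) (h2 : σ₂ * ρ < R') :
    ∫ y in Metric.ball a R, u y * meanKernel h w σ₁ (y - a) =
      ∫ y in Metric.ball a R, u y * meanKernel h w σ₂ (y - a) := by
  have hd : ∀ σ ∈ Icc σ₁ σ₂,
      HasDerivAt (fun σ => ∫ y in Metric.ball a R, u y * meanKernel h w σ (y - a)) 0 σ :=
    fun σ hs => hasDerivAt_integral_meanKernel hu huh hh hψc hψ hψs hw hw0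
      (hσ.trans_le hs.1) (h1.trans_le (mul_le_mul_of_nonneg_right hs.1 hR.le))
      ((mul_le_mul_of_nonneg_right hs.2 hρ).trans_lt h2)
  exact (constant_of_has_deriv_right_zero
    (fun σ hs => (hd σ hs).continuousAt.continuousWithinAt)
    (fun σ hs => (hd σ (Ico_subset_Icc_self hs)).hasDerivWithinAt) σ₂
    (right_mem_Icc.2 hσ₁₂)).symm

/-! ### Radial cutoffs and their potentials -/

/-- A smooth function which is `1` on `(-∞, a]` and `0` on `[b, ∞)`. -/
noncomputable def smoothCutoff (a b r : ℝ) : ℝ := Real.smoothTransition ((b - r) / (b - a))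

theorem contDiff_smoothCutoff (a b : ℝ) : ContDiff ℝ ∞ (smoothCutoff a b) :=
  Real.smoothTransition.contDiff.comp ((contDiff_const.sub contDiff_id).div_const _)

theorem smoothCutoff_of_le {a b r : ℝ} (hab : a < b) (h : r ≤ a) : smoothCutoff a b r = 1 :=
  Real.smoothTransition.one_of_one_le (by rw [one_le_div (by linarith)]; linarith)

theorem smoothCutoff_of_ge {a b r : ℝ} (hab : a < b) (h : b ≤ r) : smoothCutoff a b r = 0 :=
  Real.smoothTransition.zero_of_nonpos (div_nonpos_of_nonpos_of_nonneg (by linarith) (by linarith))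

theorem smoothCutoff_nonneg (a b r : ℝ) : 0 ≤ smoothCutoff a b r := Real.smoothTransition.nonneg _

theorem smoothCutoff_le_one (a b r : ℝ) : smoothCutoff a b r ≤ 1 := Real.smoothTransition.le_one _

/-- The radial cutoff on `ℝ^d` obtained from `smoothCutoff`, complex valued. -/
noncomputable def radialCutoff (a b : ℝ) (y : EuclideanSpace ℝ (Fin d)) : ℂ :=
  smoothCutoff a b (‖y‖ ^ 2)

theorem contDiff_radialCutoff (a b : ℝ) :
    ContDiff ℝ ∞ (radialCutoff a b : EuclideanSpace ℝ (Fin d) → ℂ) :=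
  Complex.ofRealCLM.contDiff.comp ((contDiff_smoothCutoff a b).comp (contDiff_norm_sq ℝ))

/-- The parameters of the cutoff measure the squared norm, hence the radius `√b`. -/
theorem radialCutoff_eq_zero {a b : ℝ} (hab : a < b) {y : EuclideanSpace ℝ (Fin d)}
    (h : √b < ‖y‖) : radialCutoff a b y = 0 := by
  rw [radialCutoff, smoothCutoff_of_ge hab (Real.lt_sq_of_sqrt_lt h).le, Complex.ofReal_zero]

/-- A compactly supported function with gradient `y ↦ radialCutoff a b y • y`. -/
noncomputable def radialPotential (a b : ℝ) (y : EuclideanSpace ℝ (Fin d)) : ℂ :=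
  ((2⁻¹ * ∫ r in b..‖y‖ ^ 2, smoothCutoff a b r : ℝ) : ℂ)

theorem contDiff_radialPotential (a b : ℝ) :
    ContDiff ℝ ∞ (radialPotential a b : EuclideanSpace ℝ (Fin d) → ℂ) := by
  have hd : ∀ r, HasDerivAt (fun r => ∫ r in b..r, smoothCutoff a b r) (smoothCutoff a b r) r :=
    fun r => (contDiff_smoothCutoff a b).continuous.integral_hasStrictDerivAt b r |>.hasDerivAt
  have hG : ContDiff ℝ ∞ (fun r => ∫ r in b..r, smoothCutoff a b r) := by
    rw [contDiff_infty_iff_deriv]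
    refine ⟨fun r => (hd r).differentiableAt, ?_⟩
    rw [show deriv (fun r => ∫ r in b..r, smoothCutoff a b r) = smoothCutoff a b from
      funext fun r => (hd r).deriv]
    exact contDiff_smoothCutoff a b
  exact Complex.ofRealCLM.contDiff.comp (contDiff_const.mul (hG.comp (contDiff_norm_sq ℝ)))

theorem partialDeriv_radialPotential (a b : ℝ) (i : Fin d) (y : EuclideanSpace ℝ (Fin d)) :
    partialDeriv i (radialPotential a b) y = radialCutoff a b y * (y i : ℂ) := by
  have hd : ∀ r, HasDerivAt (fun r => 2⁻¹ * ∫ r in b..r, smoothCutoff a b r)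
      (2⁻¹ * smoothCutoff a b r) r :=
    fun r => ((contDiff_smoothCutoff a b).continuous.integral_hasStrictDerivAt b r
      |>.hasDerivAt).const_mul _
  have h1 := (hd (‖y‖ ^ 2)).comp_hasFDerivAt y (hasStrictFDerivAt_norm_sq y).hasFDerivAt
  have h2 := Complex.ofRealCLM.hasFDerivAt.comp y h1
  have h3 : HasFDerivAt (radialPotential a b) _ y := h2
  rw [partialDeriv, h3.fderiv, radialCutoff]
  simp [EuclideanSpace.inner_single_right]
  ring

/-- The primitive is based at `b`, beyond which the cutoff vanishes; this choice of constant is what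
gives the potential compact support. -/
theorem radialPotential_eq_zero {a b : ℝ} (hab : a < b) (y : EuclideanSpace ℝ (Fin d))
    (h : √b < ‖y‖) : radialPotential a b y = 0 := by
  have hle := (Real.lt_sq_of_sqrt_lt h).le
  rw [radialPotential, intervalIntegral.integral_congr (g := fun _ => 0)]
  · simp
  · intro r hr
    rw [uIcc_of_le hle] at hr
    exact smoothCutoff_of_ge hab hr.1

theorem coordLaplacian_one (x : EuclideanSpace ℝ (Fin d)) :
    coordLaplacian (fun _ : EuclideanSpace ℝ (Fin d) => (1 : ℂ)) x = 0 := by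
  simp [coordLaplacian, partialDeriv_const]

/-! ### Convolution and mollifiers -/

section Convolution

open scoped Convolution

variable {u k : EuclideanSpace ℝ (Fin d) → ℂ}

theorem partialDeriv_convolution (hu : LocallyIntegrable u) (hk : ContDiff ℝ ∞ k)
    (hs : HasCompactSupport k) (i : Fin d) :
    partialDeriv i (u ⋆[ContinuousLinearMap.mul ℝ ℂ] k) =
      u ⋆[ContinuousLinearMap.mul ℝ ℂ] partialDeriv i k := by
  funext x
  rw [partialDeriv, (hs.hasFDerivAt_convolution_right (ContinuousLinearMap.mul ℝ ℂ) hu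
    (hk.of_le (by simp)) x).fderiv, convolution_precompR_apply _ hu (hs.fderiv ℝ)
    (hk.continuous_fderiv (by simp))]
  rfl

theorem coordLaplacian_convolution (hu : LocallyIntegrable u) (hk : ContDiff ℝ ∞ k)
    (hs : HasCompactSupport k) (x : EuclideanSpace ℝ (Fin d)) :
    coordLaplacian (u ⋆[ContinuousLinearMap.mul ℝ ℂ] k) x =
      (u ⋆[ContinuousLinearMap.mul ℝ ℂ] coordLaplacian k) x := by
  have h1 : ∀ i, partialDeriv i (partialDeriv i (u ⋆[ContinuousLinearMap.mul ℝ ℂ] k)) =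
      u ⋆[ContinuousLinearMap.mul ℝ ℂ] partialDeriv i (partialDeriv i k) := fun i => by
    rw [partialDeriv_convolution hu hk hs, partialDeriv_convolution hu
      (ContDiff.partialDeriv hk i) (HasCompactSupport.partialDeriv hs i)]
  simp only [coordLaplacian, h1, convolution_def, ContinuousLinearMap.mul_apply', Finset.mul_sum]
  rw [integral_finsetSum]
  intro i _
  exact (HasCompactSupport.partialDeriv (HasCompactSupport.partialDeriv hs i) i
    |>.convolutionExists_right (ContinuousLinearMap.mul ℝ ℂ) hu
    (ContDiff.partialDeriv (ContDiff.partialDeriv hk i) i).continuous) x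

end Convolution

/-- The radial mollifier of scale `σ⁻¹`. -/
noncomputable def mollifier (σ : ℝ) (y : EuclideanSpace ℝ (Fin d)) : ℂ :=
  meanKernel (radialCutoff 4⁻¹ 2⁻¹) (fun _ => 1) σ y

theorem mollifier_apply (σ : ℝ) (y : EuclideanSpace ℝ (Fin d)) :
    mollifier σ y = ((σ ^ d * smoothCutoff 4⁻¹ 2⁻¹ (‖σ • y‖ ^ 2) : ℝ) : ℂ) := by
  simp [mollifier, meanKernel, radialCutoff]

theorem mollifier_neg (σ : ℝ) (y : EuclideanSpace ℝ (Fin d)) :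
    mollifier σ (-y) = mollifier σ y := by
  simp [mollifier_apply, norm_smul]

theorem contDiff_mollifier (σ : ℝ) :
    ContDiff ℝ ∞ (mollifier σ : EuclideanSpace ℝ (Fin d) → ℂ) := by
  have : (mollifier σ : EuclideanSpace ℝ (Fin d) → ℂ) =
      fun y => (σ : ℂ) ^ d * (radialCutoff 4⁻¹ 2⁻¹ (σ • y) * 1) := rfl
  rw [this]
  exact contDiff_const.mul (((contDiff_radialCutoff _ _).comp (contDiff_const_smul σ)).mul
    contDiff_const)

theorem sqrt_half_lt_one : √(2⁻¹ : ℝ) < 1 := by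
  rw [Real.sqrt_lt' one_pos]; norm_num

theorem mollifier_eq_zero {σ : ℝ} (hσ : 0 < σ) {y : EuclideanSpace ℝ (Fin d)}
    (h : √2⁻¹ / σ < ‖y‖) : mollifier σ y = 0 := by
  have : radialCutoff 4⁻¹ 2⁻¹ (σ • y) = 0 := radialCutoff_eq_zero (by norm_num) (by
    rw [norm_smul, Real.norm_of_nonneg hσ.le]
    rwa [div_lt_iff₀' hσ] at h)
  simp [mollifier, meanKernel, this]

theorem hasCompactSupport_mollifier {σ : ℝ} (hσ : 0 < σ) :
    HasCompactSupport (mollifier σ : EuclideanSpace ℝ (Fin d) → ℂ) := by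
  refine HasCompactSupport.intro (isCompact_closedBall 0 (√2⁻¹ / σ)) fun y hy => ?_
  rw [mem_closedBall_zero_iff, not_le] at hy
  exact mollifier_eq_zero hσ hy

/-- The mass of the mollifiers. -/
noncomputable def mollifierMass (d : ℕ) : ℝ :=
  ∫ y : EuclideanSpace ℝ (Fin d), smoothCutoff 4⁻¹ 2⁻¹ (‖y‖ ^ 2)

theorem mollifierMass_pos : 0 < mollifierMass d := by
  have hc : Continuous fun y : EuclideanSpace ℝ (Fin d) => smoothCutoff 4⁻¹ 2⁻¹ (‖y‖ ^ 2) :=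
    (contDiff_smoothCutoff _ _).continuous.comp (by fun_prop)
  refine hc.integral_pos_of_hasCompactSupport_nonneg_nonzero (x := 0) ?_
    (fun y => smoothCutoff_nonneg _ _ _) ?_
  · refine HasCompactSupport.intro (K := Metric.closedBall (0 : EuclideanSpace ℝ (Fin d)) 1)
      (f := fun y => smoothCutoff 4⁻¹ 2⁻¹ (‖y‖ ^ 2)) (isCompact_closedBall _ _) fun y hy => ?_
    rw [mem_closedBall_zero_iff, not_le] at hy
    exact smoothCutoff_of_ge (by norm_num) (by nlinarith)
  · rw [smoothCutoff_of_le (by norm_num) (by simp)]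
    exact one_ne_zero

/-- Lebesgue differentiation: divided by their mass, the kernels have integral one, live in balls of
radius `1/(n+1)` and are bounded by a constant over the volume of these balls. -/
theorem ae_tendsto_integral_mollifier {u : EuclideanSpace ℝ (Fin d) → ℂ}
    (hu : LocallyIntegrable u) :
    ∀ᵐ x, Tendsto (fun n : ℕ => ∫ y, u y * mollifier (n + 1 : ℝ) (y - x)) atTop
      (𝓝 (mollifierMass d * u x)) := by
  filter_upwards [(Besicovitch.vitaliFamily volume).ae_tendsto_average_norm_sub hu] with x hx
  set m := mollifierMass d with hm
  have hmpos : 0 < m := mollifierMass_pos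
  have hlim : Tendsto (fun n : ℕ => ((n : ℝ) + 1)⁻¹) atTop (𝓝[>] 0) := by
    refine tendsto_nhdsWithin_iff.2 ⟨?_, Eventually.of_forall fun n => ?_⟩
    · simpa using tendsto_one_div_add_atTop_nhds_zero_nat (𝕜 := ℝ)
    · exact mem_Ioi.2 (by positivity)
  have h1 := (hx.comp (Besicovitch.tendsto_filterAt volume x)).comp hlim
  have h2 := tendsto_integral_smul_of_tendsto_average_norm_sub
    (g := fun (n : ℕ) y => m⁻¹ * (((n : ℝ) + 1) ^ d *
      smoothCutoff 4⁻¹ 2⁻¹ (‖((n : ℝ) + 1) • (y - x)‖ ^ 2)))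
    (m⁻¹ * volume.real (Metric.closedBall (0 : EuclideanSpace ℝ (Fin d)) 1)) h1 ?_ ?_ ?_ ?_
  · have h3 := h2.const_mul (m : ℂ)
    refine h3.congr fun n => ?_
    rw [← integral_const_mul]
    congr 1
    funext y
    rw [mollifier_apply, Complex.real_smul]
    have : (m : ℂ) ≠ 0 := Complex.ofReal_ne_zero.2 hmpos.ne'
    push_cast
    field_simp
  · exact Eventually.of_forall fun n => hu.integrableOn_isCompact (isCompact_closedBall _ _)
  · refine tendsto_const_nhds.congr fun n => ?_
    have hn : (0 : ℝ) < (n : ℝ) + 1 := by positivity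
    rw [integral_const_mul, integral_const_mul,
      integral_sub_right_eq_self (fun y => smoothCutoff 4⁻¹ 2⁻¹ (‖((n : ℝ) + 1) • y‖ ^ 2)) x,
      Measure.integral_comp_smul_of_nonneg volume
        (fun y : EuclideanSpace ℝ (Fin d) => smoothCutoff 4⁻¹ 2⁻¹ (‖y‖ ^ 2)) _ (hR := hn.le),
      finrank_euclideanSpace_fin, smul_eq_mul, mul_inv_cancel_left₀ (pow_pos hn d).ne']
    exact (inv_mul_cancel₀ hmpos.ne').symm
  · refine Eventually.of_forall fun n y hy => ?_
    have hn : (0 : ℝ) < (n : ℝ) + 1 := by positivity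
    by_contra hlt
    refine hy ?_
    simp only [mem_closedBall_iff_norm, not_le] at hlt
    rw [inv_lt_iff_one_lt_mul₀' hn] at hlt
    simp only
    rw [smoothCutoff_of_ge (by norm_num), mul_zero, mul_zero]
    rw [norm_smul, Real.norm_of_nonneg hn.le]
    nlinarith
  · refine Eventually.of_forall fun n y => ?_
    have hn : (0 : ℝ) < (n : ℝ) + 1 := by positivity
    have hvol : volume.real (Metric.closedBall x ((n : ℝ) + 1)⁻¹) =
        (((n : ℝ) + 1) ^ d)⁻¹ *
          volume.real (Metric.closedBall (0 : EuclideanSpace ℝ (Fin d)) 1) := by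
      rw [measureReal_def, Measure.addHaar_closedBall' _ _ (inv_pos.2 hn).le,
        finrank_euclideanSpace_fin, ENNReal.toReal_mul, ENNReal.toReal_ofReal (by positivity),
        inv_pow, measureReal_def]
    have hvpos : 0 < volume.real (Metric.closedBall (0 : EuclideanSpace ℝ (Fin d)) 1) :=
      ENNReal.toReal_pos (Metric.measure_closedBall_pos _ _ one_pos).ne'
        measure_closedBall_lt_top.ne
    have h0 := smoothCutoff_nonneg 4⁻¹ 2⁻¹ (‖((n : ℝ) + 1) • (y - x)‖ ^ 2)
    beta_reduce
    rw [abs_of_nonneg (by positivity), hvol, le_div_iff₀ (by positivity)]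
    have h4 := smoothCutoff_le_one 4⁻¹ 2⁻¹ (‖((n : ℝ) + 1) • (y - x)‖ ^ 2)
    have : m⁻¹ * (((n : ℝ) + 1) ^ d * smoothCutoff 4⁻¹ 2⁻¹ (‖((n : ℝ) + 1) • (y - x)‖ ^ 2)) *
        ((((n : ℝ) + 1) ^ d)⁻¹ *
          volume.real (Metric.closedBall (0 : EuclideanSpace ℝ (Fin d)) 1)) =
        m⁻¹ * volume.real (Metric.closedBall (0 : EuclideanSpace ℝ (Fin d)) 1) *
          smoothCutoff 4⁻¹ 2⁻¹ (‖((n : ℝ) + 1) • (y - x)‖ ^ 2) := by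
      field_simp
    rw [this]
    exact mul_le_of_le_one_right (by positivity) h4

/-! ### Weyl's lemma -/

section Weyl

open scoped Convolution

variable {u : EuclideanSpace ℝ (Fin d) → ℂ}

theorem WeaklyHarmonic.mono {a b : EuclideanSpace ℝ (Fin d)} {R r : ℝ}
    (hu : WeaklyHarmonic u a R) (h : Metric.ball b r ⊆ Metric.ball a R) :
    WeaklyHarmonic u b r := by
  intro φ hφ
  have h0 : ∀ x ∉ Metric.ball b r, u x * coordLaplacian φ x = 0 := fun x hx => by
    rw [image_eq_zero_of_notMem_tsupport (f := coordLaplacian φ) fun h =>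
      hx (hφ.tsupport_subset (tsupport_coordLaplacian_subset φ h)), mul_zero]
  rw [setIntegral_eq_integral_of_forall_compl_eq_zero h0,
    ← setIntegral_eq_integral_of_forall_compl_eq_zero fun x hx => h0 x fun hx' => hx (h hx')]
  exact hu φ ⟨hφ.contDiff, hφ.hasCompactSupport, hφ.tsupport_subset.trans h⟩

theorem ball_subset_unit_ball {x : EuclideanSpace ℝ (Fin d)} :
    Metric.ball x (1 - ‖x‖) ⊆ Metric.ball 0 1 :=
  Metric.ball_subset_ball' (by simp)

/-- The mollification at scale `σ⁻¹` of the restriction of `u` to the unit ball. -/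
noncomputable def mollify (u : EuclideanSpace ℝ (Fin d) → ℂ) (σ : ℝ)
    (x : EuclideanSpace ℝ (Fin d)) : ℂ :=
  ∫ y, (Metric.ball 0 1).indicator u y * mollifier σ (y - x)

theorem mollify_eq_convolution (u : EuclideanSpace ℝ (Fin d) → ℂ) (σ : ℝ) :
    mollify u σ =
      (Metric.ball 0 1).indicator u ⋆[ContinuousLinearMap.mul ℝ ℂ] mollifier σ := by
  funext x
  rw [convolution_def, mollify]
  congr 1
  funext y
  rw [← mollifier_neg, neg_sub, ContinuousLinearMap.mul_apply']

theorem locallyIntegrable_indicator (hu : IntegrableOn u (Metric.ball 0 1)) :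
    LocallyIntegrable ((Metric.ball 0 1).indicator u) :=
  ((integrable_indicator_iff measurableSet_ball).2 hu).locallyIntegrable

theorem contDiff_mollify (hu : IntegrableOn u (Metric.ball 0 1)) {σ : ℝ} (hσ : 0 < σ) :
    ContDiff ℝ ∞ (mollify u σ) := by
  rw [mollify_eq_convolution]
  exact (hasCompactSupport_mollifier hσ).contDiff_convolution_right _
    (locallyIntegrable_indicator hu) (contDiff_mollifier σ)

theorem div_lt_of_inv_le {σ r ρ : ℝ} (hr : 0 < r) (hσ : r⁻¹ ≤ σ) (hρ : ρ < 1) :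
    0 < σ ∧ ρ < σ * r ∧ ρ / σ < r := by
  have h0 : 0 < σ := (inv_pos.2 hr).trans_le hσ
  have h1 : 1 ≤ σ * r := by
    calc 1 = r⁻¹ * r := (inv_mul_cancel₀ hr.ne').symm
      _ ≤ σ * r := mul_le_mul_of_nonneg_right hσ hr.le
  exact ⟨h0, hρ.trans_le h1, by rw [div_lt_iff₀' h0]; exact hρ.trans_le h1⟩

theorem mollifier_sub_eq_zero {x y : EuclideanSpace ℝ (Fin d)} {σ : ℝ} (hx : ‖x‖ < 1)
    (hσ : (1 - ‖x‖)⁻¹ ≤ σ) (hy : y ∉ Metric.ball x (1 - ‖x‖)) : mollifier σ (y - x) = 0 := by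
  obtain ⟨h0, -, h2⟩ := div_lt_of_inv_le (sub_pos.2 hx) hσ sqrt_half_lt_one
  refine mollifier_eq_zero h0 (h2.trans_le ?_)
  rwa [mem_ball_iff_norm, not_lt] at hy

theorem mollify_eq_setIntegral {x : EuclideanSpace ℝ (Fin d)} {σ : ℝ} (hx : ‖x‖ < 1)
    (hσ : (1 - ‖x‖)⁻¹ ≤ σ) :
    mollify u σ x = ∫ y in Metric.ball x (1 - ‖x‖), u y * mollifier σ (y - x) := by
  rw [mollify, ← setIntegral_eq_integral_of_forall_compl_eq_zero
    (s := Metric.ball x (1 - ‖x‖)) fun y hy => by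
      rw [mollifier_sub_eq_zero hx hσ hy, mul_zero]]
  refine setIntegral_congr_fun measurableSet_ball fun y hy => ?_
  rw [indicator_of_mem (ball_subset_unit_ball hy)]

/-- This is the mean value property in weak form: the scaling identity with `w = 1`, centred at `x`.
-/
theorem mollify_eq_mollify (hu : IntegrableOn u (Metric.ball 0 1)) (huh : WeaklyHarmonic u 0 1)
    {x : EuclideanSpace ℝ (Fin d)} {σ₁ σ₂ : ℝ} (hx : ‖x‖ < 1)
    (hσ : (1 - ‖x‖)⁻¹ ≤ σ₁) (hσ₁₂ : σ₁ ≤ σ₂) : mollify u σ₁ x = mollify u σ₂ x := by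
  obtain ⟨h0, h1, -⟩ := div_lt_of_inv_le (sub_pos.2 hx) hσ sqrt_half_lt_one
  rw [mollify_eq_setIntegral hx hσ, mollify_eq_setIntegral hx (hσ.trans hσ₁₂)]
  -- The constant function is harmonic everywhere, so any radius above `σ₂ √(1/2)` serves as `R'`.
  exact integral_meanKernel_eq (R' := σ₂ * √2⁻¹ + 1) (hu.mono_set ball_subset_unit_ball)
    (huh.mono ball_subset_unit_ball) (contDiff_radialCutoff _ _) (contDiff_radialPotential _ _)
    (partialDeriv_radialPotential _ _) (radialPotential_eq_zero (by norm_num)) contDiff_const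
    (fun y _ => coordLaplacian_one y) (sub_pos.2 hx) (Real.sqrt_nonneg _) h0 hσ₁₂ h1 (by linarith)

/-- The Laplacian falls on the mollifier, whose translate to `x` is a test function inside the unit
ball; evenness exchanges `x - y` and `y - x`. -/
theorem coordLaplacian_mollify (hu : IntegrableOn u (Metric.ball 0 1))
    (huh : WeaklyHarmonic u 0 1) {x : EuclideanSpace ℝ (Fin d)} {σ : ℝ} (hx : ‖x‖ < 1)
    (hσ : (1 - ‖x‖)⁻¹ ≤ σ) : coordLaplacian (mollify u σ) x = 0 := by
  obtain ⟨h0, -, h2⟩ := div_lt_of_inv_le (sub_pos.2 hx) hσ sqrt_half_lt_one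
  rw [mollify_eq_convolution, coordLaplacian_convolution (locallyIntegrable_indicator hu)
    (contDiff_mollifier σ) (hasCompactSupport_mollifier h0), convolution_def]
  have htest : IsTestFunction (Metric.ball x (1 - ‖x‖)) (fun y => mollifier σ (y - x)) :=
    isTestFunction_comp_sub (contDiff_mollifier σ) x h2 fun y hy => mollifier_eq_zero h0 hy
  have h3 := huh _ ⟨htest.contDiff, htest.hasCompactSupport,
    htest.tsupport_subset.trans ball_subset_unit_ball⟩
  rw [← integral_indicator measurableSet_ball] at h3
  refine Eq.trans (congrArg _ (funext fun y => ?_)) h3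
  have heven : coordLaplacian (mollifier σ) (x - y) = coordLaplacian (mollifier σ) (y - x) := by
    have h4 := coordLaplacian_comp_smul (contDiff_mollifier (d := d) σ) (-1)
    have h5 : (fun y : EuclideanSpace ℝ (Fin d) => mollifier σ ((-1 : ℝ) • y)) = mollifier σ := by
      funext y
      rw [neg_one_smul, mollifier_neg]
    rw [h5] at h4
    have h6 := congrFun h4 (x - y)
    rw [h6, neg_one_smul, neg_sub]
    simp
  rw [ContinuousLinearMap.mul_apply', heven, coordLaplacian_comp_sub]
  by_cases hy : y ∈ Metric.ball (0 : EuclideanSpace ℝ (Fin d)) 1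
  · rw [indicator_of_mem hy, indicator_of_mem hy]
  · rw [indicator_of_notMem hy, indicator_of_notMem hy, zero_mul]

/-- **Weyl's lemma** in the unit ball. -/
theorem exists_harmonicOnBall_ae_eq (hu : IntegrableOn u (Metric.ball 0 1))
    (huh : WeaklyHarmonic u 0 1) :
    ∃ f, HarmonicOnBall f 1 ∧ f =ᵐ[volume.restrict (Metric.ball 0 1)] u := by
  have hm : (mollifierMass d : ℂ) ≠ 0 := Complex.ofReal_ne_zero.2 mollifierMass_pos.ne'
  set f : EuclideanSpace ℝ (Fin d) → ℂ :=
    fun x => (mollifierMass d : ℂ)⁻¹ * mollify u (1 - ‖x‖)⁻¹ x with hf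
  -- The scale in `f` varies with the point, but independence of scale makes `f` locally a
  -- mollification at a fixed scale, hence smooth.
  have hlocal : ∀ x ∈ Metric.ball (0 : EuclideanSpace ℝ (Fin d)) 1, ∃ σ, 0 < σ ∧
      (1 - ‖x‖)⁻¹ ≤ σ ∧ f =ᶠ[𝓝 x] fun y => (mollifierMass d : ℂ)⁻¹ * mollify u σ y := by
    intro x hx
    rw [mem_ball_zero_iff] at hx
    obtain ⟨r, hxr, hr⟩ := exists_between hx
    have hpos : 0 < 1 - r := by linarith
    refine ⟨(1 - r)⁻¹, inv_pos.2 hpos, inv_anti₀ hpos (by linarith), ?_⟩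
    have hev : ∀ᶠ y in 𝓝 x, ‖y‖ < r := continuous_norm.continuousAt.eventually_lt_const hxr
    filter_upwards [hev] with y hy
    rw [hf]
    simp only
    rw [mollify_eq_mollify hu huh (hy.trans hr) le_rfl (inv_anti₀ hpos (by linarith))]
  refine ⟨f, ⟨fun x hx => ?_, fun x hx => ?_⟩, ?_⟩
  · obtain ⟨σ, hσ, -, hev⟩ := hlocal x hx
    exact ((contDiff_const.mul (contDiff_mollify hu hσ)).contDiffAt.congr_of_eventuallyEq
      hev).contDiffWithinAt
  · obtain ⟨σ, hσ, hσx, hev⟩ := hlocal x hx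
    rw [Filter.EventuallyEq.coordLaplacian_eq hev,
      coordLaplacian_const_mul (contDiff_mollify hu hσ)]
    simp only
    rw [coordLaplacian_mollify hu huh (mem_ball_zero_iff.1 hx) hσx, mul_zero]
  · filter_upwards [ae_restrict_of_ae (ae_tendsto_integral_mollifier
      (locallyIntegrable_indicator hu)), ae_restrict_mem measurableSet_ball] with x hlim hx
    rw [indicator_of_mem hx] at hlim
    have hx' := mem_ball_zero_iff.1 hx
    -- The sequence of mollifications is eventually constant, while almost everywhere it tends to
    -- the mass times `u x`.
    have hconst : Tendsto (fun n : ℕ => mollify u (n + 1 : ℝ) x) atTop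
        (𝓝 (mollify u (1 - ‖x‖)⁻¹ x)) := by
      refine tendsto_const_nhds.congr' ?_
      obtain ⟨N, hN⟩ := exists_nat_ge (1 - ‖x‖)⁻¹
      filter_upwards [eventually_ge_atTop N] with n hn
      refine mollify_eq_mollify hu huh hx' le_rfl (hN.trans ?_)
      have : (N : ℝ) ≤ n := Nat.cast_le.2 hn
      linarith
    rw [hf]
    simp only
    rw [tendsto_nhds_unique hconst hlim, inv_mul_cancel_left₀ hm]

end Weyl

/-! ### Symmetry of dilations on harmonic functions -/

section Dilation

variable {f g : EuclideanSpace ℝ (Fin d) → ℂ}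

theorem HarmonicOnBall.continuousOn_closedBall {r R : ℝ} (hf : HarmonicOnBall f R) (h : r < R) :
    ContinuousOn f (Metric.closedBall 0 r) :=
  hf.contDiffOn.continuousOn.mono (Metric.closedBall_subset_ball h)

theorem HarmonicOnBall.memLp {R : ℝ} (hf : HarmonicOnBall f R) (hR : 1 < R) :
    MemLp f 2 (volume.restrict (Metric.ball 0 1)) := by
  have hc := hf.continuousOn_closedBall hR
  obtain ⟨C, hC⟩ := (isCompact_closedBall (0 : EuclideanSpace ℝ (Fin d))
    1).exists_bound_of_continuousOn hc
  have hm : AEStronglyMeasurable f (volume.restrict (Metric.ball 0 1)) :=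
    (hc.mono Metric.ball_subset_closedBall).aestronglyMeasurable measurableSet_ball
  have : IsFiniteMeasure (volume.restrict (Metric.ball (0 : EuclideanSpace ℝ (Fin d)) 1)) :=
    ⟨by simpa using measure_ball_lt_top⟩
  refine MemLp.of_bound hm C ?_
  filter_upwards [ae_restrict_mem measurableSet_ball] with x hx
  exact hC x (Metric.ball_subset_closedBall hx)

theorem HarmonicOnBall.memLp_comp_smul (hf : HarmonicOnBall f 1)
    (hf2 : MemLp f 2 (volume.restrict (Metric.ball 0 1))) {t : ℝ} (ht : 0 < t) (ht1 : t ≤ 1) :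
    MemLp (fun x => f (t • x)) 2 (volume.restrict (Metric.ball 0 1)) := by
  rcases ht1.eq_or_lt with rfl | hlt
  · simpa using hf2
  · exact (hf.comp_smul (r := t⁻¹) ht (mul_inv_cancel₀ ht.ne').le).memLp
      ((one_lt_inv₀ ht).2 hlt)

theorem HarmonicOnBall.weaklyHarmonic (hf : HarmonicOnBall f 1) : WeaklyHarmonic f 0 1 := by
  intro φ hφ
  rw [setIntegral_eq_integral_of_forall_compl_eq_zero fun x hx => by
    rw [image_eq_zero_of_notMem_tsupport (f := coordLaplacian φ) fun h =>
      hx (hφ.tsupport_subset (tsupport_coordLaplacian_subset φ h)), mul_zero]]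
  exact hf.integral_mul_laplacian one_pos hφ

/-- With `w = g(τ·)` the kernel at `σ = 1` gives the left side; at `σ = 1/τ` the factor `w(σ²y)`
becomes `g(y/τ)`, and the substitution `y = τx` gives the right side. -/
theorem integral_radialCutoff_mul_dilation {a b τ : ℝ} (hab : a < b) (hb : b < 1)
    (hf : HarmonicOnBall f 1) (hfi : IntegrableOn f (Metric.ball 0 1))
    (hg : HarmonicOnBall g 1) (hτ : 0 < τ) (hτ1 : τ ≤ 1) :
    ∫ x in Metric.ball 0 1, radialCutoff a b x * (f x * g (τ • x)) =
      ∫ x in Metric.ball 0 1, radialCutoff a b x * (f (τ • x) * g x) := by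
  have hρ : √b < 1 := by rw [Real.sqrt_lt' one_pos]; simpa using hb
  have hτi : 1 ≤ τ⁻¹ := (one_le_inv₀ hτ).2 hτ1
  -- The radius `r` lies between `√b/τ`, beyond which `w` is never evaluated on the support, and
  -- `1/τ`, up to which `g(τ·)` is harmonic.
  obtain ⟨r, hr1, hr2⟩ := exists_between (mul_lt_of_lt_one_right (inv_pos.2 hτ) hρ)
  have hr0 : 0 < r := lt_of_le_of_lt (mul_nonneg (inv_pos.2 hτ).le (Real.sqrt_nonneg _)) hr1
  have hρr : √b < r := lt_of_le_of_lt (le_mul_of_one_le_left (Real.sqrt_nonneg _) hτi) hr1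
  obtain ⟨w, hw, hwg, hw0⟩ := (hg.comp_smul (r := τ⁻¹) hτ
    (mul_inv_cancel₀ hτ.ne').le).exists_extension hr0 hr2
  have key := integral_meanKernel_eq (a := (0 : EuclideanSpace ℝ (Fin d))) (u := f) hfi
    hf.weaklyHarmonic (contDiff_radialCutoff a b) (contDiff_radialPotential a b)
    (partialDeriv_radialPotential a b) (radialPotential_eq_zero hab) hw hw0 one_pos
    (Real.sqrt_nonneg b) one_pos hτi (by simpa using hρ) hr1
  simp only [sub_zero] at key
  have hL : ∫ x in Metric.ball 0 1, radialCutoff a b x * (f x * g (τ • x)) =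
      ∫ x in Metric.ball 0 1, f x * meanKernel (radialCutoff a b) w 1 x := by
    congr 1
    funext x
    by_cases hx : √b < ‖x‖
    · simp [meanKernel, radialCutoff_eq_zero hab hx]
    · rw [not_lt] at hx
      have := hwg (mem_ball_zero_iff.2 (hx.trans_lt hρr))
      simp only [meanKernel, one_smul, one_pow, Complex.ofReal_one, this]
      ring
  rw [hL, key]
  have hz1 : ∀ x ∉ Metric.ball (0 : EuclideanSpace ℝ (Fin d)) 1,
      f x * meanKernel (radialCutoff a b) w τ⁻¹ x = 0 := by
    intro x hx
    rw [mem_ball_zero_iff, not_lt] at hx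
    have : √b < ‖τ⁻¹ • x‖ := by
      rw [norm_smul, Real.norm_of_nonneg (inv_pos.2 hτ).le]
      nlinarith
    simp [meanKernel, radialCutoff_eq_zero hab this]
  have hz2 : ∀ x ∉ Metric.ball (0 : EuclideanSpace ℝ (Fin d)) 1,
      radialCutoff a b x * (f (τ • x) * g x) = 0 := by
    intro x hx
    rw [mem_ball_zero_iff, not_lt] at hx
    simp [radialCutoff_eq_zero hab (hρ.trans_le hx)]
  rw [setIntegral_eq_integral_of_forall_compl_eq_zero hz1,
    setIntegral_eq_integral_of_forall_compl_eq_zero hz2]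
  have hscale := Measure.integral_comp_smul_of_nonneg volume
    (fun x => f x * meanKernel (radialCutoff a b) w τ⁻¹ x) τ (hR := hτ.le)
  rw [finrank_euclideanSpace_fin] at hscale
  have hτd : (τ ^ d : ℝ) ≠ 0 := pow_ne_zero _ hτ.ne'
  have hτc : (τ : ℂ) ≠ 0 := Complex.ofReal_ne_zero.2 hτ.ne'
  have hscale' := (eq_inv_smul_iff₀ hτd).1 hscale
  rw [← hscale', ← integral_smul]
  congr 1
  funext x
  rw [Complex.real_smul]
  by_cases hx : √b < ‖x‖
  · simp [meanKernel, radialCutoff_eq_zero hab hx, smul_smul, inv_mul_cancel₀ hτ.ne']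
  · rw [not_lt] at hx
    have hmem : τ⁻¹ • x ∈ Metric.ball (0 : EuclideanSpace ℝ (Fin d)) r := by
      rw [mem_ball_zero_iff, norm_smul, Real.norm_of_nonneg (inv_pos.2 hτ).le]
      exact (mul_le_mul_of_nonneg_left hx (inv_pos.2 hτ).le).trans_lt hr1
    have h1 := hwg hmem
    have h2 : τ⁻¹ ^ 2 • τ • x = τ⁻¹ • x := by
      rw [smul_smul]
      congr 1
      field_simp
    simp only [meanKernel, h2, h1, smul_smul, inv_mul_cancel₀ hτ.ne', mul_inv_cancel₀ hτ.ne',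
      one_smul]
    have h7 : (τ : ℂ) ^ d * (τ : ℂ)⁻¹ ^ d = 1 := by
      rw [← mul_pow, mul_inv_cancel₀ hτc, one_pow]
    push_cast
    linear_combination (f (τ • x) * radialCutoff a b x * g x) * h7

/-- Dilations are symmetric with respect to the bilinear pairing of harmonic functions. -/
theorem integral_mul_dilation {τ : ℝ} (hf : HarmonicOnBall f 1)
    (hf2 : MemLp f 2 (volume.restrict (Metric.ball 0 1)))
    (hg : HarmonicOnBall g 1) (hg2 : MemLp g 2 (volume.restrict (Metric.ball 0 1)))
    (hτ : 0 < τ) (hτ1 : τ ≤ 1) :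
    ∫ x in Metric.ball 0 1, f x * g (τ • x) = ∫ x in Metric.ball 0 1, f (τ • x) * g x := by
  have : IsFiniteMeasure (volume.restrict (Metric.ball (0 : EuclideanSpace ℝ (Fin d)) 1)) :=
    ⟨by simpa using measure_ball_lt_top⟩
  have hfi : IntegrableOn f (Metric.ball 0 1) := hf2.integrable (by norm_num)
  -- These cutoffs are eventually 1 at each point of the open ball, so dominated convergence removes
  -- them from both sides.
  have hlim : ∀ F : EuclideanSpace ℝ (Fin d) → ℂ, IntegrableOn F (Metric.ball 0 1) →
      Tendsto (fun n : ℕ => ∫ x in Metric.ball 0 1,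
        radialCutoff (1 - 2 / (n + 2 : ℝ)) (1 - 1 / (n + 2 : ℝ)) x * F x) atTop
        (𝓝 (∫ x in Metric.ball 0 1, F x)) := by
    intro F hF
    refine tendsto_integral_of_dominated_convergence (fun x => ‖F x‖)
      (fun n => (contDiff_radialCutoff _ _).continuous.aestronglyMeasurable.mul
        hF.aestronglyMeasurable) hF.norm (fun n => Eventually.of_forall fun x => ?_) ?_
    · rw [norm_mul]
      refine mul_le_of_le_one_left (norm_nonneg _) ?_
      rw [radialCutoff, Complex.norm_real, Real.norm_of_nonneg (smoothCutoff_nonneg _ _ _)]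
      exact smoothCutoff_le_one _ _ _
    · filter_upwards [ae_restrict_mem measurableSet_ball] with x hx
      rw [mem_ball_zero_iff] at hx
      refine tendsto_const_nhds.congr' ?_
      have hx2 : 0 < 1 - ‖x‖ ^ 2 := by nlinarith [norm_nonneg x]
      obtain ⟨N, hN⟩ := exists_nat_ge (2 / (1 - ‖x‖ ^ 2))
      filter_upwards [eventually_ge_atTop N] with n hn
      have hn2 : (0 : ℝ) < (n : ℝ) + 2 := by positivity
      have hnN : (N : ℝ) ≤ n := Nat.cast_le.2 hn
      rw [radialCutoff, smoothCutoff_of_le, Complex.ofReal_one, one_mul]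
      · have : (1 : ℝ) / (n + 2) < 2 / (n + 2) := by gcongr; norm_num
        linarith
      · have : 2 / ((n : ℝ) + 2) ≤ 1 - ‖x‖ ^ 2 := by
          rw [div_le_iff₀ hn2]
          rw [div_le_iff₀ hx2] at hN
          nlinarith
        linarith
  have h1 := hlim _ (hf2.integrable_mul (hg.memLp_comp_smul hg2 hτ hτ1))
  have h2 := hlim _ ((hf.memLp_comp_smul hf2 hτ hτ1).integrable_mul hg2)
  refine tendsto_nhds_unique h1 (h2.congr fun n => ?_)
  have hn2 : (0 : ℝ) < (n : ℝ) + 2 := by positivity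
  refine (integral_radialCutoff_mul_dilation ?_ ?_ hf hfi hg hτ hτ1).symm
  · have : (1 : ℝ) / (n + 2) < 2 / (n + 2) := by gcongr; norm_num
    linarith
  · have : 0 < (1 : ℝ) / (n + 2) := by positivity
    linarith

end Dilation

/-! ### Log-convexity of the energy and its two consequences -/

section Energy

variable {f g : EuclideanSpace ℝ (Fin d) → ℂ}

theorem inner_toLp_eq_integral {μ : Measure (EuclideanSpace ℝ (Fin d))}
    (hf : MemLp f 2 μ) (hg : MemLp g 2 μ) :
    inner ℂ (hg.toLp g) (hf.toLp f) = ∫ x, f x * star (g x) ∂μ := by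
  rw [L2.inner_def]
  refine integral_congr_ae ?_
  filter_upwards [hf.coeFn_toLp, hg.coeFn_toLp] with x hx hx'
  rw [hx, hx']
  rfl

theorem integral_mul_star_self {μ : Measure (EuclideanSpace ℝ (Fin d))}
    (f : EuclideanSpace ℝ (Fin d) → ℂ) :
    ∫ x, f x * star (f x) ∂μ = ((∫ x, ‖f x‖ ^ 2 ∂μ : ℝ) : ℂ) := by
  rw [← integral_complex_ofReal]
  congr 1
  funext x
  rw [Complex.ofReal_pow, ← Complex.mul_conj']
  rfl

theorem norm_toLp_sq {μ : Measure (EuclideanSpace ℝ (Fin d))} (hf : MemLp f 2 μ) :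
    ‖hf.toLp f‖ ^ 2 = ∫ x, ‖f x‖ ^ 2 ∂μ := by
  rw [norm_sq_eq_re_inner (𝕜 := ℂ), inner_toLp_eq_integral hf hf, integral_mul_star_self]
  rfl

theorem norm_integral_mul_star_sq_le {μ : Measure (EuclideanSpace ℝ (Fin d))}
    (hf : MemLp f 2 μ) (hg : MemLp g 2 μ) :
    ‖∫ x, f x * star (g x) ∂μ‖ ^ 2 ≤ (∫ x, ‖f x‖ ^ 2 ∂μ) * ∫ x, ‖g x‖ ^ 2 ∂μ := by
  rw [← norm_toLp_sq hf, ← norm_toLp_sq hg, ← inner_toLp_eq_integral hf hg, ← mul_pow, mul_comm]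
  exact pow_le_pow_left₀ (norm_nonneg _) (norm_inner_le_norm _ _) 2

/-- The squared `L²` norm over the unit ball of the dilate `f(t ·)`. -/
noncomputable def energy (f : EuclideanSpace ℝ (Fin d) → ℂ) (t : ℝ) : ℝ :=
  ∫ x in Metric.ball 0 1, ‖f (t • x)‖ ^ 2

theorem energy_nonneg (f : EuclideanSpace ℝ (Fin d) → ℂ) (t : ℝ) : 0 ≤ energy f t :=
  integral_nonneg fun _ => by positivity

theorem energy_comp_smul (f : EuclideanSpace ℝ (Fin d) → ℂ) (s t : ℝ) :
    energy (fun x => f (s • x)) t = energy f (s * t) := by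
  simp only [energy, smul_smul]

/-- Moving one dilation across the pairing rewrites `E(t)` as the pairing of `f` with `f(t²·)`;
Cauchy–Schwarz then applies. -/
theorem energy_sq_le {t : ℝ} (hf : HarmonicOnBall f 1)
    (hf2 : MemLp f 2 (volume.restrict (Metric.ball 0 1))) (ht : 0 < t) (ht1 : t ≤ 1) :
    energy f t ^ 2 ≤ energy f 1 * energy f (t * t) := by
  have hft : HarmonicOnBall (fun x => f (t • x)) 1 := hf.comp_smul ht (by simpa using ht1)
  have hft2 := hf.memLp_comp_smul hf2 ht ht1
  have hftt2 := hft.memLp_comp_smul hft2 ht ht1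
  have h1 := integral_mul_dilation hf hf2 hft.conj hft2.star ht ht1
  have h2 := norm_integral_mul_star_sq_le hf2 hftt2
  have h3 : ∫ x in Metric.ball 0 1, f (t • x) * star (f (t • x)) = (energy f t : ℂ) :=
    integral_mul_star_self _
  rw [h1, h3, Complex.norm_real, Real.norm_of_nonneg (energy_nonneg f t)] at h2
  simpa only [energy, one_smul, smul_smul] using h2

theorem energy_le_of_bound {t C r : ℝ} (ht : 0 ≤ t) (hrt : t ≤ r)
    (h : ∀ x : EuclideanSpace ℝ (Fin d), ‖x‖ ≤ r → ‖f x‖ ≤ C) :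
    energy f t ≤ C ^ 2 * volume.real (Metric.ball (0 : EuclideanSpace ℝ (Fin d)) 1) := by
  suffices hbound : ∀ x ∈ Metric.ball (0 : EuclideanSpace ℝ (Fin d)) 1,
      ‖‖f (t • x)‖ ^ 2‖ ≤ C ^ 2 by
    exact (le_abs_self _).trans (norm_setIntegral_le_of_norm_le_const (μ := volume)
      measure_ball_lt_top hbound)
  intro x hx
  have hx1 := (mem_ball_zero_iff.1 hx).le
  have := h (t • x) (by
    rw [norm_smul, Real.norm_of_nonneg ht]
    exact (mul_le_of_le_one_right ht hx1).trans hrt)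
  rw [Real.norm_of_nonneg (by positivity)]
  exact pow_le_pow_left₀ (norm_nonneg _) this 2

/-- A harmonic function vanishing at the origin to order `K` decays like `t ^ K` in `L²` mean under
dilation by `t`. -/
theorem energy_le_of_isBigO {t : ℝ} {K : ℕ} (hf : HarmonicOnBall f 1)
    (hf2 : MemLp f 2 (volume.restrict (Metric.ball 0 1))) (ht : 0 < t) (ht1 : t < 1)
    (hO : f =O[𝓝 0] fun x => ‖x‖ ^ K) : energy f t ≤ t ^ (2 * K) * energy f 1 := by
  obtain ⟨C, hC0, hC⟩ := hO.exists_nonneg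
  obtain ⟨r, hr, hball⟩ := Metric.eventually_nhds_iff_ball.1 hC.bound
  -- Vanishing to order `K` bounds `E(tⁿ)` by a constant times `t^(2Kn)`; the ratio lemma then
  -- discards that constant.
  have key := le_mul_of_logConvex (f := fun n => energy f (t ^ n))
    (C := C ^ 2 * volume.real (Metric.ball (0 : EuclideanSpace ℝ (Fin d)) 1))
    (fun n => energy_nonneg _ _) (fun n => ?_) (q := t ^ (2 * K)) (by positivity) ?_
  · simpa using key
  · have hn : 0 < t ^ n := by positivity
    have hn1 : t ^ n ≤ 1 := pow_le_one₀ ht.le ht1.le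
    have := energy_sq_le (hf.comp_smul (r := 1) hn (by simpa using hn1))
      (hf.memLp_comp_smul hf2 hn hn1) ht ht1.le
    simp only [energy_comp_smul] at this
    rwa [mul_one, ← pow_succ, ← mul_assoc, ← pow_succ, ← pow_succ] at this
  · have hlim := (tendsto_pow_atTop_nhds_zero_of_lt_one ht.le ht1).eventually_lt_const hr
    filter_upwards [hlim] with n hn
    have := energy_le_of_bound (f := f) (C := C * (t ^ n) ^ K) (t := t ^ n) (by positivity) le_rfl
      fun x hx => by
        have h1 := hball x (mem_ball_zero_iff.2 (hx.trans_lt hn))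
        rw [norm_pow, norm_norm] at h1
        exact h1.trans (mul_le_mul_of_nonneg_left (pow_le_pow_left₀ (norm_nonneg _) hx K) hC0)
    refine this.trans (le_of_eq ?_)
    ring

/-- An entire harmonic function of polynomial growth of order `K` decays at most like `t ^ K` in
`L²` mean under dilation by `t`. -/
theorem le_energy_of_growth {t C : ℝ} {K : ℕ} (hf : ∀ R, HarmonicOnBall f R) (ht : 0 < t)
    (ht1 : t < 1) (hC : ∀ x, ‖f x‖ ≤ C * (1 + ‖x‖) ^ K) :
    t ^ (2 * K) * energy f 1 ≤ energy f t := by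
  have hC0 : 0 ≤ C := by simpa using (norm_nonneg _).trans (hC 0)
  have hs : 1 < t⁻¹ := (one_lt_inv₀ ht).2 ht1
  have hs0 : 0 < t⁻¹ := inv_pos.2 ht
  -- The sequence of radii runs outwards: index 0 is `t`, index 1 is the unit radius, and the growth
  -- bound controls the tail. The outcome is `E(1) ≤ t^(-2K) E(t)`.
  have key := le_mul_of_logConvex (f := fun n => energy f (t * t⁻¹ ^ n))
    (C := (C * 2 ^ K) ^ 2 * volume.real (Metric.ball (0 : EuclideanSpace ℝ (Fin d)) 1))
    (fun n => energy_nonneg _ _) (fun n => ?_) (q := t⁻¹ ^ (2 * K)) (by positivity) ?_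
  · simp only [pow_one, mul_inv_cancel₀ ht.ne', pow_zero, mul_one] at key
    rwa [inv_pow, ← div_eq_inv_mul, le_div_iff₀ (by positivity), mul_comm] at key
  · have hr : 0 < t * t⁻¹ ^ (n + 2) := by positivity
    have hh : ∀ R, HarmonicOnBall (fun x => f ((t * t⁻¹ ^ (n + 2)) • x)) R := fun R =>
      (hf (t * t⁻¹ ^ (n + 2) * R)).comp_smul hr le_rfl
    have := energy_sq_le (hh 1) ((hh 2).memLp (by norm_num)) ht ht1.le
    simp only [energy_comp_smul] at this
    have e1 : t * t⁻¹ ^ (n + 2) * t = t * t⁻¹ ^ (n + 1) := by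
      rw [pow_succ t⁻¹ (n + 1)]; field_simp
    have e2 : t * t⁻¹ ^ (n + 2) * (t * t) = t * t⁻¹ ^ n := by
      rw [pow_add t⁻¹ n 2]; field_simp
    rw [e1, e2, mul_one, mul_comm (energy _ _)] at this
    exact this
  · refine Eventually.of_forall fun n => ?_
    have h1 : 1 ≤ t⁻¹ ^ n := one_le_pow₀ hs.le
    have := energy_le_of_bound (f := f) (C := C * (2 * t⁻¹ ^ n) ^ K) (t := t * t⁻¹ ^ n)
      (r := t⁻¹ ^ n) (by positivity) (mul_le_of_le_one_left (by positivity) ht1.le)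
      fun x hx => (hC x).trans (mul_le_mul_of_nonneg_left
        (pow_le_pow_left₀ (by positivity) (by linarith) K) hC0)
    refine this.trans (le_of_eq ?_)
    ring

end Energy

/-! ### Order of vanishing and derivatives at the origin -/

section Taylor

/-- The iterated partial derivative along a list of directions. -/
noncomputable def iterPartial (l : List (Fin d)) (f : EuclideanSpace ℝ (Fin d) → ℂ) :
    EuclideanSpace ℝ (Fin d) → ℂ :=
  l.foldl (fun g i => partialDeriv i g) f

theorem iterPartial_cons (i : Fin d) (l : List (Fin d)) (f : EuclideanSpace ℝ (Fin d) → ℂ) :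
    iterPartial (i :: l) f = iterPartial l (partialDeriv i f) := rfl

variable {f g : EuclideanSpace ℝ (Fin d) → ℂ} {U : Set (EuclideanSpace ℝ (Fin d))}

/-- By induction the first partial derivatives are `O(‖x‖^K)`, and the mean value inequality on the
closed ball of radius `‖x‖` gains one power. -/
theorem isBigO_norm_pow_of_iterPartial_eq_zero (hU : IsOpen U) (h0 : 0 ∈ U) (K : ℕ) :
    ∀ f : EuclideanSpace ℝ (Fin d) → ℂ, ContDiffOn ℝ ∞ f U →
      (∀ l : List (Fin d), l.length < K → iterPartial l f 0 = 0) →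
      f =O[𝓝 0] fun x => ‖x‖ ^ K := by
  induction K with
  | zero =>
    intro f hf _
    simpa using (hf.continuousOn.continuousAt (hU.mem_nhds h0)).norm.isBoundedUnder_le.isBigO_one ℝ
  | succ K ih =>
    intro f hf hl
    have hp : ∀ i, partialDeriv i f =O[𝓝 0] fun x => ‖x‖ ^ K := fun i =>
      ih _ (ContDiffOn.partialDeriv hf hU i) fun l hlen => hl (i :: l) (by simpa using hlen)
    choose C hC0 hC using fun i => (hp i).exists_nonneg
    have hev : ∀ᶠ x in 𝓝 (0 : EuclideanSpace ℝ (Fin d)),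
        (∀ i, ‖partialDeriv i f x‖ ≤ C i * ‖‖x‖ ^ K‖) ∧ x ∈ U :=
      (eventually_all.2 fun i => (hC i).bound).and (hU.mem_nhds h0)
    obtain ⟨r, hr, hball⟩ := Metric.eventually_nhds_iff_ball.1 hev
    refine Asymptotics.IsBigO.of_bound (∑ i, C i) ?_
    filter_upwards [Metric.ball_mem_nhds 0 hr] with x hx
    have hxr := mem_ball_zero_iff.1 hx
    have hsub : ∀ y ∈ Metric.closedBall (0 : EuclideanSpace ℝ (Fin d)) ‖x‖,
        y ∈ Metric.ball 0 r := fun y hy =>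
      mem_ball_zero_iff.2 ((mem_closedBall_zero_iff.1 hy).trans_lt hxr)
    have hmv := (convex_closedBall (0 : EuclideanSpace ℝ (Fin d)) ‖x‖).norm_image_sub_le_of_norm_fderiv_le
      (𝕜 := ℝ) (f := f) (C := (∑ i, C i) * ‖x‖ ^ K) (x := 0) (y := x)
      (fun y hy => (hf.contDiffAt (hU.mem_nhds (hball y (hsub y hy)).2)).differentiableAt (by simp))
      (fun y hy => ?_) (by simp) (by simp)
    · have hf0 : f 0 = 0 := hl [] (by simp)
      rw [hf0, sub_zero, sub_zero] at hmv
      rw [norm_pow, norm_norm, pow_succ, ← mul_assoc]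
      exact hmv
    · refine ContinuousLinearMap.opNorm_le_bound _
        (mul_nonneg (Finset.sum_nonneg fun i _ => hC0 i) (by positivity)) fun v => ?_
      rw [fderiv_apply_eq_sum, Finset.sum_mul, Finset.sum_mul]
      refine (norm_sum_le _ _).trans (Finset.sum_le_sum fun i _ => ?_)
      have h1 := (hball y (hsub y hy)).1 i
      rw [norm_pow, norm_norm] at h1
      rw [norm_mul, Complex.norm_real, mul_comm]
      refine mul_le_mul (h1.trans ?_) (PiLp.norm_apply_le v i) (norm_nonneg _)
        (mul_nonneg (hC0 i) (by positivity))
      exact mul_le_mul_of_nonneg_left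
        (pow_le_pow_left₀ (norm_nonneg _) (mem_closedBall_zero_iff.1 hy) K) (hC0 i)

theorem iterPartial_congr (hU : IsOpen U) (h : EqOn f g U) (l : List (Fin d)) :
    EqOn (iterPartial l f) (iterPartial l g) U := by
  induction l generalizing f g with
  | nil => exact h
  | cons i l ih =>
    exact ih fun x hx => (Filter.EventuallyEq.partialDeriv
      (h.eventuallyEq_of_mem (hU.mem_nhds hx)) i).eq_of_nhds

theorem iterPartial_add (hU : IsOpen U) (hf : ContDiffOn ℝ ∞ f U) (hg : ContDiffOn ℝ ∞ g U)
    (l : List (Fin d)) :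
    EqOn (iterPartial l fun x => f x + g x) (fun x => iterPartial l f x + iterPartial l g x) U := by
  induction l generalizing f g with
  | nil => exact fun x _ => rfl
  | cons i l ih =>
    intro x hx
    rw [iterPartial_cons, iterPartial_congr hU (fun y hy => partialDeriv_add
      ((hf.contDiffAt (hU.mem_nhds hy)).differentiableAt (by simp))
      ((hg.contDiffAt (hU.mem_nhds hy)).differentiableAt (by simp)) i) l hx]
    exact ih (ContDiffOn.partialDeriv hf hU i) (ContDiffOn.partialDeriv hg hU i) hx

theorem iterPartial_const_mul (hU : IsOpen U) (hf : ContDiffOn ℝ ∞ f U) (a : ℂ)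
    (l : List (Fin d)) :
    EqOn (iterPartial l fun x => a * f x) (fun x => a * iterPartial l f x) U := by
  induction l generalizing f with
  | nil => exact fun x _ => rfl
  | cons i l ih =>
    intro x hx
    rw [iterPartial_cons, iterPartial_congr hU (fun y hy => partialDeriv_const_mul
      ((hf.contDiffAt (hU.mem_nhds hy)).differentiableAt (by simp)) a i) l hx]
    exact ih (ContDiffOn.partialDeriv hf hU i) hx

theorem iterPartial_sum {ι : Type*} (hU : IsOpen U) (s : Finset ι)
    {F : ι → EuclideanSpace ℝ (Fin d) → ℂ} (hF : ∀ i, ContDiffOn ℝ ∞ (F i) U)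
    (l : List (Fin d)) :
    EqOn (iterPartial l fun x => ∑ i ∈ s, F i x) (fun x => ∑ i ∈ s, iterPartial l (F i) x) U := by
  classical
  induction s using Finset.induction_on with
  | empty =>
    intro x hx
    have := iterPartial_const_mul hU (contDiffOn_const (c := (0 : ℂ))) 0 l hx
    simpa using this
  | insert i s hi ih =>
    intro x hx
    simp only [Finset.sum_insert hi]
    rw [iterPartial_add hU (hF i) (ContDiffOn.sum fun j _ => hF j) l hx]
    exact congrArg _ (ih hx)

theorem iterPartial_perm (hU : IsOpen U) {l l' : List (Fin d)} (h : l.Perm l') :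
    ∀ f : EuclideanSpace ℝ (Fin d) → ℂ, ContDiffOn ℝ ∞ f U →
      EqOn (iterPartial l f) (iterPartial l' f) U := by
  induction h with
  | nil => exact fun f _ x _ => rfl
  | cons i _ ih => exact fun f hf => ih _ (ContDiffOn.partialDeriv hf hU i)
  | swap i j l =>
    exact fun f hf => iterPartial_congr hU (fun x hx => partialDeriv_comm hf hU hx _ _) l
  | trans _ _ ih₁ ih₂ => exact fun f hf => (ih₁ f hf).trans (ih₂ f hf)

/-- For a harmonic function, the partial derivatives at the origin that are of order at most one
in the first variable determine all others. -/
theorem iterPartial_eq_zero_of_harmonic {m K : ℕ} {f : EuclideanSpace ℝ (Fin (m + 1)) → ℂ}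
    (hf : HarmonicOnBall f 1)
    (h₀ : ∀ s : Multiset (Fin m), s.card < K → iterPartial (s.toList.map Fin.succ) f 0 = 0)
    (h₁ : ∀ s : Multiset (Fin m), s.card + 1 < K →
      iterPartial (0 :: s.toList.map Fin.succ) f 0 = 0) :
    ∀ n, ∀ l : List (Fin (m + 1)), l.count 0 ≤ n → l.length < K → iterPartial l f 0 = 0 := by
  have hU : IsOpen (Metric.ball (0 : EuclideanSpace ℝ (Fin (m + 1))) 1) := Metric.isOpen_ball
  have hmem : (0 : EuclideanSpace ℝ (Fin (m + 1))) ∈ Metric.ball 0 1 := by simp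
  have hmap : ∀ l : List (Fin (m + 1)), l.count 0 = 0 →
      ∃ s : Multiset (Fin m), s.card = l.length ∧ l.Perm (s.toList.map Fin.succ) := by
    intro l hl
    have hne : ∀ i ∈ l, i ≠ 0 := fun i hi h0 => List.count_eq_zero.1 hl (h0 ▸ hi)
    obtain ⟨l', rfl⟩ : ∃ l' : List (Fin m), l = l'.map Fin.succ := by
      clear hl
      induction l with
      | nil => exact ⟨[], rfl⟩
      | cons i l ih =>
        obtain ⟨l', rfl⟩ := ih fun j hj => hne j (List.mem_cons_of_mem _ hj)
        obtain ⟨j, rfl⟩ := Fin.exists_succ_eq.2 (hne i List.mem_cons_self)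
        exact ⟨j :: l', rfl⟩
    refine ⟨(l' : Multiset (Fin m)), by simp, List.Perm.map _ ?_⟩
    exact (Multiset.coe_eq_coe.1 (Multiset.coe_toList (l' : Multiset (Fin m)))).symm
  intro n
  induction n using Nat.strong_induction_on with
  | _ n ih =>
    intro l hln hlen
    rcases Nat.lt_or_ge (l.count 0) 2 with hlt | hge
    · interval_cases hc : l.count 0
      · obtain ⟨s, hs, hp⟩ := hmap l hc
        rw [iterPartial_perm hU hp f hf.contDiffOn hmem]
        exact h₀ s (hs ▸ hlen)
      · have hin : (0 : Fin (m + 1)) ∈ l := List.count_pos_iff.1 (by omega)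
        have hp := List.perm_cons_erase hin
        obtain ⟨s, hs, hp'⟩ := hmap (l.erase 0) (by rw [List.count_erase_self, hc])
        rw [iterPartial_perm hU (hp.trans (hp'.cons 0)) f hf.contDiffOn hmem]
        refine h₁ s ?_
        rw [hs, List.length_erase_of_mem hin]
        have := List.length_pos_of_mem hin
        omega
    · have hin : (0 : Fin (m + 1)) ∈ l := List.count_pos_iff.1 (by omega)
      have hin' : (0 : Fin (m + 1)) ∈ l.erase 0 :=
        List.count_pos_iff.1 (by rw [List.count_erase_self]; omega)
      have hp := (List.perm_cons_erase hin).trans ((List.perm_cons_erase hin').cons 0)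
      set l' := (l.erase 0).erase 0 with hl'
      have hlen' : l.length = l'.length + 2 := by simpa using hp.length_eq
      have hcount : l.count 0 = l'.count 0 + 2 := by simpa using hp.count_eq 0
      rw [iterPartial_perm hU hp f hf.contDiffOn hmem, iterPartial_cons, iterPartial_cons]
      have hsm : ∀ i, ContDiffOn ℝ ∞ (partialDeriv i (partialDeriv i f)) (Metric.ball 0 1) :=
        fun i => ContDiffOn.partialDeriv (ContDiffOn.partialDeriv hf.contDiffOn hU i) hU i
      -- Harmonicity trades two derivatives in the first variable for pairs in the others; the order
      -- is unchanged and the count of zeros drops by two.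
      have heq : EqOn (partialDeriv 0 (partialDeriv 0 f))
          (fun x => (-1) * ∑ i : Fin m, partialDeriv i.succ (partialDeriv i.succ f) x)
          (Metric.ball 0 1) := by
        intro x hx
        have := hf.coordLaplacian_eq_zero x hx
        rw [coordLaplacian, Fin.sum_univ_succ] at this
        simp only
        linear_combination this
      rw [iterPartial_congr hU heq l' hmem, iterPartial_const_mul hU
        (ContDiffOn.sum fun i _ => hsm (Fin.succ i)) (-1) l' hmem]
      simp only
      rw [iterPartial_sum hU Finset.univ (fun i => hsm (Fin.succ i)) l' hmem]
      simp only
      rw [Finset.sum_eq_zero, mul_zero]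
      intro i _
      have hci : (i.succ :: i.succ :: l').count 0 = l'.count 0 := by
        simp
      exact ih (l'.count 0) (by omega) (i.succ :: i.succ :: l') hci.le (by simp; omega)

end Taylor

/-! ### Smooth representatives of elements of the harmonic subspace -/

section Representative

instance isFiniteMeasure_lebesgueOn_ball (r : ℝ) :
    IsFiniteMeasure (lebesgueOn (Metric.ball (0 : EuclideanSpace ℝ (Fin d)) r)) :=
  ⟨by simpa [lebesgueOn] using measure_ball_lt_top⟩

theorem weaklyHarmonic_of_mem
    (u : harmonicL2 (Metric.ball (0 : EuclideanSpace ℝ (Fin d)) 1)) :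
    WeaklyHarmonic (u : Lp ℂ 2 (lebesgueOn (Metric.ball (0 : EuclideanSpace ℝ (Fin d)) 1))) 0 1 :=
  fun φ hφ => by
    rw [← laplacian_eq_coordLaplacian hφ.contDiff]
    exact u.2 φ hφ

theorem exists_harmonicRep (u : harmonicL2 (Metric.ball (0 : EuclideanSpace ℝ (Fin d)) 1)) :
    ∃ f, HarmonicOnBall f 1 ∧ f =ᵐ[lebesgueOn (Metric.ball 0 1)]
      (u : Lp ℂ 2 (lebesgueOn (Metric.ball (0 : EuclideanSpace ℝ (Fin d)) 1))) :=
  have hi : Integrable u.1 (lebesgueOn (Metric.ball 0 1)) := (Lp.memLp u.1).integrable (by norm_num)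
  exists_harmonicOnBall_ae_eq hi (weaklyHarmonic_of_mem u)

/-- The smooth representative of an element of the harmonic subspace. -/
noncomputable def harmonicRep (u : harmonicL2 (Metric.ball (0 : EuclideanSpace ℝ (Fin d)) 1)) :
    EuclideanSpace ℝ (Fin d) → ℂ :=
  (exists_harmonicRep u).choose

theorem harmonicOnBall_harmonicRep
    (u : harmonicL2 (Metric.ball (0 : EuclideanSpace ℝ (Fin d)) 1)) :
    HarmonicOnBall (harmonicRep u) 1 :=
  (exists_harmonicRep u).choose_spec.1

theorem harmonicRep_ae_eq (u : harmonicL2 (Metric.ball (0 : EuclideanSpace ℝ (Fin d)) 1)) :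
    harmonicRep u =ᵐ[lebesgueOn (Metric.ball 0 1)]
      (u : Lp ℂ 2 (lebesgueOn (Metric.ball (0 : EuclideanSpace ℝ (Fin d)) 1))) :=
  (exists_harmonicRep u).choose_spec.2

theorem memLp_harmonicRep (u : harmonicL2 (Metric.ball (0 : EuclideanSpace ℝ (Fin d)) 1)) :
    MemLp (harmonicRep u) 2 (lebesgueOn (Metric.ball 0 1)) :=
  (memLp_congr_ae (harmonicRep_ae_eq u)).2 (Lp.memLp _)

theorem energy_harmonicRep_one (u : harmonicL2 (Metric.ball (0 : EuclideanSpace ℝ (Fin d)) 1)) :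
    energy (harmonicRep u) 1 = ‖u‖ ^ 2 := by
  have h : (memLp_harmonicRep u).toLp (harmonicRep u) = u.1 := by
    refine Lp.ext ?_
    exact (memLp_harmonicRep u).coeFn_toLp.trans (harmonicRep_ae_eq u)
  change _ = ‖u.1‖ ^ 2
  rw [← h, norm_toLp_sq]
  simp [energy]

/-- Representatives are chosen arbitrarily, but in the open ball continuity upgrades almost
everywhere equality to equality, which is enough for derivatives at the origin to be linear
functionals. -/
theorem harmonicRep_add (u v : harmonicL2 (Metric.ball (0 : EuclideanSpace ℝ (Fin d)) 1)) :
    EqOn (harmonicRep (u + v)) (fun x => harmonicRep u x + harmonicRep v x) (Metric.ball 0 1) := by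
  refine Measure.eqOn_open_of_ae_eq (μ := volume) ?_ Metric.isOpen_ball
    (harmonicOnBall_harmonicRep _).contDiffOn.continuousOn
    ((harmonicOnBall_harmonicRep u).contDiffOn.continuousOn.add
      (harmonicOnBall_harmonicRep v).contDiffOn.continuousOn)
  filter_upwards [harmonicRep_ae_eq (u + v), harmonicRep_ae_eq u, harmonicRep_ae_eq v,
    Lp.coeFn_add (u : Lp ℂ 2 (lebesgueOn (Metric.ball (0 : EuclideanSpace ℝ (Fin d)) 1))) v]
    with x h1 h2 h3 h4
  rw [h1, h2, h3, Submodule.coe_add, h4, Pi.add_apply]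

theorem harmonicRep_smul (a : ℂ) (u : harmonicL2 (Metric.ball (0 : EuclideanSpace ℝ (Fin d)) 1)) :
    EqOn (harmonicRep (a • u)) (fun x => a * harmonicRep u x) (Metric.ball 0 1) := by
  refine Measure.eqOn_open_of_ae_eq (μ := volume) ?_ Metric.isOpen_ball
    (harmonicOnBall_harmonicRep _).contDiffOn.continuousOn
    (continuousOn_const.mul (harmonicOnBall_harmonicRep u).contDiffOn.continuousOn)
  filter_upwards [harmonicRep_ae_eq (a • u), harmonicRep_ae_eq u,
    Lp.coeFn_smul a (u : Lp ℂ 2 (lebesgueOn (Metric.ball (0 : EuclideanSpace ℝ (Fin d)) 1)))]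
    with x h1 h2 h3
  rw [h1, h2, Submodule.coe_smul, h3, Pi.smul_apply, smul_eq_mul]

/-- The value at the origin of an iterated partial derivative, as a linear functional. -/
noncomputable def derivAtZero (l : List (Fin d)) :
    harmonicL2 (Metric.ball (0 : EuclideanSpace ℝ (Fin d)) 1) →ₗ[ℂ] ℂ where
  toFun u := iterPartial l (harmonicRep u) 0
  map_add' u v := by
    have h0 : (0 : EuclideanSpace ℝ (Fin d)) ∈ Metric.ball 0 1 := by simp
    rw [iterPartial_congr Metric.isOpen_ball (harmonicRep_add u v) l h0,
      iterPartial_add Metric.isOpen_ball (harmonicOnBall_harmonicRep u).contDiffOn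
        (harmonicOnBall_harmonicRep v).contDiffOn l h0]
  map_smul' a u := by
    have h0 : (0 : EuclideanSpace ℝ (Fin d)) ∈ Metric.ball 0 1 := by simp
    rw [iterPartial_congr Metric.isOpen_ball (harmonicRep_smul a u) l h0,
      iterPartial_const_mul Metric.isOpen_ball (harmonicOnBall_harmonicRep u).contDiffOn a l h0]
    rfl

end Representative

/-! ### Counting the conditions for vanishing at the origin -/

section Jets

variable {m : ℕ}

/-- Multisets of size less than `K` over `Fin m`. -/
abbrev MultiIndex (m K : ℕ) : Type := Σ k : Fin K, Sym (Fin m) k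

/-- Derivatives at the origin of order at most `K`, of order at most one in the first variable;
for harmonic functions they determine all derivatives of order less than `K`. -/
noncomputable def jets (m K : ℕ) :
    harmonicL2 (Metric.ball (0 : EuclideanSpace ℝ (Fin (m + 1))) 1) →ₗ[ℂ]
      (MultiIndex m K ⊕ MultiIndex m K → ℂ) :=
  LinearMap.pi <| Sum.elim
    (fun s => derivAtZero ((s.2 : Multiset (Fin m)).toList.map Fin.succ))
    (fun s => derivAtZero (0 :: (s.2 : Multiset (Fin m)).toList.map Fin.succ))

theorem isBigO_harmonicRep_of_jets_eq_zero {K : ℕ}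
    {u : harmonicL2 (Metric.ball (0 : EuclideanSpace ℝ (Fin (m + 1))) 1)} (hu : jets m K u = 0) :
    harmonicRep u =O[𝓝 0] fun x => ‖x‖ ^ K := by
  refine isBigO_norm_pow_of_iterPartial_eq_zero Metric.isOpen_ball (by simp) K _
    (harmonicOnBall_harmonicRep u).contDiffOn fun l hl => ?_
  refine iterPartial_eq_zero_of_harmonic (harmonicOnBall_harmonicRep u) (fun s hs => ?_)
    (fun s hs => ?_) _ l le_rfl hl
  · exact congrFun hu (Sum.inl ⟨⟨s.card, hs⟩, ⟨s, rfl⟩⟩)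
  -- The index type allows one order more than needed here; equal blocks cost only lower-order terms
  -- in the dimension.
  · exact congrFun hu (Sum.inr ⟨⟨s.card, by omega⟩, ⟨s, rfl⟩⟩)

/-- The hockey-stick identity for multiset coefficients. -/
theorem card_multiIndex (m K : ℕ) : Fintype.card (MultiIndex m (K + 1)) = (m + K).choose m := by
  have h : ∀ K, ∑ k ∈ Finset.range (K + 1), m.multichoose k = (m + 1).multichoose K := by
    intro K
    induction K with
    | zero => simp
    | succ K ih => rw [Finset.sum_range_succ, ih, Nat.multichoose_succ_succ, add_comm]
  rw [Fintype.card_sigma]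
  simp only [Sym.card_sym_eq_multichoose, Fintype.card_fin]
  rw [Fin.sum_univ_eq_sum_range (fun k => m.multichoose k), h, Nat.multichoose_eq]
  rw [show m + 1 + K - 1 = m + K by omega]
  exact (Nat.choose_symm_add).symm

theorem finrank_jets_le (m K : ℕ) :
    (Module.finrank ℂ (MultiIndex m (K + 1) ⊕ MultiIndex m (K + 1) → ℂ) : ℝ) ≤
      2 * (m + K : ℝ) ^ m / m.factorial := by
  have h := Nat.choose_le_pow_div (α := ℝ) m (m + K)
  rw [Module.finrank_fintype_fun_eq_card, Fintype.card_sum, card_multiIndex]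
  push_cast at h ⊢
  rw [mul_div_assoc]
  linarith

end Jets

/-! ### Harmonic polynomials as trial functions -/

section Polynomial

/-- The function on `ℝ^d` defined by a polynomial with complex coefficients. -/
noncomputable def polyFun (p : MvPolynomial (Fin d) ℂ) (x : EuclideanSpace ℝ (Fin d)) : ℂ :=
  MvPolynomial.eval (fun i => ((x i : ℝ) : ℂ)) p

theorem contDiff_polyFun (p : MvPolynomial (Fin d) ℂ) : ContDiff ℝ ∞ (polyFun p) := by
  induction p using MvPolynomial.induction_on with
  | C a =>
    rw [show polyFun (MvPolynomial.C a) = fun _ : EuclideanSpace ℝ (Fin d) => a from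
      funext fun x => by simp [polyFun]]
    exact contDiff_const
  | add p q hp hq =>
    rw [show polyFun (p + q) = fun x => polyFun p x + polyFun q x from
      funext fun x => by simp [polyFun]]
    exact hp.add hq
  | mul_X p i hp =>
    rw [show polyFun (p * MvPolynomial.X i) = fun x => polyFun p x * ((x i : ℝ) : ℂ) from
      funext fun x => by simp [polyFun]]
    exact hp.mul (contDiff_coord i)

theorem partialDeriv_polyFun (p : MvPolynomial (Fin d) ℂ) (i : Fin d) :
    partialDeriv i (polyFun p) = polyFun (MvPolynomial.pderiv i p) := by
  have hd : ∀ p : MvPolynomial (Fin d) ℂ, Differentiable ℝ (polyFun p) :=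
    fun p => (contDiff_polyFun p).differentiable (by simp)
  funext x
  induction p using MvPolynomial.induction_on with
  | C a =>
    rw [show polyFun (MvPolynomial.C a) = fun _ : EuclideanSpace ℝ (Fin d) => a from
      funext fun x => by simp [polyFun], partialDeriv_const]
    simp [polyFun]
  | add p q hp hq =>
    rw [show polyFun (p + q) = fun x => polyFun p x + polyFun q x from
      funext fun x => by simp [polyFun], partialDeriv_add (hd p x) (hd q x), hp, hq]
    simp [polyFun]
  | mul_X p j hp =>
    rw [show polyFun (p * MvPolynomial.X j) = fun x => polyFun p x * ((x j : ℝ) : ℂ) from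
      funext fun x => by simp [polyFun], partialDeriv_mul (hd p x)
      ((contDiff_coord j).differentiable (by simp) x), hp, partialDeriv_coord]
    simp only [polyFun, Derivation.leibniz, MvPolynomial.pderiv_X, map_add, smul_eq_mul, map_mul,
      MvPolynomial.eval_X, Pi.single_apply, eq_comm (a := i)]
    split_ifs <;> simp

/-- The Laplacian of a polynomial. -/
noncomputable def polyLaplacian (d : ℕ) : MvPolynomial (Fin d) ℂ →ₗ[ℂ] MvPolynomial (Fin d) ℂ :=
  ∑ i, (MvPolynomial.pderiv i).toLinearMap ∘ₗ (MvPolynomial.pderiv i).toLinearMap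

theorem coordLaplacian_polyFun (p : MvPolynomial (Fin d) ℂ) :
    coordLaplacian (polyFun p) = polyFun (polyLaplacian d p) := by
  funext x
  simp only [coordLaplacian, partialDeriv_polyFun]
  simp [polyFun, polyLaplacian]

theorem harmonicOnBall_polyFun {p : MvPolynomial (Fin d) ℂ} (hp : polyLaplacian d p = 0) (R : ℝ) :
    HarmonicOnBall (polyFun p) R :=
  ⟨(contDiff_polyFun p).contDiffOn, fun x _ => by
    rw [coordLaplacian_polyFun, hp]
    simp [polyFun]⟩

theorem exists_norm_polyFun_le {p : MvPolynomial (Fin d) ℂ} {N : ℕ}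
    (hp : p ∈ MvPolynomial.restrictTotalDegree (Fin d) ℂ N) :
    ∃ C, ∀ x, ‖polyFun p x‖ ≤ C * (1 + ‖x‖) ^ N := by
  refine ⟨∑ α ∈ p.support, ‖p.coeff α‖, fun x => ?_⟩
  rw [polyFun, MvPolynomial.eval_eq, Finset.sum_mul]
  refine (norm_sum_le _ _).trans (Finset.sum_le_sum fun α hα => ?_)
  rw [norm_mul, norm_prod]
  refine mul_le_mul_of_nonneg_left ?_ (norm_nonneg _)
  have h1 : (1 : ℝ) ≤ 1 + ‖x‖ := by linarith [norm_nonneg x]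
  have hdeg : ∑ i ∈ α.support, α i ≤ N := hp hα
  calc ∏ i ∈ α.support, ‖((x i : ℝ) : ℂ) ^ α i‖ ≤ ∏ i ∈ α.support, (1 + ‖x‖) ^ α i := by
        refine Finset.prod_le_prod (fun i _ => norm_nonneg _) fun i _ => ?_
        rw [norm_pow, Complex.norm_real]
        refine pow_le_pow_left₀ (norm_nonneg _) ?_ _
        linarith [PiLp.norm_apply_le x i]
    _ = (1 + ‖x‖) ^ ∑ i ∈ α.support, α i := Finset.prod_pow_eq_pow_sum _ _ _
    _ ≤ (1 + ‖x‖) ^ N := pow_le_pow_right₀ h1 hdeg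

/-- The ball contains a cube around the origin, and a polynomial vanishing on a product of infinite
sets is zero. -/
theorem eq_zero_of_polyFun_eqOn_zero {p : MvPolynomial (Fin d) ℂ} {r : ℝ} (hr : 0 < r)
    (h : ∀ x ∈ Metric.ball 0 r, polyFun p x = 0) : p = 0 := by
  have hopen : IsOpen ((EuclideanSpace.equiv (Fin d) ℝ).symm ⁻¹'
      (Metric.ball (0 : EuclideanSpace ℝ (Fin d)) r)) :=
    Metric.isOpen_ball.preimage (EuclideanSpace.equiv (Fin d) ℝ).symm.continuous
  obtain ⟨ε, hε, hsub⟩ := Metric.isOpen_iff.1 hopen 0 (by simpa using hr)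
  refine MvPolynomial.funext_set (fun _ => (fun t : ℝ => (t : ℂ)) '' Metric.ball (0 : ℝ) ε)
    (fun _ => (infinite_of_mem_nhds 0 (Metric.ball_mem_nhds 0 hε)).image
      Complex.ofReal_injective.injOn) fun x hx => ?_
  choose y hy hyx using fun i => hx i (mem_univ i)
  have h2 := h ((EuclideanSpace.equiv (Fin d) ℝ).symm y) (hsub (by
    rw [ball_pi _ hε]
    exact fun i _ => hy i))
  rw [map_zero]
  have h3 : x = fun i => ((y i : ℝ) : ℂ) := funext fun i => (hyx i).symm
  rw [h3]
  exact h2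

theorem polyLaplacian_mem {n : ℕ} {p : MvPolynomial (Fin d) ℂ}
    (hp : p ∈ MvPolynomial.restrictTotalDegree (Fin d) ℂ (n + 2)) :
    polyLaplacian d p ∈ MvPolynomial.restrictTotalDegree (Fin d) ℂ n := by
  rw [MvPolynomial.restrictTotalDegree, MvPolynomial.restrictSupport_eq_span] at hp
  induction hp using Submodule.span_induction with
  | zero => simp
  | add p q _ _ hp hq => rw [map_add]; exact Submodule.add_mem _ hp hq
  | smul a p _ hp => rw [map_smul]; exact Submodule.smul_mem _ _ hp
  | mem p hp =>
    obtain ⟨α, hα, rfl⟩ := hp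
    simp only [polyLaplacian, LinearMap.sum_apply, LinearMap.comp_apply]
    refine Submodule.sum_mem _ fun i _ => ?_
    simp only [Derivation.coeFn_coe, MvPolynomial.pderiv_monomial]
    rw [MvPolynomial.restrictTotalDegree, MvPolynomial.monomial_mem_restrictSupport]
    -- For exponents below 2 subtraction on exponents truncates, so the degree argument breaks down;
    -- there the coefficient of the second derivative is zero.
    rcases Nat.lt_or_ge (α i) 2 with hlt | hge
    · right
      interval_cases h : α i <;> simp [h]
    · left
      have hle : Finsupp.single i 1 + Finsupp.single i 1 ≤ α := by
        rw [← Finsupp.single_add]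
        exact Finsupp.single_le_iff.2 hge
      have hdeg : α.degree ≤ n + 2 := hα
      have heq := tsub_add_cancel_of_le hle
      rw [← tsub_tsub] at heq
      have := congrArg Finsupp.degree heq
      simp only [map_add, Finsupp.degree_single] at this
      change (α - Finsupp.single i 1 - Finsupp.single i 1).degree ≤ n
      omega

/-- Monomials of degree at most `N` correspond to multisets of variables of size less than `N + 1`,
which are already counted. -/
theorem finrank_restrictTotalDegree (d N : ℕ) :
    Module.finrank ℂ (MvPolynomial.restrictTotalDegree (Fin d) ℂ N) =
      (d + N).choose d := by
  have hdeg : ∀ α : Fin d →₀ ℕ, (α.toMultiset).card = α.degree := fun α =>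
    Finsupp.card_toMultiset α
  let g : MultiIndex d (N + 1) → {α : Fin d →₀ ℕ | (α.sum fun _ e => e) ≤ N} :=
    fun s => ⟨Multiset.toFinsupp (s.2 : Multiset (Fin d)), by
      have h := hdeg (Multiset.toFinsupp (s.2 : Multiset (Fin d)))
      rw [Multiset.toFinsupp_toMultiset, Sym.card_coe] at h
      exact h.symm.le.trans (Nat.lt_succ_iff.1 s.1.2)⟩
  have hg : Function.Bijective g := by
    constructor
    · rintro ⟨⟨k, hk⟩, ⟨s, hs⟩⟩ ⟨⟨k', hk'⟩, ⟨s', hs'⟩⟩ h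
      have h1 : s = s' := Multiset.toFinsupp.injective (Subtype.ext_iff.1 h)
      subst h1
      simp only at hs hs'
      subst hs
      subst hs'
      rfl
    · rintro ⟨α, hα⟩
      refine ⟨⟨⟨α.toMultiset.card, ?_⟩, ⟨α.toMultiset, rfl⟩⟩, Subtype.ext ?_⟩
      · rw [hdeg]
        exact Nat.lt_succ_iff.2 hα
      · exact Finsupp.toMultiset_toFinsupp α
  rw [← card_multiIndex, ← Nat.card_eq_fintype_card, Nat.card_eq_of_bijective g hg]
  exact Module.finrank_eq_nat_card_basis (MvPolynomial.basisRestrictSupport ℂ _)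

/-- The harmonic polynomials of degree at most `N`. -/
noncomputable def harmonicPolynomial (d N : ℕ) : Submodule ℂ (MvPolynomial (Fin d) ℂ) :=
  MvPolynomial.restrictTotalDegree (Fin d) ℂ N ⊓ LinearMap.ker (polyLaplacian d)

/-- Rank–nullity for the Laplacian from degree at most `n + 2` to degree at most `n`; its range is
at most the whole target, so surjectivity plays no role. -/
theorem le_finrank_harmonicPolynomial (m n : ℕ) :
    2 * ((n : ℝ) + 2) ^ m / m.factorial ≤
      Module.finrank ℂ (harmonicPolynomial (m + 1) (n + 2)) := by
  let D : MvPolynomial.restrictTotalDegree (Fin (m + 1)) ℂ (n + 2) →ₗ[ℂ]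
      MvPolynomial.restrictTotalDegree (Fin (m + 1)) ℂ n :=
    (polyLaplacian (m + 1)).restrict fun p hp => polyLaplacian_mem hp
  have h1 := D.finrank_range_add_finrank_ker
  have h2 : Module.finrank ℂ (LinearMap.range D) ≤ _ := Submodule.finrank_le _
  rw [finrank_restrictTotalDegree] at h1 h2
  have h3 : Module.finrank ℂ (LinearMap.ker D) ≤
      Module.finrank ℂ (harmonicPolynomial (m + 1) (n + 2)) := by
    have : FiniteDimensional ℂ (harmonicPolynomial (m + 1) (n + 2)) :=
      Submodule.finiteDimensional_inf_left _ _
    let g : LinearMap.ker D →ₗ[ℂ] harmonicPolynomial (m + 1) (n + 2) :=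
      { toFun := fun p => ⟨p.1.1, p.1.2, congrArg Subtype.val p.2⟩
        map_add' := fun _ _ => rfl
        map_smul' := fun _ _ => rfl }
    have hg : Function.Injective g := by
      intro p q h
      have h' : (g p).1 = (g q).1 := by rw [h]
      exact Subtype.ext (Subtype.ext h')
    exact LinearMap.finrank_le_finrank_of_injective hg
  -- Pascal's rule twice: the dimensions differ by two binomial coefficients, each at least `(n +
  -- 2)^m / m!`.
  have h4 : (m + 1 + (n + 2)).choose (m + 1) =
      (m + n + 2).choose m + ((m + n + 1).choose m + (m + 1 + n).choose (m + 1)) := by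
    rw [show m + 1 + (n + 2) = (m + n + 2) + 1 by omega, Nat.choose_succ_succ,
      Nat.succ_eq_add_one, show m + n + 2 = (m + n + 1) + 1 by omega,
      Nat.choose_succ_succ (m + n + 1) m, Nat.succ_eq_add_one]
    rw [show m + 1 + n = m + n + 1 by omega]
  have h5 : (m + n + 2).choose m + (m + n + 1).choose m ≤
      Module.finrank ℂ (harmonicPolynomial (m + 1) (n + 2)) := by omega
  have h6 := Nat.pow_le_choose (α := ℝ) m (m + n + 2)
  have h7 := Nat.pow_le_choose (α := ℝ) m (m + n + 1)
  rw [show m + n + 2 + 1 - m = n + 3 by omega] at h6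
  rw [show m + n + 1 + 1 - m = n + 2 by omega] at h7
  have h8 : ((n : ℝ) + 2) ^ m / m.factorial ≤ ((n + 3 : ℕ) : ℝ) ^ m / m.factorial := by
    gcongr
    push_cast
    linarith
  push_cast at h6 h7 h8
  have h9 : (((m + n + 2).choose m : ℕ) : ℝ) + ((m + n + 1).choose m : ℕ) ≤
      Module.finrank ℂ (harmonicPolynomial (m + 1) (n + 2)) := by exact_mod_cast h5
  rw [mul_div_assoc]
  linarith

theorem memLp_polyFun {p : MvPolynomial (Fin d) ℂ} (hp : polyLaplacian d p = 0) :
    MemLp (polyFun p) 2 (lebesgueOn (Metric.ball (0 : EuclideanSpace ℝ (Fin d)) 1)) :=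
  (harmonicOnBall_polyFun hp 2).memLp (by norm_num)

/-- Harmonic polynomials as elements of the harmonic subspace. -/
noncomputable def polyToLp (d N : ℕ) :
    harmonicPolynomial d N →ₗ[ℂ] harmonicL2 (Metric.ball (0 : EuclideanSpace ℝ (Fin d)) 1) where
  toFun p := ⟨(memLp_polyFun p.2.2).toLp (polyFun p), fun φ hφ => by
    rw [laplacian_eq_coordLaplacian hφ.contDiff,
      ← (harmonicOnBall_polyFun p.2.2 1).weaklyHarmonic φ hφ]
    refine integral_congr_ae ?_
    filter_upwards [(memLp_polyFun p.2.2).coeFn_toLp] with x hx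
    rw [hx]⟩
  map_add' p q := Subtype.ext <|
    (MemLp.toLp_congr (memLp_polyFun (p + q).2.2)
      ((memLp_polyFun p.2.2).add (memLp_polyFun q.2.2))
      (Eventually.of_forall fun x => by simp [polyFun])).trans
      (MemLp.toLp_add (memLp_polyFun p.2.2) (memLp_polyFun q.2.2))
  map_smul' a p := Subtype.ext <|
    (MemLp.toLp_congr (memLp_polyFun (a • p).2.2) ((memLp_polyFun p.2.2).const_smul a)
      (Eventually.of_forall fun x => by simp [polyFun])).trans
      (MemLp.toLp_const_smul a (memLp_polyFun p.2.2))

theorem harmonicRep_polyToLp {N : ℕ} (p : harmonicPolynomial d N) :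
    EqOn (harmonicRep (polyToLp d N p)) (polyFun p) (Metric.ball 0 1) := by
  refine Measure.eqOn_open_of_ae_eq (μ := volume) ?_ Metric.isOpen_ball
    (harmonicOnBall_harmonicRep _).contDiffOn.continuousOn
    (contDiff_polyFun _).continuous.continuousOn
  exact (harmonicRep_ae_eq _).trans (memLp_polyFun p.2.2).coeFn_toLp

theorem polyToLp_ne_zero {N : ℕ} {p : harmonicPolynomial d N} (hp : p ≠ 0) :
    polyToLp d N p ≠ 0 := by
  intro h0
  refine hp (Subtype.ext (eq_zero_of_polyFun_eqOn_zero one_pos fun x hx => ?_))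
  rw [← harmonicRep_polyToLp p hx, h0]
  have := harmonicRep_smul (d := d) 0 0 hx
  simpa using this

theorem energy_congr {f g : EuclideanSpace ℝ (Fin d) → ℂ} (h : EqOn f g (Metric.ball 0 1))
    {t : ℝ} (ht : 0 < t) (ht1 : t ≤ 1) : energy f t = energy g t := by
  refine setIntegral_congr_fun measurableSet_ball fun x hx => ?_
  have : t • x ∈ Metric.ball (0 : EuclideanSpace ℝ (Fin d)) 1 := by
    rw [mem_ball_zero_iff] at hx ⊢
    rw [norm_smul, Real.norm_of_nonneg ht.le]
    nlinarith [norm_nonneg x]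
  simp only [h this]

theorem le_energy_polyToLp {N : ℕ} (p : harmonicPolynomial d N) {t : ℝ} (ht : 0 < t)
    (ht1 : t < 1) : t ^ (2 * N) * ‖polyToLp d N p‖ ^ 2 ≤ energy (harmonicRep (polyToLp d N p)) t := by
  obtain ⟨C, hC⟩ := exists_norm_polyFun_le p.2.1
  rw [← energy_harmonicRep_one, energy_congr (harmonicRep_polyToLp p) one_pos le_rfl,
    energy_congr (harmonicRep_polyToLp p) ht ht1.le]
  exact le_energy_of_growth (harmonicOnBall_polyFun p.2.2) ht ht1 hC

end Polynomial

/-! ### The quadratic form of the Toeplitz operator -/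

section Toeplitz

variable {Ω : Set (EuclideanSpace ℝ (Fin d))} {V : EuclideanSpace ℝ (Fin d) → ℝ}

theorem coeFn_mulOperator {W : EuclideanSpace ℝ (Fin d) → ℂ} (hW : MemLp W ∞ (lebesgueOn Ω))
    (u : Lp ℂ 2 (lebesgueOn Ω)) :
    mulOperator hW u =ᵐ[lebesgueOn Ω] fun x => W x * u x := by
  filter_upwards [(ContinuousLinearMap.mul ℂ ℂ).coeFn_holder (r := 2) (hW.toLp W) u,
    hW.coeFn_toLp] with x h1 h2
  refine h1.trans ?_
  rw [h2]
  rfl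

/-- Against a vector of the harmonic subspace the orthogonal projection can be dropped. -/
theorem inner_toeplitz (hV : MemLp V ∞ (lebesgueOn Ω)) (u v : harmonicL2 Ω) :
    inner ℂ u (toeplitz hV.ofReal v) =
      ∫ x in Ω, (V x : ℂ) * ((v : Lp ℂ 2 (lebesgueOn Ω)) x *
        star ((u : Lp ℂ 2 (lebesgueOn Ω)) x)) := by
  change inner ℂ u ((harmonicL2 Ω).orthogonalProjectionOnto
    (mulOperator hV.ofReal (v : Lp ℂ 2 (lebesgueOn Ω)))) = _
  rw [Submodule.inner_orthogonalProjectionOnto_eq_of_mem_left, L2.inner_def]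
  refine integral_congr_ae ?_
  filter_upwards [coeFn_mulOperator hV.ofReal (v : Lp ℂ 2 (lebesgueOn Ω))] with x hx
  rw [hx, ← mul_assoc]
  rfl

theorem isSymmetric_toeplitz (hV : MemLp V ∞ (lebesgueOn Ω)) :
    (toeplitz hV.ofReal : harmonicL2 Ω →ₗ[ℂ] harmonicL2 Ω).IsSymmetric := by
  intro u v
  change inner ℂ (toeplitz hV.ofReal u) v = inner ℂ u (toeplitz hV.ofReal v)
  refine (inner_conj_symm (𝕜 := ℂ) (toeplitz hV.ofReal u) v).symm.trans ?_
  rw [inner_toeplitz hV, inner_toeplitz hV, ← integral_conj]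
  refine integral_congr_ae (Eventually.of_forall fun x => ?_)
  simp [mul_comm]

theorem re_inner_toeplitz (hV : MemLp V ∞ (lebesgueOn Ω)) (u : harmonicL2 Ω)
    {f : EuclideanSpace ℝ (Fin d) → ℂ} (hf : f =ᵐ[lebesgueOn Ω] (u : Lp ℂ 2 (lebesgueOn Ω))) :
    (inner ℂ u (toeplitz hV.ofReal u)).re = ∫ x in Ω, V x * ‖f x‖ ^ 2 := by
  have h : inner ℂ u (toeplitz hV.ofReal u) = ((∫ x in Ω, V x * ‖f x‖ ^ 2 : ℝ) : ℂ) := by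
    rw [inner_toeplitz hV, ← integral_complex_ofReal]
    refine integral_congr_ae ?_
    filter_upwards [hf] with x hx
    rw [hx, Complex.ofReal_mul, Complex.ofReal_pow, ← Complex.mul_conj']
    rfl
  rw [h, Complex.ofReal_re]

theorem norm_sq_eq_integral {μ : Measure (EuclideanSpace ℝ (Fin d))} (u : Lp ℂ 2 μ) :
    ‖u‖ ^ 2 = ∫ x, ‖u x‖ ^ 2 ∂μ := by
  rw [← norm_toLp_sq (Lp.memLp u), Lp.toLp_coeFn]

theorem norm_toeplitz_sq_le (hV : MemLp V ∞ (lebesgueOn Ω)) (u : harmonicL2 Ω)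
    {f : EuclideanSpace ℝ (Fin d) → ℂ} (hf : f =ᵐ[lebesgueOn Ω] (u : Lp ℂ 2 (lebesgueOn Ω))) :
    ‖toeplitz hV.ofReal u‖ ^ 2 ≤ ∫ x in Ω, V x ^ 2 * ‖f x‖ ^ 2 := by
  have h1 : ‖toeplitz hV.ofReal u‖ ≤ ‖mulOperator hV.ofReal (u : Lp ℂ 2 (lebesgueOn Ω))‖ := by
    change ‖(harmonicL2 Ω).orthogonalProjectionOnto
      (mulOperator hV.ofReal (u : Lp ℂ 2 (lebesgueOn Ω)))‖ ≤ _
    exact Submodule.norm_orthogonalProjectionOnto_apply_le (harmonicL2 Ω) _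
  refine (pow_le_pow_left₀ (norm_nonneg _) h1 2).trans (le_of_eq ?_)
  rw [norm_sq_eq_integral]
  refine integral_congr_ae ?_
  filter_upwards [hf, coeFn_mulOperator hV.ofReal (u : Lp ℂ 2 (lebesgueOn Ω))] with x hx hx'
  rw [hx', hx, norm_mul, mul_pow]
  simp

end Toeplitz

/-! ### Energy bounds from the support and size of the symbol -/

section Symbol

variable {V : EuclideanSpace ℝ (Fin d) → ℝ}

theorem setIntegral_ball_eq_energy (f : EuclideanSpace ℝ (Fin d) → ℂ) {t : ℝ} (ht : 0 < t) :
    ∫ x in Metric.ball 0 t, ‖f x‖ ^ 2 = t ^ d * energy f t := by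
  have h := Measure.setIntegral_comp_smul_of_pos volume (fun x => ‖f x‖ ^ 2)
    (Metric.ball (0 : EuclideanSpace ℝ (Fin d)) 1) ht
  rw [smul_unitBall_of_pos ht, finrank_euclideanSpace_fin, smul_eq_mul] at h
  rw [energy, h, mul_inv_cancel_left₀ (by positivity)]

/-- A general weight `W` serves both the quadratic form (`W = V`) and the operator norm (`W = V²`).
-/
theorem integral_mul_normSq_le {f : EuclideanSpace ℝ (Fin d) → ℂ} {W : EuclideanSpace ℝ (Fin d) → ℝ}
    {c M : ℝ} (hc : 0 < c) (hc1 : c ≤ 1) (hf : MemLp f 2 (lebesgueOn (Metric.ball 0 1)))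
    (hW0 : ∀ᵐ x ∂lebesgueOn (Metric.ball 0 1), 0 ≤ W x)
    (hWM : ∀ᵐ x ∂lebesgueOn (Metric.ball 0 1), W x ≤ M)
    (hWc : ∀ᵐ x ∂lebesgueOn (Metric.ball 0 1), x ∉ Metric.ball 0 c → W x = 0) :
    ∫ x in Metric.ball 0 1, W x * ‖f x‖ ^ 2 ≤ M * (c ^ d * energy f c) := by
  have hi : Integrable (fun x => M * ‖f x‖ ^ 2) (lebesgueOn (Metric.ball 0 1)) :=
    (hf.integrable_norm_pow two_ne_zero).const_mul M
  rw [← setIntegral_ball_eq_energy f hc, ← integral_const_mul,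
    ← Set.inter_eq_left.2 (Metric.ball_subset_ball hc1 :
      Metric.ball (0 : EuclideanSpace ℝ (Fin d)) c ⊆ Metric.ball 0 1),
    ← Measure.restrict_restrict measurableSet_ball, ← integral_indicator (measurableSet_ball (ε := c))]
  refine integral_mono_of_nonneg ?_ (hi.indicator measurableSet_ball) ?_
  · filter_upwards [hW0] with x hx
    exact mul_nonneg hx (by positivity)
  · filter_upwards [hWM, hWc] with x hx hx'
    by_cases hxc : x ∈ Metric.ball 0 c
    · rw [indicator_of_mem hxc]
      gcongr
    · rw [indicator_of_notMem hxc, hx' hxc, zero_mul]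

theorem le_integral_mul_normSq {f : EuclideanSpace ℝ (Fin d) → ℂ} {W : EuclideanSpace ℝ (Fin d) → ℝ}
    {δ a M : ℝ} (hδ : 0 < δ) (hδ1 : δ ≤ 1) (ha : 0 ≤ a)
    (hf : MemLp f 2 (lebesgueOn (Metric.ball 0 1)))
    (hWm : AEStronglyMeasurable W (lebesgueOn (Metric.ball 0 1)))
    (hW0 : ∀ᵐ x ∂lebesgueOn (Metric.ball 0 1), 0 ≤ W x)
    (hWM : ∀ᵐ x ∂lebesgueOn (Metric.ball 0 1), W x ≤ M)
    (hWa : ∀ᵐ x ∂lebesgueOn (Metric.ball 0 δ), a ≤ W x) :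
    a * (δ ^ d * energy f δ) ≤ ∫ x in Metric.ball 0 1, W x * ‖f x‖ ^ 2 := by
  have hsub : Metric.ball (0 : EuclideanSpace ℝ (Fin d)) δ ∩ Metric.ball 0 1 = Metric.ball 0 δ :=
    Set.inter_eq_left.2 (Metric.ball_subset_ball hδ1)
  -- Integrability matters for a lower bound, since the Bochner integral of a non-integrable
  -- function is zero.
  have hi : Integrable (fun x => W x * ‖f x‖ ^ 2) (lebesgueOn (Metric.ball 0 1)) := by
    refine (hf.integrable_norm_pow two_ne_zero).bdd_mul hWm (c := M) ?_
    filter_upwards [hW0, hWM] with x hx hx'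
    rwa [Real.norm_of_nonneg hx]
  rw [← setIntegral_ball_eq_energy f hδ, ← integral_const_mul, ← hsub,
    ← Measure.restrict_restrict measurableSet_ball, ← integral_indicator (measurableSet_ball (ε := δ))]
  rw [lebesgueOn, ← hsub, ← Measure.restrict_restrict measurableSet_ball,
    ae_restrict_iff' measurableSet_ball] at hWa
  refine integral_mono_of_nonneg ?_ hi ?_
  · refine Eventually.of_forall fun x => indicator_nonneg (fun y _ => ?_) x
    positivity
  · filter_upwards [hW0, hWa] with x hx hx'
    by_cases hxc : x ∈ Metric.ball 0 δ
    · rw [indicator_of_mem hxc]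
      exact mul_le_mul_of_nonneg_right (hx' hxc) (by positivity)
    · rw [indicator_of_notMem hxc]
      positivity

theorem exists_ae_le_of_memLp_top {X : Type*} {mX : MeasurableSpace X} {μ : Measure X} {f : X → ℝ}
    (hf : MemLp f ⊤ μ) : ∃ M, 1 ≤ M ∧ ∀ᵐ x ∂μ, f x ≤ M := by
  -- The maximum with 1 makes `Real.log M` nonnegative, which the later choice of the order of
  -- vanishing uses.
  refine ⟨max 1 (eLpNormEssSup f μ).toReal, le_max_left _ _, ?_⟩
  have htop : eLpNormEssSup f μ ≠ ⊤ := by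
    rw [← eLpNorm_exponent_top]
    exact hf.eLpNorm_ne_top
  filter_upwards [ae_le_eLpNormEssSup (f := f) (μ := μ)] with x hx
  refine (le_abs_self _).trans (le_trans ?_ (le_max_right _ _))
  rw [← Real.norm_eq_abs, ← toReal_enorm]
  exact ENNReal.toReal_mono htop hx

theorem exists_pos_ae_le_of_essInf_pos {X : Type*} {mX : MeasurableSpace X} {μ : Measure X}
    {f : X → ℝ} (hf : 0 < essInf f μ) : ∃ a, 0 < a ∧ ∀ᵐ x ∂μ, a ≤ f x := by
  rw [essInf, liminf_eq] at hf
  -- The real `essInf` is a supremum of essential lower bounds; were there none, it would default to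
  -- 0, against positivity.
  have hne : {a | ∀ᶠ x in ae μ, a ≤ f x}.Nonempty := by
    by_contra h
    rw [not_nonempty_iff_eq_empty] at h
    rw [h, Real.sSup_empty] at hf
    exact lt_irrefl _ hf
  obtain ⟨a, ha, ha0⟩ := exists_lt_of_lt_csSup hne hf
  exact ⟨a, ha0, ha⟩

/-- The exceptional set is locally null, and second countability makes a locally null set null. -/
theorem ae_eq_zero_of_notMem_essSupport {X : Type*} [TopologicalSpace X]
    [SecondCountableTopology X] [MeasurableSpace X] {μ : Measure X} {f : X → ℝ} :
    ∀ᵐ x ∂μ, x ∉ essSupport μ f → f x = 0 := by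
  rw [ae_iff]
  refine measure_null_of_locally_null _ fun x hx => ?_
  obtain ⟨hx, -⟩ := Classical.not_imp.1 hx
  simp only [essSupport, mem_ofPred_eq, not_forall, not_not] at hx
  obtain ⟨U, hU, hfU⟩ := hx
  refine ⟨{y | f y ≠ 0} ∩ U, inter_mem (mem_of_superset self_mem_nhdsWithin ?_)
    (mem_nhdsWithin_of_mem_nhds hU), ?_⟩
  · exact fun y hy h => hy fun _ => h
  · exact le_antisymm ((Measure.le_restrict_apply _ _).trans (ae_iff.1 hfU).le) zero_le

/-- The sphere of radius `c` is a null set, so the closed ball may be replaced by the open one. -/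
theorem ae_eq_zero_of_essSupport_eq {c : ℝ} (hc : 0 < c)
    (hV : essSupport (lebesgueOn (Metric.ball 0 1)) V = Metric.closedBall 0 c) :
    ∀ᵐ x ∂lebesgueOn (Metric.ball (0 : EuclideanSpace ℝ (Fin d)) 1),
      x ∉ Metric.ball 0 c → V x = 0 := by
  have hs : ∀ᵐ x ∂lebesgueOn (Metric.ball (0 : EuclideanSpace ℝ (Fin d)) 1),
      x ∉ Metric.sphere 0 c :=
    ae_restrict_of_ae (measure_eq_zero_iff_ae_notMem.1
      (Measure.addHaar_sphere_of_ne_zero volume 0 hc.ne'))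
  filter_upwards [hs, ae_eq_zero_of_notMem_essSupport (μ := lebesgueOn (Metric.ball 0 1)) (f := V)]
    with x hx hx' hxc
  refine hx' fun hmem => ?_
  rw [hV, ← Metric.ball_union_sphere] at hmem
  exact hmem.elim hxc hx

end Symbol

/-! ### Limits from two-sided polynomial bounds -/

section Asymptotics

theorem tendsto_linear_pow_div_pow (m : ℕ) (b A : ℝ) :
    Tendsto (fun x : ℝ => 2 * (b * x + A) ^ m / m.factorial / x ^ m) atTop
      (𝓝 (2 * b ^ m / m.factorial)) := by
  have h : Tendsto (fun x : ℝ => 2 * (b + A / x) ^ m / m.factorial) atTop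
      (𝓝 (2 * (b + 0) ^ m / m.factorial)) :=
    (((tendsto_const_nhds.add (tendsto_const_nhds.div_atTop tendsto_id)).pow m).const_mul
      2).div_const _
  rw [add_zero] at h
  refine h.congr' ?_
  filter_upwards [eventually_gt_atTop 0] with x hx
  rw [show b + A / x = (b * x + A) / x by field_simp, div_pow]
  field_simp

/-- The constants `A` are absorbed as `L → ∞`. The lower bound is only asked for slopes with `γ >
β`, because the symbol is bounded below only on balls strictly inside its support; continuity in `γ`
closes the gap. -/
theorem tendsto_div_pow_of_linear_pow_bounds {ι : Type*} {l : Filter ι} {L F : ι → ℝ} {m : ℕ}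
    {β : ℝ} (hβ : 0 < β) (hL : Tendsto L l atTop)
    (hup : ∃ A, ∀ᶠ s in l, F s ≤ 2 * ((2 * β)⁻¹ * L s + A) ^ m / m.factorial)
    (hlow : ∀ γ > β, ∃ A, ∀ᶠ s in l, 2 * ((2 * γ)⁻¹ * L s + A) ^ m / m.factorial ≤ F s) :
    Tendsto (fun s => F s / L s ^ m) l (𝓝 (2 * (2 * β)⁻¹ ^ m / m.factorial)) := by
  refine tendsto_order.2 ⟨fun a ha => ?_, fun b hb => ?_⟩
  · have hcont : ContinuousAt (fun γ : ℝ => 2 * (2 * γ)⁻¹ ^ m / m.factorial) β :=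
      ((((continuousAt_id.const_mul 2).inv₀ (by simpa using hβ.ne')).pow m).const_mul 2).div_const _
    have hev := (hcont.eventually (lt_mem_nhds ha)).filter_mono
      (nhdsWithin_le_nhds (s := Ioi β))
    obtain ⟨γ, hγ, hγβ⟩ := (hev.and self_mem_nhdsWithin).exists
    obtain ⟨A, hA⟩ := hlow γ hγβ
    filter_upwards [hA, hL.eventually_gt_atTop 0,
      ((tendsto_linear_pow_div_pow m _ A).comp hL).eventually (lt_mem_nhds hγ)] with s h1 h2 h3
    exact h3.trans_le (by simp only [Function.comp]; gcongr)
  · obtain ⟨A, hA⟩ := hup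
    filter_upwards [hA, hL.eventually_gt_atTop 0,
      ((tendsto_linear_pow_div_pow m _ A).comp hL).eventually (gt_mem_nhds hb)] with s h1 h2 h3
    refine lt_of_le_of_lt ?_ h3
    simp only [Function.comp]
    gcongr

end Asymptotics

/-! ### Comparison of the Toeplitz operator with the energy -/

section Counting

variable {V : EuclideanSpace ℝ (Fin d) → ℝ} {c M : ℝ}

theorem re_inner_toeplitz_le (hV : MemLp V ∞ (lebesgueOn (Metric.ball 0 1)))
    (hV0 : ∀ᵐ x ∂lebesgueOn (Metric.ball 0 1), 0 ≤ V x)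
    (hVM : ∀ᵐ x ∂lebesgueOn (Metric.ball 0 1), V x ≤ M)
    (hVc : ∀ᵐ x ∂lebesgueOn (Metric.ball 0 1), x ∉ Metric.ball 0 c → V x = 0)
    (hc : 0 < c) (hc1 : c ≤ 1) (u : harmonicL2 (Metric.ball (0 : EuclideanSpace ℝ (Fin d)) 1)) :
    (inner ℂ u (toeplitz hV.ofReal u)).re ≤ M * (c ^ d * energy (harmonicRep u) c) := by
  rw [re_inner_toeplitz hV u (harmonicRep_ae_eq u)]
  exact integral_mul_normSq_le hc hc1 (memLp_harmonicRep u) hV0 hVM hVc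

theorem norm_toeplitz_sq_le_energy (hV : MemLp V ∞ (lebesgueOn (Metric.ball 0 1)))
    (hV0 : ∀ᵐ x ∂lebesgueOn (Metric.ball 0 1), 0 ≤ V x)
    (hVM : ∀ᵐ x ∂lebesgueOn (Metric.ball 0 1), V x ≤ M)
    (hVc : ∀ᵐ x ∂lebesgueOn (Metric.ball 0 1), x ∉ Metric.ball 0 c → V x = 0)
    (hc : 0 < c) (hc1 : c ≤ 1) (u : harmonicL2 (Metric.ball (0 : EuclideanSpace ℝ (Fin d)) 1)) :
    ‖toeplitz hV.ofReal u‖ ^ 2 ≤ M ^ 2 * (c ^ d * energy (harmonicRep u) c) := by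
  refine (norm_toeplitz_sq_le hV u (harmonicRep_ae_eq u)).trans
    (integral_mul_normSq_le hc hc1 (memLp_harmonicRep u) ?_ ?_ ?_)
  · exact Eventually.of_forall fun x => sq_nonneg _
  · filter_upwards [hV0, hVM] with x hx hx'
    exact pow_le_pow_left₀ hx hx' 2
  · filter_upwards [hVc] with x hx hxc
    rw [hx hxc, zero_pow two_ne_zero]

theorem le_re_inner_toeplitz {δ a : ℝ} (hV : MemLp V ∞ (lebesgueOn (Metric.ball 0 1)))
    (hV0 : ∀ᵐ x ∂lebesgueOn (Metric.ball 0 1), 0 ≤ V x)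
    (hVM : ∀ᵐ x ∂lebesgueOn (Metric.ball 0 1), V x ≤ M)
    (hVa : ∀ᵐ x ∂lebesgueOn (Metric.ball 0 δ), a ≤ V x) (ha : 0 ≤ a)
    (hδ : 0 < δ) (hδ1 : δ ≤ 1) (u : harmonicL2 (Metric.ball (0 : EuclideanSpace ℝ (Fin d)) 1)) :
    a * (δ ^ d * energy (harmonicRep u) δ) ≤ (inner ℂ u (toeplitz hV.ofReal u)).re := by
  rw [re_inner_toeplitz hV u (harmonicRep_ae_eq u)]
  exact le_integral_mul_normSq hδ hδ1 ha (memLp_harmonicRep u) hV.1 hV0 hVM hVa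

end Counting

/-! ### Bounds for the counting function and its limit -/

section Dimension

variable {m : ℕ} {V : EuclideanSpace ℝ (Fin (m + 1)) → ℝ} {c M : ℝ}

theorem energy_harmonicRep_le {K : ℕ} (hc : 0 < c) (hc1 : c < 1)
    {u : harmonicL2 (Metric.ball (0 : EuclideanSpace ℝ (Fin (m + 1))) 1)}
    (hu : jets m K u = 0) : energy (harmonicRep u) c ≤ c ^ (2 * K) * ‖u‖ ^ 2 := by
  rw [← energy_harmonicRep_one]
  exact energy_le_of_isBigO (harmonicOnBall_harmonicRep u) (memLp_harmonicRep u) hc hc1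
    (isBigO_harmonicRep_of_jets_eq_zero hu)

/-- Once the jet of order `K` vanishes, `‖T u‖ ≤ M c^K ‖u‖`, and the jet is a finite set of linear
conditions. -/
theorem isCompactOperator_toeplitz (hV : MemLp V ∞ (lebesgueOn (Metric.ball 0 1)))
    (hV0 : ∀ᵐ x ∂lebesgueOn (Metric.ball 0 1), 0 ≤ V x)
    (hVM : ∀ᵐ x ∂lebesgueOn (Metric.ball 0 1), V x ≤ M)
    (hVc : ∀ᵐ x ∂lebesgueOn (Metric.ball 0 1), x ∉ Metric.ball 0 c → V x = 0)
    (hc : 0 < c) (hc1 : c < 1) (hM : 0 < M) : IsCompactOperator (toeplitz hV.ofReal) := by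
  refine isCompactOperator_of_small_on_ker fun ε hε => ?_
  obtain ⟨K, hK⟩ := exists_pow_lt_of_lt_one (div_pos hε hM) hc1
  have hK' : M * c ^ K ≤ ε := by
    rw [lt_div_iff₀ hM] at hK
    linarith
  let e := Fintype.equivFin (MultiIndex m K ⊕ MultiIndex m K)
  refine ⟨_, (LinearEquiv.funCongrLeft ℂ ℂ e.symm).toLinearMap ∘ₗ jets m K, fun u hu => ?_⟩
  have hu' : jets m K u = 0 := (LinearEquiv.map_eq_zero_iff (LinearEquiv.funCongrLeft ℂ ℂ e.symm)).1 hu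
  refine (pow_le_pow_iff_left₀ (norm_nonneg _) (by positivity) two_ne_zero).1 ?_
  calc ‖toeplitz hV.ofReal u‖ ^ 2 ≤ M ^ 2 * (c ^ (m + 1) * energy (harmonicRep u) c) :=
        norm_toeplitz_sq_le_energy hV hV0 hVM hVc hc hc1.le u
    _ ≤ M ^ 2 * (1 * (c ^ (2 * K) * ‖u‖ ^ 2)) := by
        have h1 := pow_le_one₀ (n := m + 1) hc.le hc1.le
        have h2 := energy_harmonicRep_le hc hc1 hu'
        have h3 := energy_nonneg (harmonicRep u) c
        gcongr
    _ = (M * c ^ K * ‖u‖) ^ 2 := by ring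
    _ ≤ (ε * ‖u‖) ^ 2 := by gcongr

theorem re_inner_toeplitz_le_of_jets_eq_zero (hV : MemLp V ∞ (lebesgueOn (Metric.ball 0 1)))
    (hV0 : ∀ᵐ x ∂lebesgueOn (Metric.ball 0 1), 0 ≤ V x)
    (hVM : ∀ᵐ x ∂lebesgueOn (Metric.ball 0 1), V x ≤ M)
    (hVc : ∀ᵐ x ∂lebesgueOn (Metric.ball 0 1), x ∉ Metric.ball 0 c → V x = 0)
    (hc : 0 < c) (hc1 : c < 1) (hM : 0 ≤ M) {s : ℝ} {K : ℕ} (hs : M * c ^ (2 * K) ≤ s)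
    {u : harmonicL2 (Metric.ball (0 : EuclideanSpace ℝ (Fin (m + 1))) 1)} (hu : jets m K u = 0) :
    (inner ℂ u (toeplitz hV.ofReal u)).re ≤ s * ‖u‖ ^ 2 :=
  calc (inner ℂ u (toeplitz hV.ofReal u)).re ≤ M * (c ^ (m + 1) * energy (harmonicRep u) c) :=
        re_inner_toeplitz_le hV hV0 hVM hVc hc hc1.le u
    _ ≤ M * (1 * (c ^ (2 * K) * ‖u‖ ^ 2)) := by
        have h1 := pow_le_one₀ (n := m + 1) hc.le hc1.le
        have h2 := energy_harmonicRep_le hc hc1 hu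
        have h3 := energy_nonneg (harmonicRep u) c
        gcongr
    _ = M * c ^ (2 * K) * ‖u‖ ^ 2 := by ring
    _ ≤ s * ‖u‖ ^ 2 := by gcongr

theorem nPlus_toeplitz_le (hV : MemLp V ∞ (lebesgueOn (Metric.ball 0 1)))
    (hV0 : ∀ᵐ x ∂lebesgueOn (Metric.ball 0 1), 0 ≤ V x)
    (hVM : ∀ᵐ x ∂lebesgueOn (Metric.ball 0 1), V x ≤ M)
    (hVc : ∀ᵐ x ∂lebesgueOn (Metric.ball 0 1), x ∉ Metric.ball 0 c → V x = 0)
    (hc : 0 < c) (hc1 : c < 1) (hM : 0 ≤ M) {s : ℝ} {K : ℕ} (hs : M * c ^ (2 * (K + 1)) ≤ s) :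
    (nPlus s (toeplitz hV.ofReal) : ℝ) ≤ 2 * ((m : ℝ) + K) ^ m / m.factorial :=
  (Nat.cast_le.2 (nPlus_le_finrank (isSymmetric_toeplitz hV) (jets m (K + 1)) fun _ hu =>
    re_inner_toeplitz_le_of_jets_eq_zero hV hV0 hVM hVc hc hc1 hM hs hu)).trans
    (finrank_jets_le m K)

theorem le_nPlus_toeplitz {δ a : ℝ} (hV : MemLp V ∞ (lebesgueOn (Metric.ball 0 1)))
    (hV0 : ∀ᵐ x ∂lebesgueOn (Metric.ball 0 1), 0 ≤ V x)
    (hVM : ∀ᵐ x ∂lebesgueOn (Metric.ball 0 1), V x ≤ M)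
    (hVc : ∀ᵐ x ∂lebesgueOn (Metric.ball 0 1), x ∉ Metric.ball 0 c → V x = 0)
    (hVa : ∀ᵐ x ∂lebesgueOn (Metric.ball 0 δ), a ≤ V x)
    (hc : 0 < c) (hc1 : c < 1) (hM : 0 < M) (ha : 0 ≤ a) (hδ : 0 < δ) (hδ1 : δ < 1)
    {s : ℝ} (hs0 : 0 < s) {n : ℕ} (hs : s < a * δ ^ (m + 1 + 2 * (n + 2))) :
    2 * ((n : ℝ) + 2) ^ m / m.factorial ≤ nPlus s (toeplitz hV.ofReal) := by
  -- Any `K` large enough will do: it serves only to show that the upper space is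
  -- finite-dimensional.
  obtain ⟨K, hK⟩ := exists_pow_lt_of_lt_one (div_pos hs0 hM) hc1
  have hK' : M * c ^ (2 * K) ≤ s := by
    rw [lt_div_iff₀ hM] at hK
    have : c ^ (2 * K) ≤ c ^ K := pow_le_pow_of_le_one hc.le hc1.le (by omega)
    nlinarith
  have : FiniteDimensional ℂ (upperSpace s (toeplitz hV.ofReal)) :=
    finiteDimensional_upperSpace (isSymmetric_toeplitz hV) (jets m K) fun _ hu =>
      re_inner_toeplitz_le_of_jets_eq_zero hV hV0 hVM hVc hc hc1 hM.le hK' hu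
  refine (le_finrank_harmonicPolynomial m n).trans (Nat.cast_le.2
    (finrank_le_nPlus (isSymmetric_toeplitz hV)
      (isCompactOperator_toeplitz hV hV0 hVM hVc hc hc1 hM) (polyToLp (m + 1) (n + 2))
      fun p hp => ?_))
  have hpos : 0 < ‖polyToLp (m + 1) (n + 2) p‖ ^ 2 :=
    pow_pos (norm_pos_iff.2 (polyToLp_ne_zero hp)) 2
  calc s * ‖polyToLp (m + 1) (n + 2) p‖ ^ 2
      < a * δ ^ (m + 1 + 2 * (n + 2)) * ‖polyToLp (m + 1) (n + 2) p‖ ^ 2 := by gcongr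
    _ = a * (δ ^ (m + 1) * (δ ^ (2 * (n + 2)) * ‖polyToLp (m + 1) (n + 2) p‖ ^ 2)) := by ring
    _ ≤ a * (δ ^ (m + 1) * energy (harmonicRep (polyToLp (m + 1) (n + 2) p)) δ) := by
        gcongr
        exact le_energy_polyToLp p hδ hδ1
    _ ≤ _ := le_re_inner_toeplitz hV hV0 hVM hVa ha hδ hδ1.le _

theorem tendsto_nPlus_toeplitz (hV : MemLp V ∞ (lebesgueOn (Metric.ball 0 1)))
    (hV0 : ∀ᵐ x ∂lebesgueOn (Metric.ball 0 1), 0 ≤ V x)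
    (hVM : ∀ᵐ x ∂lebesgueOn (Metric.ball 0 1), V x ≤ M)
    (hVc : ∀ᵐ x ∂lebesgueOn (Metric.ball 0 1), x ∉ Metric.ball 0 c → V x = 0)
    (hVa : ∀ δ ∈ Ioo 0 c, ∃ a, 0 < a ∧ ∀ᵐ x ∂lebesgueOn (Metric.ball 0 δ), a ≤ V x)
    (hc : 0 < c) (hc1 : c < 1) (hM : 1 ≤ M) :
    Tendsto (fun s : ℝ => (nPlus s (toeplitz hV.ofReal) : ℝ) / |Real.log s| ^ m) (𝓝[>] 0)
      (𝓝 (2 * (2 * |Real.log c|)⁻¹ ^ m / m.factorial)) := by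
  have hlogc : Real.log c < 0 := Real.log_neg hc hc1
  have hβ : 0 < |Real.log c| := abs_pos.2 hlogc.ne
  have hM0 : 0 < M := by linarith
  have hL : Tendsto (fun s : ℝ => |Real.log s|) (𝓝[>] 0) atTop :=
    tendsto_abs_atBot_atTop.comp Real.tendsto_log_nhdsGT_zero
  have hpos : ∀ᶠ s : ℝ in 𝓝[>] 0, 0 < s := self_mem_nhdsWithin
  have hlt : ∀ᶠ s : ℝ in 𝓝[>] 0, s < 1 := nhdsWithin_le_nhds (gt_mem_nhds one_pos)
  refine tendsto_div_pow_of_linear_pow_bounds hβ hL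
    ⟨(2 * |Real.log c|)⁻¹ * Real.log M + 1 + m, ?_⟩ fun γ hγ => ?_
  · filter_upwards [hpos, hlt] with s hs hs1
    have habs : |Real.log s| = -Real.log s := abs_of_neg (Real.log_neg hs hs1)
    have hx : 0 ≤ (2 * |Real.log c|)⁻¹ * (|Real.log s| + Real.log M) := by
      have := Real.log_nonneg hM
      positivity
    -- The least integer `K` with `M c^(2K) ≤ s`, obtained by taking logarithms and rounding up.
    obtain ⟨K, hK1, hK2⟩ : ∃ K : ℕ, (2 * |Real.log c|)⁻¹ * (|Real.log s| + Real.log M) ≤ K ∧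
        (K : ℝ) ≤ (2 * |Real.log c|)⁻¹ * (|Real.log s| + Real.log M) + 1 :=
      ⟨_, Nat.le_ceil _, (Nat.ceil_lt_add_one hx).le⟩
    have hKs : M * c ^ (2 * (K + 1)) ≤ s := by
      rw [← Real.log_le_log_iff (by positivity) hs, Real.log_mul hM0.ne' (by positivity),
        Real.log_pow]
      rw [inv_mul_le_iff₀ (by positivity), habs, abs_of_neg hlogc] at hK1
      push_cast
      nlinarith
    refine (nPlus_toeplitz_le hV hV0 hVM hVc hc hc1 hM0.le hKs).trans ?_
    have h1 : (m : ℝ) + K ≤ (2 * |Real.log c|)⁻¹ * |Real.log s| +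
        ((2 * |Real.log c|)⁻¹ * Real.log M + 1 + m) := by linarith
    gcongr
  · have hγ0 : 0 < γ := hβ.trans hγ
    have hδc : Real.exp (-γ) < c := by
      rw [← Real.lt_log_iff_exp_lt hc]
      rw [abs_of_neg hlogc] at hγ
      linarith
    obtain ⟨a, ha, hVa'⟩ := hVa (Real.exp (-γ)) ⟨Real.exp_pos _, hδc⟩
    -- With `δ = exp(-γ)`, the requirement `s < a δ^(m+1+2(n+2))` reads `2γ(n+2) < |log s| - (B -
    -- 1)`; the extra 1 makes it strict.
    set B := (m + 1) * γ - Real.log a + 1 with hB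
    refine ⟨-((2 * γ)⁻¹ * B) - 1, ?_⟩
    filter_upwards [hpos, hlt, hL.eventually_ge_atTop (B + 2 * γ * 2)] with s hs hs1 hsB
    have habs : |Real.log s| = -Real.log s := abs_of_neg (Real.log_neg hs hs1)
    have hx : 2 ≤ (2 * γ)⁻¹ * (|Real.log s| - B) := by
      rw [le_inv_mul_iff₀ (by positivity)]
      linarith
    -- The largest admissible degree `n + 2`, rounded down; `s` is already small enough for it to be
    -- at least 2.
    obtain ⟨n, hn1, hn2⟩ : ∃ n : ℕ, ((n : ℝ) + 2) ≤ (2 * γ)⁻¹ * (|Real.log s| - B) ∧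
        (2 * γ)⁻¹ * (|Real.log s| - B) - 1 ≤ (n : ℝ) + 2 := by
      obtain ⟨n, hn⟩ := Nat.exists_eq_add_of_le' (Nat.le_floor (by exact_mod_cast hx) :
        2 ≤ ⌊(2 * γ)⁻¹ * (|Real.log s| - B)⌋₊)
      have h1 := Nat.floor_le (by linarith : 0 ≤ (2 * γ)⁻¹ * (|Real.log s| - B))
      have h2 := Nat.lt_floor_add_one ((2 * γ)⁻¹ * (|Real.log s| - B))
      rw [hn] at h1 h2
      push_cast at h1 h2
      exact ⟨n, h1, by linarith⟩
    have hns : s < a * Real.exp (-γ) ^ (m + 1 + 2 * (n + 2)) := by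
      rw [← Real.log_lt_log_iff hs (by positivity), Real.log_mul ha.ne' (by positivity),
        Real.log_pow, Real.log_exp]
      rw [le_inv_mul_iff₀ (by positivity), habs, hB] at hn1
      push_cast
      nlinarith
    refine le_trans ?_ (le_nPlus_toeplitz hV hV0 hVM hVc hVa' hc hc1 hM0 ha.le (Real.exp_pos _)
      (hδc.trans hc1) hs hns)
    have h0 : 0 ≤ (2 * γ)⁻¹ * |Real.log s| + (-((2 * γ)⁻¹ * B) - 1) := by linarith
    have h1 : (2 * γ)⁻¹ * |Real.log s| + (-((2 * γ)⁻¹ * B) - 1) ≤ (n : ℝ) + 2 := by linarith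
    gcongr

end Dimension

end HarmonicToeplitz

theorem proposition4p1 (d : ℕ) (hd : 2 ≤ d) (c : ℝ) (hc : c ∈ Set.Ioo (0 : ℝ) 1)
    (V : EuclideanSpace ℝ (Fin d) → ℝ)
    (hV : MemLp V ∞ (HarmonicToeplitz.lebesgueOn (Metric.ball 0 1)))
    (hV_nonneg : ∀ᵐ x ∂(HarmonicToeplitz.lebesgueOn (Metric.ball 0 1)), 0 ≤ V x)
    (hV_supp : HarmonicToeplitz.essSupport (HarmonicToeplitz.lebesgueOn (Metric.ball 0 1)) V =
      Metric.closedBall 0 c)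
    (hV_inf : ∀ δ ∈ Set.Ioo (0 : ℝ) c,
      0 < essInf V (HarmonicToeplitz.lebesgueOn (Metric.ball 0 δ))) :
    IsSelfAdjoint (HarmonicToeplitz.toeplitz hV.ofReal) ∧
    IsCompactOperator (HarmonicToeplitz.toeplitz hV.ofReal) ∧
    Tendsto
      (fun s : ℝ => |Real.log s| ^ (-(d : ℤ) + 1) *
        (HarmonicToeplitz.nPlus s (HarmonicToeplitz.toeplitz hV.ofReal) : ℝ))
      (𝓝[>] 0)
      (𝓝 ((2 : ℝ) ^ (-(d : ℤ) + 2) / ((d - 1).factorial * |Real.log c| ^ (d - 1)))) := by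
  obtain ⟨m, rfl⟩ := Nat.exists_eq_add_of_le' (one_le_two.trans hd)
  obtain ⟨M, hM, hVM⟩ := HarmonicToeplitz.exists_ae_le_of_memLp_top hV
  have hVc := HarmonicToeplitz.ae_eq_zero_of_essSupport_eq hc.1 hV_supp
  refine ⟨ContinuousLinearMap.isSelfAdjoint_iff_isSymmetric.2
      (HarmonicToeplitz.isSymmetric_toeplitz hV),
    HarmonicToeplitz.isCompactOperator_toeplitz hV hV_nonneg hVM hVc hc.1 hc.2
      (one_pos.trans_le hM), ?_⟩
  have h := HarmonicToeplitz.tendsto_nPlus_toeplitz hV hV_nonneg hVM hVc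
    (fun δ hδ => HarmonicToeplitz.exists_pos_ae_le_of_essInf_pos (hV_inf δ hδ)) hc.1 hc.2 hM
  have h1 : -((m + 1 : ℕ) : ℤ) + 1 = -(m : ℤ) := by push_cast; ring
  have h2 : -((m + 1 : ℕ) : ℤ) + 2 = 1 - (m : ℤ) := by push_cast; ring
  rw [h1, h2, zpow_sub₀ two_ne_zero, zpow_one, zpow_natCast, Nat.add_sub_cancel]
  convert h using 2
  · rw [zpow_neg, zpow_natCast, div_eq_inv_mul]
  · rw [inv_pow, mul_pow]
    field_simp
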